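/- Let $0<k<1$, $\mu,\mu_0,\mu_1>0$, $\kappa_j=\mu_j/\mu$, and assume $\kappa_0=\kappa_1\neq 1$. Let $\tau,\tau^\infty,c_{-1}\in\mathbb C$ with $\tau\ne0$, $c_{-1}\neq 0$, and put $$\lambda_j=\frac{\mu_j}{1-\kappa_j},\quad \tilde\lambda_0=\frac{\kappa_0}{1-\kappa_0},\quad c=\frac{\bar\tau^\infty-\bar\tau}{\mu}c_{-1},\quad c''=\operatorname{Im}c,\quad c_*=\operatorname{Re}\Big[c_{-1}\Big(\frac{\bar\tau^\infty}{\mu}-\frac{\bar\tau}{\mu_0}\Big)\Big],$$ $|q(\xi)|=\sqrt{|(\xi^2-1)(\xi^2-k^2)|}$, $I=\int_k^1\frac{d\xi}{|q(\xi)|}$, $J=\int_k^1\frac{d\xi}{\xi|q(\xi)|}$ (both integrals converge). Let $\mathcal D^e$ be the extended plane cut along the two-sided slits $l_0$, $l_1$ over $[-1,-k]$ and $[k,1]$. "Admissible" functions are analytic in $\mathcal D^e\setminus\{0\}$ (including at $\infty$), continuous up to both banks of the slits (tips included), and have a prescribed principal part at $\zeta=0$. First Schwarz problem, for real $a_0,a_1$: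 find an admissible $F$ with principal part $c/\zeta$ and $\operatorname{Im}F=a_j$ on $l_j$. Second Schwarz problem, for a solution $F$ of the first and real $d_0',d_1'$: find an admissible $\omega$ with principal part $c_{-1}/\zeta$ and $\operatorname{Re}[\bar\tau\omega]=\lambda_j(\operatorname{Re}F-d_j')$ on $l_j$. Put $\beta_0=\operatorname{Re}F(\infty)$, $\rho_j'=\beta_0-d_j'$, $\rho_j=\lambda_j\rho_j'$, $\gamma_0=\operatorname{Re}[i\bar\tau\omega(\infty)]$. Let $g_0(\xi)=\operatorname{Re}\big[\frac{c_{-1}}{\xi}\big(\frac{\bar\tau^\infty}{\mu}-\frac{\bar\tau}{\mu_0}\big)\big]$ and, with principal values, $$g_1(\xi)=\frac{|q(\xi)|}{\pi}\Big\{\int_{-1}^{-k}\Big[a_0-\operatorname{Im}\frac{c}{\eta}\Big]\frac{d\eta}{|q(\eta)|(\eta-\xi)}-\int_{k}^{1}\Big[a_1-\operatorname{Im}\frac{c}{\eta}\Big]\frac{d\eta}{|q(\eta)|(\eta-\xi)}\Big\}.$$ Then: 1. The first problem is solvable if and only if $a_1-a_0=2c''J/I$; the only antisymmetric choice of the constants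 for which it is solvable is $a_1=-a_0=c''\,I^{-1}J$. 2. For every solution $F$ of the first problem, the second problem is solvable if and only if $\rho_1-\rho_0=-2\frac{\mu_0c_*}{1-\kappa_0}I^{-1}J$; the only antisymmetric choice for which it is solvable is $\rho_1=-\rho_0=-\frac{\mu_0c_*}{1-\kappa_0}I^{-1}J$. 3. The function $g_0$ is odd and $g_0(\xi)=c_*/\xi$ for $k\le|\xi|\le1$. If $a_1=-a_0$, then for $k<|\xi|<1$ the principal values exist, $g_1$ is odd, and $$g_1(\xi)=\frac{2\xi|q(\xi)|}{\pi}\int_k^1\Big(\frac{c''}{\eta}-a_1\Big)\frac{d\eta}{|q(\eta)|(\eta^2-\xi^2)}.$$ 4. Let $F$, $\omega$ solve the two problems with $a_1=-a_0$, $\rho_1=-\rho_0$. Subtracting the constant $-i\gamma_0/\bar\tau$ from $\omega$ gives again a solution of the second problem, now with $\gamma_0=0$. If $\gamma_0=0$, then for $k<\xi<1$ (upper signs together, lower signs together; the principal values exist) $$\omega(-\xi\mp i0)=-\frac{c_{-1}}{\xi}+\frac{i\mu\tilde\lambda_0}{\bar\tau}\Big\{\mp ig_1(\xi)+ig_0(\xi)+i\rho_1'+\frac1\pi\sum_{j=0}^1(-1)^j\int_k^1\Big[-g_1(\eta)\pm\frac{|q(\xi)|}{|q(\eta)|}(g_0(\eta)+\rho_1')\Big]\frac{d\eta}{\eta-(-1)^j\xi}\Big\},$$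 and for all $\xi\in[k,1]$ $$\omega(\xi\pm i0)=-\omega(-\xi\mp i0).$$ Consequently the contours $L_j=\omega(l_j)$ and the inclusions $D_j$ (the sets of points enclosed by $L_j$, i.e. the unions of the bounded components of $\mathbb C\setminus L_j$) satisfy $L_1=-L_0$ and $D_1=-D_0$: the two inclusions are symmetric with respect to the origin. -/

import Mathlib

open Filter Topology MeasureTheory
open scoped ComplexConjugate

noncomputable section

namespace TwoSlit

/-! ### The slit domain and boundary values on the two banks -/

/-- Left end points of the two slits `l₀ = [-1,-k]`, `l₁ = [k,1]`. -/
def lo (k : ℝ) : Fin 2 → ℝ := ![-1, k]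

/-- Right end points of the two slits. -/
def hi (k : ℝ) : Fin 2 → ℝ := ![-k, 1]

/-- The segment carrying the two-sided slit `l_j`. -/
def slit (k : ℝ) (j : Fin 2) : Set ℝ := Set.Icc (lo k j) (hi k j)

/-- The finite part of the canonical domain: the plane cut along the two slits
(the point at infinity is treated separately). -/
def slitDomain (k : ℝ) : Set ℂ := (⋃ j : Fin 2, (fun ξ : ℝ => (ξ : ℂ)) '' slit k j)ᶜ

/-- The neighbourhood filter of the boundary point `ξ + σ i 0`, where `σ = 1` (upper bank) or
`σ = -1` (lower bank). -/
def bankFilter (σ ξ : ℝ) : Filter ℂ := 𝓝[{z : ℂ | 0 < σ * z.im}] (ξ : ℂ)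

/-- The boundary value `F(ξ + σ i 0)`. -/
def bank (σ : ℝ) (F : ℂ → ℂ) (ξ : ℝ) : ℂ := limUnder (bankFilter σ ξ) F

/-- The value `F(∞)`. -/
def valueAtInfinity (F : ℂ → ℂ) : ℂ := limUnder (cocompact ℂ) F

/-- `F` is analytic in the extended plane cut along `l₀ ∪ l₁` apart from the point `ζinf`, where it
has the principal part `p / (ζ - ζinf)`, and it is continuous up to both banks of the slits,
their tips included. -/
structure IsSlitAnalytic (k ζinf : ℝ) (p : ℂ) (F : ℂ → ℂ) : Prop where
  differentiableOn : DifferentiableOn ℂ F (slitDomain k \ {(ζinf : ℂ)})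
  pole : ∃ w : ℂ, Tendsto (fun ζ : ℂ => F ζ - p / (ζ - ζinf)) (𝓝[≠] (ζinf : ℂ)) (𝓝 w)
  infinity : ∃ w : ℂ, Tendsto F (cocompact ℂ) (𝓝 w)
  banks : ∀ σ : ℝ, (σ = 1 ∨ σ = -1) → ∀ j : Fin 2, ∀ ξ ∈ slit k j,
    ∃ w : ℂ, Tendsto F (bankFilter σ ξ) (𝓝 w)
  tips : ∀ ξ ∈ ({-1, -k, k, 1} : Set ℝ), ∃ w : ℂ, Tendsto F (𝓝[slitDomain k] (ξ : ℂ)) (𝓝 w)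

/-! ### Constants of the elastic problem -/

/-- `κ = μ' / μ` for an inclusion with shear modulus `μ'` in a matrix with shear modulus `μ`. -/
def kap (μ μ' : ℝ) : ℝ := μ' / μ

/-- `λ = μ' / (1 - κ)`. -/
def lam (μ μ' : ℝ) : ℝ := μ' / (1 - kap μ μ')

/-- `λ~ = κ / (1 - κ)`. -/
def lamTilde (μ μ' : ℝ) : ℝ := kap μ μ' / (1 - kap μ μ')

/-- The residue `c = (conj τ^∞ - conj τ) c₋₁ / μ` of `F` at `ζinf`. -/
def resF (μ : ℝ) (τ τinf cm : ℂ) : ℂ := (conj τinf - conj τ) / (μ : ℂ) * cm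

/-- `c_* = Re [c₋₁ (conj τ^∞ / μ - conj τ / μ')]`. -/
def cStar (μ μ' : ℝ) (τ τinf cm : ℂ) : ℝ :=
  (cm * (conj τinf / (μ : ℂ) - conj τ / (μ' : ℂ))).re

/-! ### The two Schwarz problems -/

/-- First Schwarz problem: `Im F = a_j` on `l_j`, with `F ~ c / (ζ - ζinf)` at `ζinf`. -/
structure FirstSchwarz (k ζinf μ : ℝ) (τ τinf cm : ℂ) (a : Fin 2 → ℝ) (F : ℂ → ℂ) : Prop where
  analytic : IsSlitAnalytic k ζinf (resF μ τ τinf cm) F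
  boundary : ∀ σ : ℝ, (σ = 1 ∨ σ = -1) → ∀ j : Fin 2, ∀ ξ ∈ slit k j, (bank σ F ξ).im = a j

/-- Second Schwarz problem: `Re [conj τ ω] = λ_j [Re F - d_j']` on `l_j`, with
`ω = c₋₁ / (ζ - ζinf) + O(1)` at `ζinf`. -/
structure SecondSchwarz (k ζinf μ : ℝ) (μi : Fin 2 → ℝ) (τ cm : ℂ) (d : Fin 2 → ℝ)
    (F ω : ℂ → ℂ) : Prop where
  analytic : IsSlitAnalytic k ζinf cm ω
  boundary : ∀ σ : ℝ, (σ = 1 ∨ σ = -1) → ∀ j : Fin 2, ∀ ξ ∈ slit k j,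
    (conj τ * bank σ ω ξ).re = lam μ (μi j) * ((bank σ F ξ).re - d j)

/-- The real additive constant `β₀` of `F`. The remaining part of the general solution of the first
problem takes a purely imaginary value at infinity, so that `β₀ = Re F(∞)`. -/
def beta0 (F : ℂ → ℂ) : ℝ := (valueAtInfinity F).re

/-- `ρ_j' = β₀ - d_j'`. -/
def rho' (d : Fin 2 → ℝ) (F : ℂ → ℂ) (j : Fin 2) : ℝ := beta0 F - d j

/-- `ρ_j = λ_j ρ_j'`. -/
def rho (μ : ℝ) (μi : Fin 2 → ℝ) (d : Fin 2 → ℝ) (F : ℂ → ℂ) (j : Fin 2) : ℝ :=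
  lam μ (μi j) * rho' d F j

/-- The real additive constant `γ₀` of `i (conj τ) ω`. The remaining part of the general solution
of the second problem takes a purely imaginary value at infinity, so that
`γ₀ = Re [i (conj τ) ω(∞)]`. -/
def gamma0 (τ : ℂ) (ω : ℂ → ℂ) : ℝ := (Complex.I * conj τ * valueAtInfinity ω).re

/-! ### Integrals -/

/-- `|q(ξ)|` for real `ξ`, where `q² = (ζ² - 1)(ζ² - k²)`. -/
def absq (k ξ : ℝ) : ℝ := Real.sqrt |(ξ ^ 2 - 1) * (ξ ^ 2 - k ^ 2)|

/-- `∫_k^1 dξ / |q(ξ)|`. -/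
def ellI (k : ℝ) : ℝ := ∫ ξ in k..1, 1 / absq k ξ

/-- `∫_k^1 dξ / (ξ |q(ξ)|)`. -/
def ellJ (k : ℝ) : ℝ := ∫ ξ in k..1, 1 / (ξ * absq k ξ)

/-- The truncated integral of `f` over the part of `[a,b]` outside the `ε`-neighbourhood of `s`. -/
def truncIntegral (a b s : ℝ) (f : ℝ → ℝ) (ε : ℝ) : ℝ :=
  ∫ η in {η : ℝ | η ∈ Set.Icc a b ∧ ε < |η - s|}, f η

/-- The Cauchy principal value of `∫_a^b f` at the point `s` exists. -/
def PVExists (a b s : ℝ) (f : ℝ → ℝ) : Prop :=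
  (∀ ε > 0, IntegrableOn f {η : ℝ | η ∈ Set.Icc a b ∧ ε < |η - s|}) ∧
    ∃ v : ℝ, Tendsto (truncIntegral a b s f) (𝓝[>] 0) (𝓝 v)

/-- The Cauchy principal value of `∫_a^b f` at the point `s`
(the ordinary integral when `s` is not in `[a,b]`). -/
def pv (a b s : ℝ) (f : ℝ → ℝ) : ℝ := limUnder (𝓝[>] 0) (truncIntegral a b s f)

/-- `g₀(ξ) = Re [c₋₁ / (ξ - ζinf) (conj τ^∞ / μ - conj τ / μ')]`. -/
def g0 (ζinf μ μ' : ℝ) (τ τinf cm : ℂ) (ξ : ℝ) : ℝ :=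
  (cm / ((ξ : ℂ) - ζinf) * (conj τinf / (μ : ℂ) - conj τ / (μ' : ℂ))).re

/-- The integrand `[a_j - Im (c / (η - ζinf))] / (|q(η)| (η - ξ))`. -/
def g1Integrand (k ζinf μ : ℝ) (τ τinf cm : ℂ) (a : Fin 2 → ℝ) (ξ : ℝ) (j : Fin 2) (η : ℝ) : ℝ :=
  (a j - (resF μ τ τinf cm / ((η : ℂ) - ζinf)).im) / (absq k η * (η - ξ))

/-- `g₁(ξ) = (|q(ξ)| / π) ∑_j (-1)^j ∫_{l_j^+} [a_j - Im (c / (η - ζinf))] dη / (|q(η)| (η - ξ))`,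
with principal values. -/
def g1 (k ζinf μ : ℝ) (τ τinf cm : ℂ) (a : Fin 2 → ℝ) (ξ : ℝ) : ℝ :=
  absq k ξ / Real.pi * ∑ j : Fin 2, (-1 : ℝ) ^ (j : ℕ) *
    pv (lo k j) (hi k j) ξ (g1Integrand k ζinf μ τ τinf cm a ξ j)

/-- The integrand of the explicit form of `g₁` for a symmetric pair. -/
def g1SymIntegrand (k c'' a1 ξ η : ℝ) : ℝ := (c'' / η - a1) / (absq k η * (η ^ 2 - ξ ^ 2))

/-- The integrand
`[-g₁(η) + σ (|q(ξ)| / |q(η)|) (g₀(η) + r)] / (η - s)` of the boundary map. -/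
def mapIntegrand (k : ℝ) (G₀ G₁ : ℝ → ℝ) (r σ ξ s η : ℝ) : ℝ :=
  (-G₁ η + σ * (absq k ξ / absq k η) * (G₀ η + r)) / (η - s)

/-! ### The inclusions -/

/-- The contour `L_j`, the image of the two-sided slit `l_j`. -/
def contour (k : ℝ) (ω : ℂ → ℂ) (j : Fin 2) : Set ℂ :=
  {z | ∃ ξ ∈ slit k j, z = bank 1 ω ξ ∨ z = bank (-1) ω ξ}

/-- The inclusion `D_j`, the set of points enclosed by `L_j`: the union of the bounded connected
components of the complement of `L_j` (the interior of `L_j` if `L_j` is a Jordan curve). -/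
def inclusion (k : ℝ) (ω : ℂ → ℂ) (j : Fin 2) : Set ℂ :=
  {z | z ∉ contour k ω j ∧ Bornology.IsBounded (connectedComponentIn (contour k ω j)ᶜ z)}

end TwoSlit

end

open TwoSlit

/-!
Both Schwarz problems are the same problem: to find a function on the slit domain with residue `p`
at the origin and constant imaginary part on each slit (`IsSchwarz`). The first one is of this form
for `F`, the second one for `i (conj τ ω / λ - F)`.

A function of the class is described by two functions on the closed upper half plane: the regular
part `F - p / ζ` and its conjugate reflection (`IsSlitAnalytic.exists_pair`). For such pairs
Cauchy's theorem with a pole just below the real axis, followed by the limit of the Poisson and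
conjugate Poisson kernels, gives the Sokhotski–Plemelj relation in principal value form
(`IsUpper.plemelj`). It is used twice: for the regular part, where it expresses the mean of the two
boundary values by the integral of the jump (`IsSlitAnalytic.hasPVSum_jump`), and for the regular
part divided by `q`, where it expresses the jump by the integral of the mean
(`IsSlitAnalytic.hasPVSum_mean`). Cauchy's theorem for the same quotient without kernel
(`IsSlitAnalytic.sum_integral_mean_eq_zero`) is the solvability condition.

* Solvability. The condition is necessary by the last relation (`IsSchwarz.sub_eq`). For sufficiency
  one explicit function is enough. With `E' = (ζ² + s) / q` and `s` chosen such that `E` has no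
  period across a slit, `(E - q / ζ) / k` is real on the gaps, has residue `1`, is bounded at
  infinity and has constant real part on each slit; reflection across the gaps continues it to the
  slit domain (`exists_schwarz_kernel`). Every problem satisfying the condition is solved by a
  combination of this function, `1 / ζ` and a constant (`exists_isSchwarz`).
* Uniqueness. For `p = 0` and zero data the two relations show that the boundary values are equal to
  the value at infinity (`IsSchwarz.bank_eq_valueAtInfinity`). Applied to `F(ζ) + F(-ζ)` and to
  `i (conj τ) (ω(ζ) + ω(-ζ))` this is the symmetry of the boundary values
  (`FirstSchwarz.bank_add_bank_neg`, `SecondSchwarz.bank_eq_neg`), and hence of the contours and of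
  the inclusions.
* Boundary values. The two relations for `-iF` give `Re F` on the slits in terms of `g₁`
  (`FirstSchwarz.re_bank`). This determines the mean and the jump of `Re (conj τ ω)`, and the two
  relations for `conj τ ω` then give its imaginary part (`SecondSchwarz.map_formula`).
-/

namespace TwoSlit

section

/-! ### Cauchy principal values -/

/-- The principal value of `∫_a^b f` at `s` exists and equals `v`. -/
def HasPV (a b s : ℝ) (f : ℝ → ℝ) (v : ℝ) : Prop :=
  (∀ ε > 0, IntegrableOn f {η : ℝ | η ∈ Set.Icc a b ∧ ε < |η - s|}) ∧
    Tendsto (truncIntegral a b s f) (𝓝[>] 0) (𝓝 v)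

variable {a b s v w : ℝ} {f g : ℝ → ℝ}

theorem HasPV.pvExists (h : HasPV a b s f v) : PVExists a b s f := ⟨h.1, v, h.2⟩

theorem HasPV.pv_eq (h : HasPV a b s f v) : pv a b s f = v := h.2.limUnder_eq

theorem measurableSet_trunc (a b s ε : ℝ) :
    MeasurableSet {η : ℝ | η ∈ Set.Icc a b ∧ ε < |η - s|} :=
  measurableSet_Icc.inter
    (measurableSet_lt measurable_const (show Measurable fun η : ℝ => |η - s| by fun_prop))

theorem HasPV.add (hf : HasPV a b s f v) (hg : HasPV a b s g w) :
    HasPV a b s (fun η => f η + g η) (v + w) := by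
  refine ⟨fun ε hε => (hf.1 ε hε).add (hg.1 ε hε), (hf.2.add hg.2).congr' ?_⟩
  filter_upwards [self_mem_nhdsWithin] with ε hε
  exact (integral_add (hf.1 ε hε) (hg.1 ε hε)).symm

theorem HasPV.const_mul (c : ℝ) (hf : HasPV a b s f v) :
    HasPV a b s (fun η => c * f η) (c * v) := by
  refine ⟨fun ε hε => (hf.1 ε hε).const_mul c, (hf.2.const_mul c).congr' ?_⟩
  filter_upwards with ε
  exact (integral_const_mul c _).symm

theorem HasPV.congr_ae (hf : HasPV a b s f v)
    (h : ∀ᵐ η ∂volume.restrict (Set.Icc a b), f η = g η) : HasPV a b s g v := by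
  have h' : ∀ ε : ℝ, f =ᵐ[volume.restrict {η : ℝ | η ∈ Set.Icc a b ∧ ε < |η - s|}] g :=
    fun ε => ae_restrict_of_ae_restrict_of_subset (fun _ hη => hη.1) h
  refine ⟨fun ε hε => (hf.1 ε hε).congr (h' ε), hf.2.congr' ?_⟩
  filter_upwards with ε
  exact integral_congr_ae (h' ε)

theorem HasPV.congr (hf : HasPV a b s f v)
    (h : ∀ η ∈ Set.Icc a b, η ≠ s → f η = g η) : HasPV a b s g v := by
  refine hf.congr_ae ?_
  rw [ae_restrict_iff' measurableSet_Icc]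
  filter_upwards [Measure.ae_ne volume s] with η hη hm using h η hm hη

/-- If the integrand is integrable, the principal value is the ordinary integral. -/
theorem HasPV.of_integrableOn (s : ℝ) (hf : IntegrableOn f (Set.Icc a b)) :
    HasPV a b s f (∫ η in Set.Icc a b, f η) := by
  refine ⟨fun ε _ => hf.mono_set fun _ hη => hη.1, ?_⟩
  have hset : ∀ ε : ℝ, truncIntegral a b s f ε
      = ∫ η in Set.Icc a b, Set.indicator {η : ℝ | ε < |η - s|} f η := fun ε => by
    rw [setIntegral_indicator (measurableSet_lt measurable_const (by fun_prop))]; rfl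
  simp_rw [funext hset]
  refine tendsto_integral_filter_of_dominated_convergence (fun η => ‖f η‖) ?_ ?_ hf.norm ?_
  · filter_upwards with ε
    exact hf.aestronglyMeasurable.indicator (measurableSet_lt measurable_const (by fun_prop))
  · filter_upwards with ε
    filter_upwards with η using norm_indicator_le_norm_self _ _
  · refine ae_restrict_of_ae ?_
    filter_upwards [Measure.ae_ne volume s] with η hη
    have : ∀ᶠ ε : ℝ in 𝓝[>] 0, ε < |η - s| :=
      nhdsWithin_le_nhds (eventually_lt_nhds (abs_pos.2 (sub_ne_zero.2 hη)))
    refine tendsto_const_nhds.congr' ?_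
    filter_upwards [this] with ε hε
    rw [Set.indicator_of_mem (by exact hε)]

theorem truncIntegral_comp_neg (a b s : ℝ) (f : ℝ → ℝ) (ε : ℝ) :
    truncIntegral (-b) (-a) (-s) (fun η => f (-η)) ε = truncIntegral a b s f ε := by
  unfold truncIntegral
  have hm : MeasurableEmbedding (fun x : ℝ => -x) := (Homeomorph.neg ℝ).measurableEmbedding
  have := (Measure.measurePreserving_neg (volume : Measure ℝ)).setIntegral_preimage_emb hm f
    {η : ℝ | η ∈ Set.Icc a b ∧ ε < |η - s|}
  rw [← this]
  congr 2
  ext η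
  simp only [Set.mem_ofPred_eq, Set.mem_preimage, Set.mem_Icc]
  rw [show -η - s = -(η - -s) by ring, abs_neg]
  constructor <;> rintro ⟨⟨h1, h2⟩, h3⟩ <;> exact ⟨⟨by linarith, by linarith⟩, h3⟩

theorem HasPV.comp_neg (hf : HasPV a b s f v) :
    HasPV (-b) (-a) (-s) (fun η => f (-η)) v := by
  refine ⟨fun ε hε => ?_, ?_⟩
  · have hm : MeasurableEmbedding (fun x : ℝ => -x) := (Homeomorph.neg ℝ).measurableEmbedding
    have := ((Measure.measurePreserving_neg (volume : Measure ℝ)).integrableOn_comp_preimage hm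
      (f := f) (s := {η : ℝ | η ∈ Set.Icc a b ∧ ε < |η - s|})).2 (hf.1 ε hε)
    refine this.mono_set ?_
    rintro η ⟨⟨h1, h2⟩, h3⟩
    refine ⟨⟨by linarith, by linarith⟩, ?_⟩
    rwa [show -η - s = -(η - -s) by ring, abs_neg]
  · rw [funext (truncIntegral_comp_neg a b s f)]
    exact hf.2

/-- The odd kernel `1 / (η - s)` is cancelled on an interval symmetric about `s`, so that only
the difference quotient of `f` contributes to the limit. -/
theorem exists_hasPV_of_differentiableAt (ha : a < s) (hb : s < b)
    (hf : IntegrableOn f (Set.Icc a b)) (hd : DifferentiableAt ℝ f s) :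
    ∃ v, HasPV a b s (fun η => f η / (η - s)) v := by
  obtain ⟨C, hC⟩ := hd.hasDerivAt.isBigO_sub.bound
  obtain ⟨r0, hr0, hr0C⟩ := Metric.eventually_nhds_iff.1 hC
  obtain ⟨r, hr, hrr, hra, hrb⟩ : ∃ r > 0, r < r0 ∧ r < s - a ∧ r < b - s := by
    refine ⟨min r0 (min (s - a) (b - s)) / 2, ?_, ?_, ?_, ?_⟩
    · have : 0 < min r0 (min (s - a) (b - s)) :=
        lt_min hr0 (lt_min (by linarith) (by linarith))
      linarith
    all_goals
      have h1 := min_le_left r0 (min (s - a) (b - s))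
      have h2 := min_le_right r0 (min (s - a) (b - s))
      have h3 := min_le_left (s - a) (b - s)
      have h4 := min_le_right (s - a) (b - s)
      have : 0 < min r0 (min (s - a) (b - s)) :=
        lt_min hr0 (lt_min (by linarith) (by linarith))
      linarith
  -- subtract `f s / (η - s)` on the symmetric interval `A`: the rest is integrable
  set A : Set ℝ := Set.Icc (s - r) (s + r) with hA
  have hAab : A ⊆ Set.Icc a b := Set.Icc_subset_Icc (by linarith) (by linarith)
  set h : ℝ → ℝ := fun η => (f η - A.indicator (fun _ => f s) η) / (η - s) with hh
  have hfm : AEStronglyMeasurable f (volume.restrict (Set.Icc a b)) := hf.aestronglyMeasurable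
  have hmeas : AEStronglyMeasurable h (volume.restrict (Set.Icc a b)) := by
    have h1 : AEMeasurable (A.indicator (fun _ => f s)) (volume.restrict (Set.Icc a b)) :=
      (measurable_const.indicator measurableSet_Icc).aemeasurable
    exact ((hfm.aemeasurable.sub h1).div (by fun_prop)).aestronglyMeasurable
  have hint : IntegrableOn h (Set.Icc a b) := by
    have hbound : Integrable (fun η => |C| + ‖f η‖ / r) (volume.restrict (Set.Icc a b)) :=
      (integrable_const _).add (hf.norm.div_const r)
    refine hbound.mono' hmeas ?_
    filter_upwards with η
    by_cases hη : η ∈ A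
    · rw [hh]
      simp only [Set.indicator_of_mem hη, norm_div]
      have h1 := hr0C (y := η) (by
        rw [Real.dist_eq]
        exact lt_of_le_of_lt (abs_le.2 ⟨by linarith [hη.1], by linarith [hη.2]⟩) hrr)
      have h2 : ‖f η - f s‖ / ‖η - s‖ ≤ |C| := by
        refine div_le_of_le_mul₀ (norm_nonneg _) (abs_nonneg _) (h1.trans ?_)
        gcongr
        exact le_abs_self C
      have h3 : 0 ≤ ‖f η‖ / r := by positivity
      linarith
    · rw [hh]
      simp only [Set.indicator_of_notMem hη, norm_div, sub_zero]
      have : r ≤ ‖η - s‖ := by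
        by_contra! hlt
        rw [Real.norm_eq_abs, abs_lt] at hlt
        exact hη ⟨by linarith, by linarith⟩
      have h2 : ‖f η‖ / ‖η - s‖ ≤ ‖f η‖ / r := by gcongr
      linarith [abs_nonneg C]
  have hpv := HasPV.of_integrableOn s hint
  refine ⟨_, ?_, hpv.2.congr' ?_⟩
  · intro ε hε
    have hdom : IntegrableOn (fun η => ‖f η‖ / ε) (Set.Icc a b) := hf.norm.div_const ε
    refine Integrable.mono' (hdom.mono_set fun _ hη => hη.1) ?_ ?_
    · exact ((hfm.mono_measure (Measure.restrict_mono (fun _ hη => hη.1) le_rfl)).aemeasurable.div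
        (by fun_prop)).aestronglyMeasurable
    · filter_upwards [self_mem_ae_restrict (measurableSet_trunc a b s ε)] with η hη
      rw [norm_div]
      have : ε ≤ ‖η - s‖ := hη.2.le
      gcongr
  · filter_upwards [Ioo_mem_nhdsGT hr] with ε hε
    have hm := measurableSet_trunc a b s ε
    -- the symmetric part integrates to zero
    set k0 : ℝ → ℝ := fun η => A.indicator (fun _ => f s) η / (η - s) with hk0
    have hk0int : IntegrableOn k0 {η : ℝ | η ∈ Set.Icc a b ∧ ε < |η - s|} := by
      have hc : IntegrableOn (fun _ : ℝ => |f s| / ε)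
          {η : ℝ | η ∈ Set.Icc a b ∧ ε < |η - s|} :=
        (integrableOn_const (s := Set.Icc a b) (by simp)).mono_set fun _ hη => hη.1
      refine hc.mono' ?_ ?_
      · exact ((measurable_const.indicator measurableSet_Icc).div
          (by fun_prop)).aestronglyMeasurable
      · filter_upwards [self_mem_ae_restrict hm] with η hη
        rw [hk0, norm_div]
        have h1 : ε ≤ ‖η - s‖ := hη.2.le
        have h2 : ‖A.indicator (fun _ => f s) η‖ ≤ |f s| := norm_indicator_le_norm_self _ _
        have := hε.1
        gcongr
    have hzero : ∫ η in {η : ℝ | η ∈ Set.Icc a b ∧ ε < |η - s|}, k0 η = 0 := by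
      rw [← integral_indicator hm]
      set G := Set.indicator {η : ℝ | η ∈ Set.Icc a b ∧ ε < |η - s|} k0 with hG
      have hodd : ∀ x, G (2 * s - x) = -G x := by
        intro x
        have hx1 : 2 * s - x ∈ A ↔ x ∈ A := by
          simp only [hA, Set.mem_Icc]
          constructor <;> rintro ⟨h1, h2⟩ <;> constructor <;> linarith
        have habs : |2 * s - x - s| = |x - s| := by
          rw [← abs_neg]; congr 1; ring
        by_cases hx : x ∈ A
        · by_cases hxe : ε < |x - s|
          · have m1 : x ∈ {η : ℝ | η ∈ Set.Icc a b ∧ ε < |η - s|} := ⟨hAab hx, hxe⟩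
            have m2 : 2 * s - x ∈ {η : ℝ | η ∈ Set.Icc a b ∧ ε < |η - s|} :=
              ⟨hAab (hx1.2 hx), by rwa [habs]⟩
            rw [hG, Set.indicator_of_mem m1, Set.indicator_of_mem m2, hk0]
            simp only [Set.indicator_of_mem hx, Set.indicator_of_mem (hx1.2 hx)]
            rw [show 2 * s - x - s = -(x - s) by ring, div_neg]
          · rw [hG, Set.indicator_of_notMem (fun h => hxe (by rw [← habs]; exact h.2)),
              Set.indicator_of_notMem (fun h => hxe h.2), neg_zero]
        · have e1 : k0 x = 0 := by simp [hk0, Set.indicator_of_notMem hx]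
          have e2 : k0 (2 * s - x) = 0 := by
            simp [hk0, Set.indicator_of_notMem (mt hx1.1 hx)]
          simp [hG, Set.indicator_apply, e1, e2]
      have h1 : ∫ x, G (2 * s - x) = ∫ x, G x := integral_sub_left_eq_self G volume (2 * s)
      simp_rw [hodd, integral_neg] at h1
      linarith
    have h1 : (fun η => f η / (η - s)) = fun η => h η + k0 η := by
      funext η
      simp only [hh, hk0]
      ring
    unfold truncIntegral
    rw [h1, integral_add (hint.mono_set fun _ hη => hη.1) hk0int, hzero, add_zero]

end

/-! ### Approximate identities dominated by the Poisson kernel -/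

/-- The dilates `ε⁻¹ K ((x - ξ) / ε)` of a kernel dominated by `1 / (1 + u²)` act in the limit as
`∫ K` times the point mass at `ξ`, on functions that need only be integrable against
`1 / (1 + x²)`. -/
theorem tendsto_integral_dilate_kernel {K : ℝ → ℝ} (hK : Measurable K)
    (hKb : ∀ u, |K u| ≤ (1 + u ^ 2)⁻¹) {φ : ℝ → ℂ} (hφ : Measurable φ)
    (hφi : Integrable fun x => (1 + x ^ 2)⁻¹ * ‖φ x‖) {ξ : ℝ} (hc : ContinuousAt φ ξ) :
    Tendsto (fun ε : ℝ => ∫ x, ((ε⁻¹ * K ((x - ξ) / ε) : ℝ) : ℂ) * φ x) (𝓝[>] 0)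
      (𝓝 (((∫ u, K u : ℝ) : ℂ) * φ ξ)) := by
  obtain ⟨r, hr, hrb⟩ := Metric.continuousAt_iff.1 hc 1 one_pos
  set S : Set ℝ := Metric.ball ξ r
  have hS : MeasurableSet S := Metric.isOpen_ball.measurableSet
  -- split `φ` into a bounded part near `ξ` and a part where the kernel is `O(ε / (1 + x²))`
  set near : ℝ → ℂ := S.indicator φ with hnear
  set far : ℝ → ℂ := Sᶜ.indicator φ with hfar
  have hnm : Measurable near := hφ.indicator hS
  have hfm : Measurable far := hφ.indicator hS.compl
  have hsum : ∀ x, φ x = near x + far x := fun x =>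
    (congrFun (Set.indicator_self_add_compl S φ) x).symm
  have hnb : ∀ x, ‖near x‖ ≤ ‖φ ξ‖ + 1 := by
    intro x
    by_cases hx : x ∈ S
    · rw [hnear, Set.indicator_of_mem hx]
      have h1 := hrb hx
      rw [dist_eq_norm] at h1
      have h2 := norm_add_le (φ ξ) (φ x - φ ξ)
      rw [add_sub_cancel] at h2
      linarith
    · rw [hnear, Set.indicator_of_notMem hx, norm_zero]
      positivity
  set C : ℝ := (1 + 2 * ξ ^ 2) / r ^ 2 + 2 with hC
  have hCpos : 0 ≤ C := by positivity
  have hkb : ∀ ε > 0, ∀ x, |ε⁻¹ * K ((x - ξ) / ε)| ≤ ε / ((x - ξ) ^ 2 + ε ^ 2) := by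
    intro ε hε x
    rw [abs_mul, abs_of_pos (inv_pos.2 hε)]
    calc ε⁻¹ * |K ((x - ξ) / ε)| ≤ ε⁻¹ * (1 + ((x - ξ) / ε) ^ 2)⁻¹ := by
          gcongr; exact hKb _
      _ = ε / ((x - ξ) ^ 2 + ε ^ 2) := by field_simp; ring
  have hfarb : ∀ ε > 0, ∀ x, ‖((ε⁻¹ * K ((x - ξ) / ε) : ℝ) : ℂ) * far x‖ ≤
      ε * (C * ((1 + x ^ 2)⁻¹ * ‖φ x‖)) := by
    intro ε hε x
    by_cases hx : x ∈ S
    · rw [hfar, Set.indicator_of_notMem (by simpa using hx), mul_zero, norm_zero]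
      positivity
    · rw [hfar, Set.indicator_of_mem hx, norm_mul, Complex.norm_real, Real.norm_eq_abs]
      have hx' : r ≤ |x - ξ| := by
        have : ¬ dist x ξ < r := hx
        rwa [Real.dist_eq, not_lt] at this
      have hsq : r ^ 2 ≤ (x - ξ) ^ 2 := by rw [← sq_abs (x - ξ)]; gcongr
      have hpos : 0 < (x - ξ) ^ 2 := lt_of_lt_of_le (by positivity) hsq
      have h1 : (1 + x ^ 2) ≤ C * (x - ξ) ^ 2 := by
        have h2 : (1 + 2 * ξ ^ 2) ≤ (1 + 2 * ξ ^ 2) / r ^ 2 * (x - ξ) ^ 2 := by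
          rw [div_mul_eq_mul_div, le_div_iff₀ (by positivity)]
          gcongr
        rw [hC, add_mul]
        nlinarith [sq_nonneg (x - 2 * ξ)]
      have h3 : 1 / ((x - ξ) ^ 2 + ε ^ 2) ≤ C * (1 + x ^ 2)⁻¹ := by
        rw [div_le_iff₀ (by positivity), ← div_eq_mul_inv, div_mul_eq_mul_div,
          le_div_iff₀ (by positivity)]
        nlinarith [mul_nonneg hCpos (sq_nonneg ε)]
      calc |ε⁻¹ * K ((x - ξ) / ε)| * ‖φ x‖ ≤ ε / ((x - ξ) ^ 2 + ε ^ 2) * ‖φ x‖ := by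
            gcongr; exact hkb ε hε x
        _ = ε * (1 / ((x - ξ) ^ 2 + ε ^ 2)) * ‖φ x‖ := by ring
        _ ≤ ε * (C * (1 + x ^ 2)⁻¹) * ‖φ x‖ := by gcongr
        _ = _ := by ring
  have hkm : ∀ ε : ℝ, Measurable fun x : ℝ => ((ε⁻¹ * K ((x - ξ) / ε) : ℝ) : ℂ) := fun ε =>
    Complex.measurable_ofReal.comp ((hK.comp (by fun_prop)).const_mul _)
  have hfint : ∀ ε > 0, Integrable fun x => ((ε⁻¹ * K ((x - ξ) / ε) : ℝ) : ℂ) * far x :=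
    fun ε hε => ((hφi.const_mul C).const_mul ε).mono'
      ((hkm ε).mul hfm).aestronglyMeasurable (ae_of_all _ (hfarb ε hε))
  -- the far part tends to zero
  have hfar0 : Tendsto (fun ε : ℝ => ∫ x, ((ε⁻¹ * K ((x - ξ) / ε) : ℝ) : ℂ) * far x)
      (𝓝[>] 0) (𝓝 0) := by
    have hb : Tendsto (fun ε : ℝ => ε * ∫ x, C * ((1 + x ^ 2)⁻¹ * ‖φ x‖)) (𝓝[>] 0) (𝓝 0) := by
      have : Tendsto (fun ε : ℝ => ε * ∫ x, C * ((1 + x ^ 2)⁻¹ * ‖φ x‖)) (𝓝 0)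
          (𝓝 (0 * ∫ x, C * ((1 + x ^ 2)⁻¹ * ‖φ x‖))) := tendsto_id.mul_const _
      rw [zero_mul] at this
      exact this.mono_left nhdsWithin_le_nhds
    refine squeeze_zero_norm' ?_ hb
    filter_upwards [self_mem_nhdsWithin] with ε hε
    rw [← integral_const_mul]
    exact norm_integral_le_of_norm_le ((hφi.const_mul C).const_mul ε)
      (ae_of_all _ (hfarb ε hε))
  -- the near part, after rescaling
  have hnear_eq : ∀ ε > 0, ∫ x, ((ε⁻¹ * K ((x - ξ) / ε) : ℝ) : ℂ) * near x =
      ∫ u, ((K u : ℝ) : ℂ) * near (ξ + ε * u) := by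
    intro ε hε
    have h1 := integral_sub_right_eq_self (μ := (volume : Measure ℝ))
      (fun y => ((ε⁻¹ * K (y / ε) : ℝ) : ℂ) * near (ξ + y)) ξ
    simp only [add_sub_cancel] at h1
    rw [h1]
    have h2 := Measure.integral_comp_div
      (fun u : ℝ => ((ε⁻¹ * K u : ℝ) : ℂ) * near (ξ + ε * u)) ε
    have h3 : ∀ y : ℝ, ξ + ε * (y / ε) = ξ + y := fun y => by field_simp
    simp only [h3] at h2
    rw [h2, abs_of_pos hε, ← integral_smul]
    congr 1
    funext u
    rw [Complex.real_smul]
    push_cast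
    have : (ε : ℂ) ≠ 0 := by exact_mod_cast hε.ne'
    field_simp
  have hnear1 : Tendsto (fun ε : ℝ => ∫ x, ((ε⁻¹ * K ((x - ξ) / ε) : ℝ) : ℂ) * near x)
      (𝓝[>] 0) (𝓝 (((∫ u, K u : ℝ) : ℂ) * φ ξ)) := by
    have hlim : Tendsto (fun ε : ℝ => ∫ u, ((K u : ℝ) : ℂ) * near (ξ + ε * u)) (𝓝[>] 0)
        (𝓝 (∫ u, ((K u : ℝ) : ℂ) * φ ξ)) := by
      refine tendsto_integral_filter_of_dominated_convergence
        (fun u => (1 + u ^ 2)⁻¹ * (‖φ ξ‖ + 1)) ?_ ?_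
        (integrable_inv_one_add_sq.mul_const _) ?_
      · filter_upwards with ε
        exact ((Complex.measurable_ofReal.comp hK).mul
          (hnm.comp (by fun_prop))).aestronglyMeasurable
      · filter_upwards with ε
        filter_upwards with u
        rw [norm_mul, Complex.norm_real, Real.norm_eq_abs]
        exact mul_le_mul (hKb u) (hnb _) (norm_nonneg _) (by positivity)
      · filter_upwards with u
        refine Tendsto.const_mul _ ?_
        have hn : ContinuousAt near ξ := by
          refine hc.congr ?_
          filter_upwards [Metric.ball_mem_nhds ξ hr] with x hx
          rw [hnear, Set.indicator_of_mem (by exact hx)]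
        have hnξ : near ξ = φ ξ := by
          rw [hnear, Set.indicator_of_mem (Metric.mem_ball_self hr)]
        rw [← hnξ]
        have : Tendsto (fun ε : ℝ => ξ + ε * u) (𝓝[>] 0) (𝓝 ξ) := by
          have h0 : Tendsto (fun ε : ℝ => ξ + ε * u) (𝓝 0) (𝓝 (ξ + 0 * u)) := by
            apply Continuous.tendsto; fun_prop
          rw [zero_mul, add_zero] at h0
          exact h0.mono_left nhdsWithin_le_nhds
        exact hn.tendsto.comp this
    rw [integral_mul_const, integral_complex_ofReal] at hlim
    refine hlim.congr' ?_
    filter_upwards [self_mem_nhdsWithin] with ε hε using (hnear_eq ε hε).symm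
  have hnint : ∀ ε > 0, Integrable fun x => ((ε⁻¹ * K ((x - ξ) / ε) : ℝ) : ℂ) * near x := by
    intro ε hε
    have hbi : Integrable fun x : ℝ => ε⁻¹ * (1 + ((x - ξ) / ε) ^ 2)⁻¹ * (‖φ ξ‖ + 1) :=
      (((integrable_inv_one_add_sq.comp_div hε.ne').comp_sub_right ξ).const_mul _).mul_const _
    refine hbi.mono' ((hkm ε).mul hnm).aestronglyMeasurable (ae_of_all _ fun x => ?_)
    rw [norm_mul, Complex.norm_real, Real.norm_eq_abs, abs_mul, abs_of_pos (inv_pos.2 hε)]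
    gcongr
    exacts [hKb _, hnb x]
  have := hnear1.add hfar0
  rw [add_zero] at this
  refine this.congr' ?_
  filter_upwards [self_mem_nhdsWithin] with ε hε
  rw [← integral_add (hnint ε hε) (hfint ε hε)]
  congr 1
  funext x
  rw [hsum x]
  ring

theorem tendsto_integral_poisson {φ : ℝ → ℂ} (hφ : Measurable φ)
    (hφi : Integrable fun x => (1 + x ^ 2)⁻¹ * ‖φ x‖) {ξ : ℝ} (hc : ContinuousAt φ ξ) :
    Tendsto (fun ε : ℝ => ∫ x, ((ε / ((x - ξ) ^ 2 + ε ^ 2) : ℝ) : ℂ) * φ x) (𝓝[>] 0)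
      (𝓝 ((Real.pi : ℂ) * φ ξ)) := by
  have h := tendsto_integral_dilate_kernel (K := fun u => (1 + u ^ 2)⁻¹) (by fun_prop)
    (fun u => (abs_of_nonneg (by positivity)).le) hφ hφi hc
  rw [integral_univ_inv_one_add_sq] at h
  refine h.congr' ?_
  filter_upwards [self_mem_nhdsWithin] with ε (hε : 0 < ε)
  congr 1
  funext x
  congr 2
  field_simp
  ring

/-- The difference between the smooth and the sharp truncation of `1 / u`, on the unit scale. -/
noncomputable def truncKernel (u : ℝ) : ℝ := u / (1 + u ^ 2) - (if 1 < |u| then u⁻¹ else 0)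

theorem abs_truncKernel_le (u : ℝ) : |truncKernel u| ≤ (1 + u ^ 2)⁻¹ := by
  unfold truncKernel
  have hp : 0 < 1 + u ^ 2 := by positivity
  split_ifs with h
  · have hu : u ≠ 0 := by rintro rfl; norm_num at h
    have : u / (1 + u ^ 2) - u⁻¹ = -(u⁻¹ * (1 + u ^ 2)⁻¹) := by field_simp; ring
    rw [this, abs_neg, abs_mul, abs_of_pos (inv_pos.2 hp), abs_inv]
    exact mul_le_of_le_one_left (by positivity) (inv_le_one_of_one_le₀ h.le)
  · rw [sub_zero, abs_div, abs_of_pos hp, inv_eq_one_div]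
    gcongr
    exact not_lt.1 h

theorem measurable_truncKernel : Measurable truncKernel := by
  unfold truncKernel
  refine (by fun_prop : Measurable fun u : ℝ => u / (1 + u ^ 2)).sub ?_
  exact Measurable.ite (measurableSet_lt measurable_const (by fun_prop)) (by fun_prop) (by fun_prop)

theorem integral_truncKernel : ∫ u, truncKernel u = 0 := by
  have h1 : ∫ u, truncKernel (-u) = ∫ u, truncKernel u := integral_neg_eq_self truncKernel volume
  have h2 : ∀ u, truncKernel (-u) = -truncKernel u := by
    intro u
    unfold truncKernel
    simp only [abs_neg, neg_sq, inv_neg]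
    split_ifs <;> ring
  simp_rw [h2, integral_neg] at h1
  linarith

/-- For a density continuous at `ξ` the conjugate Poisson integrals and the truncated integrals
have the same limit. -/
theorem tendsto_truncated_of_tendsto_conjPoisson {φ : ℝ → ℂ} (hφ : Measurable φ)
    (hφi : Integrable φ) {ξ : ℝ} (hc : ContinuousAt φ ξ) {L : ℂ}
    (hL : Tendsto (fun ε : ℝ => ∫ x, (((x - ξ) / ((x - ξ) ^ 2 + ε ^ 2) : ℝ) : ℂ) * φ x) (𝓝[>] 0)
      (𝓝 L)) :
    (∀ ε > 0, IntegrableOn (fun x => φ x / ((x : ℂ) - ξ)) {x : ℝ | ε < |x - ξ|}) ∧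
    Tendsto (fun ε : ℝ => ∫ x in {x : ℝ | ε < |x - ξ|}, φ x / ((x : ℂ) - ξ)) (𝓝[>] 0) (𝓝 L) := by
  have hm : ∀ ε : ℝ, MeasurableSet {x : ℝ | ε < |x - ξ|} := fun ε =>
    measurableSet_lt measurable_const (show Measurable fun x : ℝ => |x - ξ| by fun_prop)
  have hmeas : Measurable fun x : ℝ => φ x / ((x : ℂ) - ξ) := by fun_prop
  have hint : ∀ ε > 0, IntegrableOn (fun x => φ x / ((x : ℂ) - ξ)) {x : ℝ | ε < |x - ξ|} := by
    intro ε hε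
    have hd : Integrable (fun x => ‖φ x‖ / ε) (volume.restrict {x : ℝ | ε < |x - ξ|}) :=
      (hφi.norm.div_const ε).integrableOn
    refine hd.mono' hmeas.aestronglyMeasurable ?_
    filter_upwards [self_mem_ae_restrict (hm ε)] with x (hx : ε < |x - ξ|)
    rw [norm_div, ← Complex.ofReal_sub, Complex.norm_real, Real.norm_eq_abs]
    gcongr
  refine ⟨hint, ?_⟩
  -- the two truncations differ by the dilates of `truncKernel`, whose integral is zero
  have hk := tendsto_integral_dilate_kernel measurable_truncKernel abs_truncKernel_le hφ
    (hφi.norm.bdd_mul (c := 1) (by fun_prop) (ae_of_all _ fun x => by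
      rw [Real.norm_of_nonneg (by positivity)]
      exact inv_le_one_of_one_le₀ (by nlinarith [sq_nonneg x]))) hc
  rw [integral_truncKernel, Complex.ofReal_zero, zero_mul] at hk
  have := hL.sub hk
  rw [sub_zero] at this
  refine this.congr' ?_
  filter_upwards [self_mem_nhdsWithin] with ε (hε : 0 < ε)
  rw [← integral_indicator (hm ε), sub_eq_iff_eq_add, ← integral_add]
  · congr 1
    funext x
    unfold truncKernel
    have hiff : 1 < |(x - ξ) / ε| ↔ ε < |x - ξ| := by
      rw [abs_div, abs_of_pos hε, lt_div_iff₀ hε, one_mul]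
    rw [Set.indicator_apply]
    simp only [hiff, Set.mem_ofPred_eq]
    split_ifs with h
    · have h0 : x - ξ ≠ 0 := by
        intro h0; rw [h0, abs_zero] at h; linarith
      have h0' : (x : ℂ) - ξ ≠ 0 := by exact_mod_cast h0
      have e : (x - ξ) / ((x - ξ) ^ 2 + ε ^ 2) =
          (x - ξ)⁻¹ + ε⁻¹ * ((x - ξ) / ε / (1 + ((x - ξ) / ε) ^ 2) - ((x - ξ) / ε)⁻¹) := by
        field_simp; ring
      rw [e]
      push_cast
      ring
    · have e : (x - ξ) / ((x - ξ) ^ 2 + ε ^ 2) =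
          ε⁻¹ * ((x - ξ) / ε / (1 + ((x - ξ) / ε) ^ 2)) := by
        field_simp; ring
      rw [e]
      push_cast
      ring
  · exact (hint ε hε).integrable_indicator (hm ε)
  · refine hφi.bdd_mul (c := ε⁻¹) ?_ (ae_of_all _ fun x => ?_)
    · exact (Complex.measurable_ofReal.comp ((measurable_truncKernel.comp
        (by fun_prop)).const_mul _)).aestronglyMeasurable
    · rw [Complex.norm_real, Real.norm_eq_abs, abs_mul, abs_of_pos (inv_pos.2 hε)]
      refine mul_le_of_le_one_right (by positivity) ((abs_truncKernel_le _).trans ?_)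
      exact inv_le_one_of_one_le₀ (by nlinarith [sq_nonneg ((x - ξ) / ε)])

section

/-! ### Boundary integrals of analytic functions in the upper half plane -/

theorem tendsto_add_mul_I (x : ℝ) :
    Tendsto (fun y : ℝ => (x : ℂ) + y * Complex.I) (𝓝[>] 0) (𝓝[{z : ℂ | 0 < z.im}] (x : ℂ)) := by
  refine tendsto_nhdsWithin_iff.2 ⟨?_, ?_⟩
  · have : Tendsto (fun y : ℝ => (x : ℂ) + y * Complex.I) (𝓝 0)
        (𝓝 ((x : ℂ) + (0 : ℝ) * Complex.I)) := by
      apply Continuous.tendsto; fun_prop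
    rw [Complex.ofReal_zero, zero_mul, add_zero] at this
    exact this.mono_left nhdsWithin_le_nhds
  · filter_upwards [self_mem_nhdsWithin] with y hy
    simpa using hy

/-- Shifting the line of integration: an analytic function in the upper half plane which is
`O(|z|⁻²)` at infinity and dominated on horizontal lines has boundary values of integral zero. -/
theorem integral_boundary_eq_zero {f : ℂ → ℂ} {m : ℝ → ℝ}
    (hd : DifferentiableOn ℂ f {z | 0 < z.im}) (hm : Integrable m)
    (hb : ∀ᵐ x : ℝ, ∀ y : ℝ, 0 < y → y ≤ 1 → ‖f (x + y * Complex.I)‖ ≤ m x)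
    {C R : ℝ} (hR : 0 < R) (hC : ∀ z : ℂ, 0 < z.im → R ≤ ‖z‖ → ‖f z‖ ≤ C / ‖z‖ ^ 2)
    (hlim : ∀ᵐ x : ℝ, Tendsto (fun y : ℝ => f (x + y * Complex.I)) (𝓝[>] 0) (𝓝 (f x))) :
    ∫ x : ℝ, f x = 0 := by
  have hcont : ∀ y : ℝ, 0 < y → Continuous fun x : ℝ => f (x + y * Complex.I) := by
    intro y hy
    refine hd.continuousOn.comp_continuous (by fun_prop) fun x => ?_
    simpa using hy
  have hint : ∀ y : ℝ, 0 < y → y ≤ 1 → Integrable fun x : ℝ => f (x + y * Complex.I) :=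
    fun y hy hy1 => hm.mono' (hcont y hy).aestronglyMeasurable (hb.mono fun x hx => hx y hy hy1)
  have hzero : ∀ y : ℝ, 0 < y → y ≤ 1 → ∫ x : ℝ, f (x + y * Complex.I) = 0 := by
    intro y hy hy1
    have h1 : Tendsto (fun r : ℝ => ∫ x in (-r)..r, f (x + y * Complex.I)) atTop
        (𝓝 (∫ x : ℝ, f (x + y * Complex.I))) :=
      intervalIntegral_tendsto_integral (hint y hy hy1) tendsto_neg_atTop_atBot tendsto_id
    have h2 : Tendsto (fun r : ℝ => ∫ x in (-r)..r, f (x + y * Complex.I)) atTop (𝓝 0) := by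
      have hto : Tendsto (fun r : ℝ => 4 * |C| / r) atTop (𝓝 0) :=
        tendsto_const_nhds.div_atTop tendsto_id
      refine squeeze_zero_norm' ?_ hto
      filter_upwards [eventually_ge_atTop R, eventually_ge_atTop 1] with r hr hr1
      have hr0 : 0 < r := by linarith
      -- the rectangle over `[-r, r]` between the heights `y` and `r`
      have hrect := Complex.integral_boundary_rect_eq_zero_of_differentiableOn f
        (-r + y * Complex.I) (r + r * Complex.I) (hd.mono (by
          intro z hz
          have := hz.2
          simp only [Set.mem_preimage, Complex.add_im, Complex.neg_im, Complex.ofReal_im,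
            Complex.mul_im, Complex.I_im, Complex.I_re, Complex.ofReal_re, mul_one, mul_zero,
            add_zero, zero_add, neg_zero] at this
          rw [Set.uIcc_of_le (by linarith)] at this
          exact lt_of_lt_of_le hy this.1))
      simp only [Complex.add_re, Complex.neg_re, Complex.ofReal_re, Complex.mul_re, Complex.I_re,
        mul_zero, Complex.ofReal_im, Complex.I_im, mul_one, add_zero, Complex.add_im,
        Complex.neg_im, neg_zero, zero_add, Complex.mul_im, smul_eq_mul, sub_self]
        at hrect
      have hest : ∀ z : ℂ, 0 < z.im → r ≤ ‖z‖ → ‖f z‖ ≤ |C| / r ^ 2 := fun z hz hzr =>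
        (hC z hz (hr.trans hzr)).trans (by gcongr; exact le_abs_self C)
      have htop : ‖∫ x in (-r)..r, f (x + r * Complex.I)‖ ≤ |C| / r ^ 2 * |r - -r| := by
        refine intervalIntegral.norm_integral_le_of_norm_le_const fun x _ => hest _ ?_ ?_
        · simpa using hr0
        · have := Complex.abs_im_le_norm ((x : ℂ) + r * Complex.I)
          simp at this
          exact (le_abs_self r).trans this
      have hside : ∀ s : ℝ, |s| = r →
          ‖∫ t in y..r, f (s + t * Complex.I)‖ ≤ |C| / r ^ 2 * |r - y| := by
        intro s hs
        refine intervalIntegral.norm_integral_le_of_norm_le_const fun t ht => hest _ ?_ ?_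
        · rw [Set.uIoc_of_le (by linarith)] at ht
          simpa using hy.trans ht.1
        · have := Complex.abs_re_le_norm ((s : ℂ) + t * Complex.I)
          simp [hs] at this
          exact this
      have hs1 := hside r (abs_of_pos hr0)
      have hs2 := hside (-r) (by rw [abs_neg, abs_of_pos hr0])
      rw [abs_of_nonneg (show (0 : ℝ) ≤ r - -r by linarith)] at htop
      rw [abs_of_nonneg (show (0 : ℝ) ≤ r - y by linarith)] at hs1 hs2
      rw [Complex.ofReal_neg] at hs2 hrect
      have heq : ∫ x in (-r)..r, f (x + y * Complex.I) =
          (∫ x in (-r)..r, f (x + r * Complex.I)) -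
            Complex.I * (∫ t in y..r, f (r + t * Complex.I)) +
            Complex.I * (∫ t in y..r, f (-r + t * Complex.I)) := by
        linear_combination hrect
      rw [heq]
      refine (norm_add_le _ _).trans ((add_le_add_left (norm_sub_le _ _) _).trans ?_)
      rw [norm_mul, norm_mul, Complex.norm_I, one_mul, one_mul]
      calc _ ≤ |C| / r ^ 2 * (r - -r) + |C| / r ^ 2 * (r - y) + |C| / r ^ 2 * (r - y) := by
            gcongr
        _ ≤ |C| / r ^ 2 * (r - -r) + |C| / r ^ 2 * r + |C| / r ^ 2 * r := by
            have : r - y ≤ r := by linarith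
            gcongr
        _ = 4 * |C| / r := by field_simp; ring
    exact tendsto_nhds_unique h1 h2
  have hdct : Tendsto (fun y : ℝ => ∫ x : ℝ, f (x + y * Complex.I)) (𝓝[>] 0)
      (𝓝 (∫ x : ℝ, f x)) := by
    refine tendsto_integral_filter_of_dominated_convergence m ?_ ?_ hm hlim
    · filter_upwards [self_mem_nhdsWithin] with y hy using (hcont y hy).aestronglyMeasurable
    · filter_upwards [Ioc_mem_nhdsGT one_pos] with y hy
      exact hb.mono fun x hx => hx y hy.1 hy.2
  refine tendsto_nhds_unique hdct (tendsto_const_nhds.congr' ?_)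
  filter_upwards [Ioc_mem_nhdsGT one_pos] with y hy using (hzero y hy.1 hy.2).symm

/-- A function analytic in the upper half plane, `O(1/|z|)` at infinity, dominated near the real
axis by a function of `Re z` that is integrable against `1 / (1 + |x|)`, and having its values on
the real axis as vertical boundary values almost everywhere. -/
structure IsUpper (f : ℂ → ℂ) : Prop where
  diff : DifferentiableOn ℂ f {z | 0 < z.im}
  meas : Measurable fun x : ℝ => f x
  bound : ∃ m : ℝ → ℝ, Integrable (fun x => (1 + |x|)⁻¹ * m x) ∧
    ∀ᵐ x : ℝ, ∀ y : ℝ, 0 < y → y ≤ 1 → ‖f (x + y * Complex.I)‖ ≤ m x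
  decay : ∃ C R : ℝ, 0 < R ∧ ∀ z : ℂ, 0 < z.im → R ≤ ‖z‖ → ‖f z‖ ≤ C / ‖z‖
  boundary : ∀ᵐ x : ℝ, Tendsto (fun y : ℝ => f (x + y * Complex.I)) (𝓝[>] 0) (𝓝 (f x))

variable {f g : ℂ → ℂ}

theorem IsUpper.integrable_weight (hf : IsUpper f) :
    Integrable fun x : ℝ => (1 + |x|)⁻¹ * ‖f x‖ := by
  obtain ⟨m, hm, hb⟩ := hf.bound
  refine hm.mono' ((by fun_prop : Measurable fun x : ℝ => (1 + |x|)⁻¹).mul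
    hf.meas.norm).aestronglyMeasurable ?_
  filter_upwards [hf.boundary, hb] with x hx hbx
  rw [norm_mul, norm_norm, Real.norm_of_nonneg (by positivity)]
  gcongr
  refine le_of_tendsto hx.norm ?_
  filter_upwards [Ioc_mem_nhdsGT one_pos] with y hy using hbx y hy.1 hy.2

theorem IsUpper.integrable_poisson_weight (hf : IsUpper f) :
    Integrable fun x : ℝ => (1 + x ^ 2)⁻¹ * ‖f x‖ := by
  refine (hf.integrable_weight.const_mul 2).mono'
    ((by fun_prop : Measurable fun x : ℝ => (1 + x ^ 2)⁻¹).mul hf.meas.norm).aestronglyMeasurable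
    (ae_of_all _ fun x => ?_)
  rw [norm_mul, norm_norm, Real.norm_of_nonneg (by positivity), ← mul_assoc]
  gcongr
  rw [← div_eq_mul_inv, inv_eq_one_div, div_le_div_iff₀ (by positivity) (by positivity)]
  nlinarith [sq_nonneg (|x| - 1), sq_abs x, sq_nonneg (|x|)]

/-- The Cauchy kernel of a point of the lower half plane decays like `1 / (1 + |Re z|)`, uniformly
in the closed upper half plane. -/
theorem norm_sub_shift_ge (ξ : ℝ) {ε : ℝ} (hε : 0 < ε) {z : ℂ} (hz : 0 ≤ z.im) :
    (1 + |z.re|) ≤ ((1 + |ξ|) / ε + 1) * ‖z - ξ + ε * Complex.I‖ := by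
  have h1 : ε ≤ ‖z - ξ + ε * Complex.I‖ := by
    have := Complex.abs_im_le_norm (z - ξ + ε * Complex.I)
    simp at this
    exact le_trans (by linarith) ((le_abs_self _).trans this)
  have h2 : |z.re - ξ| ≤ ‖z - ξ + ε * Complex.I‖ := by
    have := Complex.abs_re_le_norm (z - ξ + ε * Complex.I)
    simpa using this
  have h3 : |z.re| ≤ |ξ| + |z.re - ξ| := by
    have := abs_add_le ξ (z.re - ξ)
    rwa [add_sub_cancel] at this
  have h4 : 1 + |ξ| ≤ (1 + |ξ|) / ε * ‖z - ξ + ε * Complex.I‖ := by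
    rw [div_mul_eq_mul_div, le_div_iff₀ hε]
    gcongr
  rw [add_mul, one_mul]
  linarith

/-- Cauchy's theorem with the kernel of a point `ξ - iε` of the lower half plane. -/
theorem IsUpper.integral_cauchy (hf : IsUpper f) (ξ : ℝ) {ε : ℝ} (hε : 0 < ε) :
    Integrable (fun x : ℝ => f x / ((x : ℂ) - ξ + ε * Complex.I)) ∧
      ∫ x : ℝ, f x / ((x : ℂ) - ξ + ε * Complex.I) = 0 := by
  obtain ⟨m, hm, hb⟩ := hf.bound
  obtain ⟨C, R, hR, hC⟩ := hf.decay
  set K : ℝ := (1 + |ξ|) / ε + 1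
  have hK : 0 < K := by positivity
  have hne : ∀ z : ℂ, 0 ≤ z.im → 0 < ‖z - ξ + ε * Complex.I‖ := by
    intro z hz
    have h1 := norm_sub_shift_ge ξ hε hz
    by_contra! h
    have : K * ‖z - ξ + ε * Complex.I‖ ≤ 0 := mul_nonpos_of_nonneg_of_nonpos hK.le h
    have := abs_nonneg z.re
    linarith
  have hinv : ∀ z : ℂ, 0 ≤ z.im → ‖z - ξ + ε * Complex.I‖⁻¹ ≤ K * (1 + |z.re|)⁻¹ := by
    intro z hz
    have h1 := norm_sub_shift_ge ξ hε hz
    rw [← div_eq_mul_inv, inv_eq_one_div, div_le_div_iff₀ (hne z hz) (by positivity), one_mul]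
    exact h1
  constructor
  · refine (hf.integrable_weight.const_mul K).mono'
      (hf.meas.div (by fun_prop)).aestronglyMeasurable (ae_of_all _ fun x => ?_)
    rw [norm_div, div_eq_mul_inv, mul_comm, ← mul_assoc]
    gcongr
    simpa using hinv (x : ℂ) (by simp)
  · refine integral_boundary_eq_zero (f := fun z => f z / (z - ξ + ε * Complex.I))
      (m := fun x => K * ((1 + |x|)⁻¹ * m x)) (R := max R (2 * (|ξ| + ε))) (C := |C| * 2)
      ?_ (hm.const_mul K) ?_ (lt_max_of_lt_left hR) ?_ ?_
    · refine hf.diff.div (by fun_prop) fun z hz h0 => ?_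
      have := hne z (le_of_lt hz)
      rw [h0, norm_zero] at this
      exact lt_irrefl _ this
    · filter_upwards [hb] with x hbx y hy hy1
      rw [norm_div, div_eq_mul_inv, mul_comm, ← mul_assoc]
      have h1 := hinv (x + y * Complex.I) (by simpa using hy.le)
      have h2 : ((x : ℂ) + y * Complex.I).re = x := by simp
      rw [h2] at h1
      exact mul_le_mul h1 (hbx y hy hy1) (norm_nonneg _) (by positivity)
    · intro z hz hzR
      have h1 : 2 * (|ξ| + ε) ≤ ‖z‖ := (le_max_right _ _).trans hzR
      have h2 := hC z hz ((le_max_left _ _).trans hzR)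
      have hz0 : 0 < ‖z‖ := lt_of_lt_of_le (by positivity) h1
      have h3 : ‖z‖ / 2 ≤ ‖z - ξ + ε * Complex.I‖ := by
        have h4 := norm_sub_norm_le z (ξ - ε * Complex.I)
        have h5 : ‖(ξ : ℂ) - ε * Complex.I‖ ≤ |ξ| + ε := by
          refine (norm_sub_le _ _).trans ?_
          rw [norm_mul, Complex.norm_I, Complex.norm_real, Complex.norm_real, Real.norm_eq_abs,
            Real.norm_eq_abs, abs_of_pos hε, mul_one]
        rw [show z - ξ + ε * Complex.I = z - (ξ - ε * Complex.I) by ring]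
        linarith
      rw [norm_div]
      calc ‖f z‖ / ‖z - ξ + ε * Complex.I‖ ≤ (|C| / ‖z‖) / (‖z‖ / 2) := by
            have : C / ‖z‖ ≤ |C| / ‖z‖ := by gcongr; exact le_abs_self C
            have := h2.trans this
            gcongr
        _ = |C| * 2 / ‖z‖ ^ 2 := by field_simp
    · filter_upwards [hf.boundary] with x hx
      refine hx.div ?_ ?_
      · have h0 : Tendsto (fun z : ℂ => z - ξ + ε * Complex.I) (𝓝 (x : ℂ))
            (𝓝 ((x : ℂ) - ξ + ε * Complex.I)) := by
          apply Continuous.tendsto; fun_prop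
        exact h0.comp ((tendsto_add_mul_I x).mono_right nhdsWithin_le_nhds)
      · exact norm_pos_iff.1 (hne x (by simp))

/-- The **Sokhotski–Plemelj** relation between the sum and the difference of the boundary values
on the two sides of the real axis. The function on the lower side is `conj (g (conj z))`. Both
sides come from Cauchy's theorem with a pole in the opposite half plane, so that no Cauchy integral
formula is needed. -/
theorem IsUpper.plemelj (hf : IsUpper f) (hg : IsUpper g)
    (hj : Integrable fun x : ℝ => f x - conj (g x)) {ξ : ℝ}
    (hfc : ContinuousAt (fun x : ℝ => f x) ξ) (hgc : ContinuousAt (fun x : ℝ => g x) ξ) :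
    (∀ ε > 0, IntegrableOn (fun x : ℝ => (f x - conj (g x)) / ((x : ℂ) - ξ))
      {x : ℝ | ε < |x - ξ|}) ∧
    Tendsto (fun ε : ℝ => ∫ x in {x : ℝ | ε < |x - ξ|}, (f x - conj (g x)) / ((x : ℂ) - ξ))
      (𝓝[>] 0) (𝓝 (Complex.I * Real.pi * (f ξ + conj (g ξ)))) := by
  have hcg : Measurable fun x : ℝ => conj (g x) := Complex.continuous_conj.measurable.comp hg.meas
  have hsm : Measurable fun x : ℝ => f x + conj (g x) := hf.meas.add hcg
  have hpois := tendsto_integral_poisson (φ := fun x : ℝ => f x + conj (g x)) hsm (by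
    refine (hf.integrable_poisson_weight.add hg.integrable_poisson_weight).mono'
      ((by fun_prop : Measurable fun x : ℝ => (1 + x ^ 2)⁻¹).mul hsm.norm).aestronglyMeasurable
      (ae_of_all _ fun x => ?_)
    rw [norm_mul, norm_norm, Real.norm_of_nonneg (by positivity), Pi.add_apply, ← mul_add]
    gcongr
    refine (norm_add_le _ _).trans ?_
    rw [RCLike.norm_conj]) (hfc.add (Complex.continuous_conj.continuousAt.comp hgc))
  refine tendsto_truncated_of_tendsto_conjPoisson (hf.meas.sub hcg) hj
    (hfc.sub (Complex.continuous_conj.continuousAt.comp hgc)) ?_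
  rw [mul_assoc]
  refine (hpois.const_mul Complex.I).congr' ?_
  filter_upwards [self_mem_nhdsWithin] with ε (hε : 0 < ε)
  obtain ⟨hf1, hf2⟩ := hf.integral_cauchy ξ hε
  obtain ⟨hg1, hg2⟩ := hg.integral_cauchy ξ hε
  have hg1' : Integrable fun x : ℝ => conj (g x / ((x : ℂ) - ξ + ε * Complex.I)) :=
    Complex.conjCLE.toContinuousLinearMap.integrable_comp hg1
  have hg2' : ∫ x : ℝ, conj (g x / ((x : ℂ) - ξ + ε * Complex.I)) = 0 := by
    rw [integral_conj, hg2, map_zero]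
  have hAj : Integrable fun x : ℝ =>
      (((x - ξ) / ((x - ξ) ^ 2 + ε ^ 2) : ℝ) : ℂ) * (f x - conj (g x)) := by
    refine hj.bdd_mul (c := ε⁻¹) (Complex.measurable_ofReal.comp (by fun_prop)).aestronglyMeasurable
      (ae_of_all _ fun x => ?_)
    rw [Complex.norm_real, Real.norm_eq_abs, abs_div,
      abs_of_pos (by positivity : 0 < (x - ξ) ^ 2 + ε ^ 2), div_le_iff₀ (by positivity), inv_mul_eq_div, le_div_iff₀ hε]
    nlinarith [sq_abs (x - ξ), sq_nonneg (|x - ξ| - ε), abs_nonneg (x - ξ)]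
  -- Poisson kernel on the sum against conjugate Poisson kernel on the difference: they differ by
  -- the two integrands of Cauchy's theorem
  have key : ∀ x : ℝ, Complex.I * ((((ε / ((x - ξ) ^ 2 + ε ^ 2) : ℝ) : ℂ)) * (f x + conj (g x))) =
      (((x - ξ) / ((x - ξ) ^ 2 + ε ^ 2) : ℝ) : ℂ) * (f x - conj (g x)) -
      (f x / ((x : ℂ) - ξ + ε * Complex.I) - conj (g x / ((x : ℂ) - ξ + ε * Complex.I))) := by
    intro x
    have hD : (((x - ξ) ^ 2 + ε ^ 2 : ℝ) : ℂ) ≠ 0 := by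
      exact_mod_cast (by positivity : 0 < (x - ξ) ^ 2 + ε ^ 2).ne'
    have hfac : (((x - ξ) ^ 2 + ε ^ 2 : ℝ) : ℂ) =
        ((x : ℂ) - ξ + ε * Complex.I) * ((x : ℂ) - ξ - ε * Complex.I) := by
      push_cast
      linear_combination (ε : ℂ) ^ 2 * Complex.I_sq
    have h1 : (x : ℂ) - ξ + ε * Complex.I ≠ 0 := fun h => hD (by rw [hfac, h, zero_mul])
    have h2 : (x : ℂ) - ξ - ε * Complex.I ≠ 0 := fun h => hD (by rw [hfac, h, mul_zero])
    rw [map_div₀, map_add, map_sub, map_mul, Complex.conj_I, Complex.conj_ofReal,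
      Complex.conj_ofReal, Complex.conj_ofReal, Complex.ofReal_div, Complex.ofReal_div, hfac,
      mul_neg, ← sub_eq_add_neg]
    have hA : Complex.I * ε = (((x : ℂ) - ξ + ε * Complex.I) -
        ((x : ℂ) - ξ - ε * Complex.I)) / 2 := by ring
    have hB : ((x - ξ : ℝ) : ℂ) = (((x : ℂ) - ξ + ε * Complex.I) +
        ((x : ℂ) - ξ - ε * Complex.I)) / 2 := by push_cast; ring
    rw [← mul_assoc, ← mul_div_assoc, hA, hB]
    generalize (x : ℂ) - ξ + ε * Complex.I = A at h1 ⊢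
    generalize (x : ℂ) - ξ - ε * Complex.I = B at h2 ⊢
    field_simp
    ring
  have hsplit := integral_sub hAj (hf1.sub hg1')
  have hsplit' := integral_sub hf1 hg1'
  rw [hf2, hg2', sub_zero] at hsplit'
  simp only [Pi.sub_apply] at hsplit ⊢
  rw [← integral_const_mul, integral_congr_ae (ae_of_all _ key), hsplit, hsplit', sub_zero]

/-- Without the Cauchy kernel: two functions of order `O(|z|⁻²)` at infinity. -/
theorem integral_jump_eq_zero {mf mg : ℝ → ℝ} (hf : IsUpper f) (hg : IsUpper g)
    (hmf : Integrable mf) (hbf : ∀ᵐ x : ℝ, ∀ y : ℝ, 0 < y → y ≤ 1 → ‖f (x + y * Complex.I)‖ ≤ mf x)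
    (hmg : Integrable mg) (hbg : ∀ᵐ x : ℝ, ∀ y : ℝ, 0 < y → y ≤ 1 → ‖g (x + y * Complex.I)‖ ≤ mg x)
    {C R : ℝ} (hR : 0 < R)
    (hCf : ∀ z : ℂ, 0 < z.im → R ≤ ‖z‖ → ‖f z‖ ≤ C / ‖z‖ ^ 2)
    (hCg : ∀ z : ℂ, 0 < z.im → R ≤ ‖z‖ → ‖g z‖ ≤ C / ‖z‖ ^ 2) :
    ∫ x : ℝ, (f x - conj (g x)) = 0 := by
  have hif : ∀ {h : ℂ → ℂ} {m : ℝ → ℝ}, IsUpper h → Integrable m →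
      (∀ᵐ x : ℝ, ∀ y : ℝ, 0 < y → y ≤ 1 → ‖h (x + y * Complex.I)‖ ≤ m x) →
      Integrable fun x : ℝ => h x := by
    intro h m hh hm hb
    -- the bound on the lines `Im z = y` passes to the boundary
    refine hm.mono' hh.meas.aestronglyMeasurable ?_
    filter_upwards [hh.boundary, hb] with x hx hbx
    refine le_of_tendsto hx.norm ?_
    filter_upwards [Ioc_mem_nhdsGT one_pos] with y hy using hbx y hy.1 hy.2
  have hg1 : Integrable fun x : ℝ => conj (g x) :=
    Complex.conjCLE.toContinuousLinearMap.integrable_comp (hif hg hmg hbg)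
  rw [integral_sub (hif hf hmf hbf) hg1, integral_conj,
    integral_boundary_eq_zero hf.diff hmf hbf hR hCf hf.boundary,
    integral_boundary_eq_zero hg.diff hmg hbg hR hCg hg.boundary, map_zero, sub_zero]

end

section

/-! ### The square root `q` on the closed upper half plane -/

/-- The principal square root; on the closed upper half plane it is continuous. -/
noncomputable def csqrt (z : ℂ) : ℂ := z ^ (1 / 2 : ℂ)

/-- The branch of `√((z² - 1)(z² - k²))` on the closed upper half plane that is positive on
`(1, ∞)`. Its restriction to the real axis gives the values on the upper banks. -/
noncomputable def Q (k : ℝ) (z : ℂ) : ℂ :=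
  csqrt (z - 1) * csqrt (z + 1) * csqrt (z - k) * csqrt (z + k)

theorem csqrt_sq (z : ℂ) : csqrt z ^ 2 = z := by
  unfold csqrt
  rw [← Complex.cpow_nat_mul]
  norm_num

theorem continuousOn_csqrt : ContinuousOn csqrt {z : ℂ | 0 ≤ z.im} := by
  intro z hz
  rcases eq_or_ne z 0 with rfl | h0
  · have := Complex.continuousAt_cpow_zero_of_re_pos (z := (1 / 2 : ℂ)) (by norm_num)
    exact (ContinuousAt.comp (f := fun z : ℂ => (z, (1 / 2 : ℂ))) (x := (0 : ℂ)) this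
      (by fun_prop)).continuousWithinAt
  · have hlog : ContinuousWithinAt Complex.log {z : ℂ | 0 ≤ z.im} z := by
      by_cases hs : z ∈ Complex.slitPlane
      · exact (continuousAt_clog hs).continuousWithinAt
      · rw [Complex.mem_slitPlane_iff, not_or, not_lt, not_not] at hs
        refine Complex.continuousWithinAt_log_of_re_neg_of_im_zero ?_ hs.2
        exact lt_of_le_of_ne hs.1 fun h => h0 (Complex.ext h hs.2)
    have h1 : ContinuousWithinAt (fun z => Complex.exp (Complex.log z * (1 / 2)))
        {z : ℂ | 0 ≤ z.im} z :=
      Complex.continuous_exp.continuousAt.comp_continuousWithinAt (hlog.mul_const _)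
    refine h1.congr_of_eventuallyEq ?_ (Complex.cpow_def_of_ne_zero h0 _)
    filter_upwards [nhdsWithin_le_nhds (isOpen_ne.mem_nhds h0)] with w hw
    exact Complex.cpow_def_of_ne_zero hw _

theorem differentiableOn_csqrt : DifferentiableOn ℂ csqrt {z : ℂ | 0 < z.im} := by
  intro z hz
  refine DifferentiableAt.differentiableWithinAt ?_
  exact differentiableAt_id.cpow_const (Or.inr (ne_of_gt hz))

/-- The phase of the principal square root of a real number. -/
noncomputable def phase (t : ℝ) : ℂ := if 0 ≤ t then 1 else Complex.I

theorem csqrt_ofReal (t : ℝ) : csqrt t = (√|t| : ℝ) * phase t := by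
  have hpos : ∀ t : ℝ, 0 ≤ t → csqrt t = (√t : ℝ) := by
    intro t ht
    unfold csqrt
    rw [Real.sqrt_eq_rpow, Complex.ofReal_cpow ht]
    norm_num
  unfold phase
  split_ifs with h
  · rw [abs_of_nonneg h, hpos t h, mul_one]
  · have h' : t ≤ 0 := (not_le.1 h).le
    have h1 : csqrt (t : ℂ) = csqrt (-t : ℂ) * Complex.exp (Real.pi * Complex.I * (1 / 2)) :=
      Complex.ofReal_cpow_of_nonpos h' _
    have h2 : (Real.pi : ℂ) * Complex.I * (1 / 2) = Real.pi / 2 * Complex.I := by ring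
    rw [h1, h2, Complex.exp_pi_div_two_mul_I, abs_of_nonpos h', ← Complex.ofReal_neg,
      hpos _ (by linarith)]

variable {k : ℝ}

theorem Q_sq (k : ℝ) (z : ℂ) : Q k z ^ 2 = (z ^ 2 - 1) * (z ^ 2 - k ^ 2) := by
  unfold Q
  rw [mul_pow, mul_pow, mul_pow, csqrt_sq, csqrt_sq, csqrt_sq, csqrt_sq]
  ring

theorem continuousOn_Q (k : ℝ) : ContinuousOn (Q k) {z : ℂ | 0 ≤ z.im} := by
  unfold Q
  refine (((continuousOn_csqrt.comp (by fun_prop) ?_).mul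
    (continuousOn_csqrt.comp (by fun_prop) ?_)).mul
    (continuousOn_csqrt.comp (by fun_prop) ?_)).mul (continuousOn_csqrt.comp (by fun_prop) ?_) <;>
  · intro z (hz : 0 ≤ z.im)
    simpa using hz

theorem differentiableOn_Q (k : ℝ) : DifferentiableOn ℂ (Q k) {z : ℂ | 0 < z.im} := by
  unfold Q
  refine (((differentiableOn_csqrt.comp (by fun_prop) ?_).mul
    (differentiableOn_csqrt.comp (by fun_prop) ?_)).mul
    (differentiableOn_csqrt.comp (by fun_prop) ?_)).mul
    (differentiableOn_csqrt.comp (by fun_prop) ?_) <;>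
  · intro z (hz : 0 < z.im)
    simpa using hz

theorem continuous_Q_ofReal (k : ℝ) : Continuous fun x : ℝ => Q k x :=
  (continuousOn_Q k).comp_continuous Complex.continuous_ofReal fun x => by simp

theorem norm_Q_sq (k : ℝ) (z : ℂ) : ‖Q k z‖ ^ 2 = ‖z ^ 2 - 1‖ * ‖z ^ 2 - k ^ 2‖ := by
  rw [← norm_pow, Q_sq, norm_mul]

theorem Q_ofReal (k x : ℝ) : Q k x = (absq k x : ℂ) *
    (phase (x - 1) * phase (x + 1) * phase (x - k) * phase (x + k)) := by
  have h : absq k x = √|x - 1| * √|x + 1| * √|x - k| * √|x + k| := by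
    unfold absq
    rw [← Real.sqrt_mul (abs_nonneg _), ← Real.sqrt_mul (by positivity),
      ← Real.sqrt_mul (by positivity), ← abs_mul, ← abs_mul, ← abs_mul]
    congr 2
    ring
  unfold Q
  have e1 : (x : ℂ) - 1 = ((x - 1 : ℝ) : ℂ) := by push_cast; ring
  have e2 : (x : ℂ) + 1 = ((x + 1 : ℝ) : ℂ) := by push_cast; ring
  have e3 : (x : ℂ) - k = ((x - k : ℝ) : ℂ) := by push_cast; ring
  have e4 : (x : ℂ) + k = ((x + k : ℝ) : ℂ) := by push_cast; ring
  rw [e1, e2, e3, e4, csqrt_ofReal, csqrt_ofReal, csqrt_ofReal, csqrt_ofReal, h]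
  push_cast
  ring

theorem absq_nonneg (k x : ℝ) : 0 ≤ absq k x := Real.sqrt_nonneg _

theorem absq_neg (k x : ℝ) : absq k (-x) = absq k x := by
  unfold absq; rw [neg_sq]

theorem absq_sq (k x : ℝ) : absq k x ^ 2 = |x ^ 2 - 1| * |x ^ 2 - k ^ 2| := by
  unfold absq; rw [Real.sq_sqrt (abs_nonneg _), abs_mul]

@[fun_prop]
theorem continuous_absq (k : ℝ) : Continuous (absq k) := by
  unfold absq; fun_prop

theorem absq_pos {x : ℝ} (h1 : x ^ 2 ≠ 1) (h2 : x ^ 2 ≠ k ^ 2) : 0 < absq k x := by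
  unfold absq
  exact Real.sqrt_pos.2 (abs_pos.2 (mul_ne_zero (sub_ne_zero.2 h1) (sub_ne_zero.2 h2)))

theorem absq_pos_of_abs (hk0 : 0 < k) {x : ℝ} (h1 : k < |x|) (h2 : |x| < 1) : 0 < absq k x := by
  have h3 := sq_abs x
  refine absq_pos ?_ ?_
  · nlinarith [abs_nonneg x]
  · nlinarith [abs_nonneg x]

theorem norm_phase (t : ℝ) : ‖phase t‖ = 1 := by
  unfold phase; split_ifs <;> simp

theorem norm_Q_ofReal (k x : ℝ) : ‖Q k x‖ = absq k x := by
  rw [Q_ofReal]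
  simp [norm_phase, abs_of_nonneg (absq_nonneg k x)]

theorem Q_ofReal_right (hk0 : 0 < k) {x : ℝ} (hx : x ∈ Set.Icc k 1) :
    Q k x = Complex.I * absq k x := by
  rcases eq_or_lt_of_le hx.2 with rfl | h1
  · have : absq k 1 = 0 := by simp [absq]
    rw [Q_ofReal, this]; simp
  · rw [Q_ofReal, phase, phase, phase, phase, if_neg (by linarith),
      if_pos (by linarith [hx.1]), if_pos (by linarith [hx.1]), if_pos (by linarith [hx.1])]
    ring

theorem Q_ofReal_left (hk0 : 0 < k) {x : ℝ} (hx : x ∈ Set.Icc (-1) (-k)) :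
    Q k x = -Complex.I * absq k x := by
  rcases eq_or_lt_of_le hx.2 with rfl | h1
  · have : absq k (-k) = 0 := by simp [absq]
    rw [Q_ofReal, this]; simp
  · rw [Q_ofReal, phase, phase, phase, phase, if_neg (by linarith),
      if_pos (by linarith [hx.1]), if_neg (by linarith [hx.1]), if_neg (by linarith [hx.1])]
    linear_combination (absq k x : ℂ) * Complex.I * Complex.I_sq

theorem mem_slits_iff {k x : ℝ} : (∃ j, x ∈ slit k j) ↔ x ∈ Set.Icc (-1) (-k) ∨ x ∈ Set.Icc k 1 := by
  rw [Fin.exists_fin_two]; rfl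

/-- On the gaps `q` is real. -/
theorem conj_Q_ofReal (hk0 : 0 < k) (hk1 : k < 1) {x : ℝ} (hx : ∀ j, x ∉ slit k j) :
    conj (Q k x) = Q k x := by
  have hx0 : ¬ (-1 ≤ x ∧ x ≤ -k) := hx 0
  have hx1 : ¬ (k ≤ x ∧ x ≤ 1) := hx 1
  rw [Q_ofReal]
  unfold phase
  rcases lt_or_ge x k with h | h
  · rcases lt_or_ge x (-k) with h' | h'
    · have : x < -1 := by by_contra! hh; exact hx0 ⟨hh, h'.le⟩
      rw [if_neg (by linarith), if_neg (by linarith), if_neg (by linarith), if_neg (by linarith)]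
      simp
    · rw [if_neg (by linarith), if_pos (by linarith), if_neg (by linarith), if_pos (by linarith)]
      simp
  · have : 1 < x := by by_contra! hh; exact hx1 ⟨h, hh⟩
    rw [if_pos (by linarith), if_pos (by linarith), if_pos (by linarith), if_pos (by linarith)]
    simp

theorem Q_zero (hk0 : 0 < k) : Q k 0 = -k := by
  have h := Q_ofReal k 0
  unfold phase at h
  rw [if_neg (by norm_num), if_pos (by norm_num), if_neg (by linarith), if_pos (by linarith)] at h
  have h2 : absq k 0 = k := by
    unfold absq
    rw [show |((0 : ℝ) ^ 2 - 1) * (0 ^ 2 - k ^ 2)| = k ^ 2 by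
      rw [show ((0 : ℝ) ^ 2 - 1) * (0 ^ 2 - k ^ 2) = k ^ 2 by ring]; exact abs_of_nonneg (by positivity),
      Real.sqrt_sq hk0.le]
  rw [h2] at h
  rw [Complex.ofReal_zero] at h
  rw [h]
  linear_combination (k : ℂ) * Complex.I_sq

theorem Q_ne_zero (k : ℝ) {z : ℂ} (hz : 0 < z.im) : Q k z ≠ 0 := by
  have him : ∀ t : ℝ, z ^ 2 - (t : ℂ) ^ 2 ≠ 0 := by
    intro t h
    have h' : (z - t) * (z + t) = 0 := by linear_combination h
    rcases mul_eq_zero.1 h' with h1 | h1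
    · have := congrArg Complex.im h1
      simp at this
      linarith
    · have := congrArg Complex.im h1
      simp at this
      linarith
  have h1 := him 1
  rw [Complex.ofReal_one, one_pow] at h1
  intro h
  have := Q_sq k z
  rw [h] at this
  exact mul_ne_zero h1 (him k) (by rw [← this]; ring)

theorem absq_le_norm_Q (k x y : ℝ) : absq k x ≤ ‖Q k (x + y * Complex.I)‖ := by
  refine le_of_sq_le_sq ?_ (norm_nonneg _)
  rw [absq_sq, norm_Q_sq]
  have h : ∀ t : ℝ, |x ^ 2 - t ^ 2| ≤ ‖((x : ℂ) + y * Complex.I) ^ 2 - (t : ℂ) ^ 2‖ := by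
    intro t
    have h1 : ∀ s : ℝ, |x - s| ≤ ‖(x : ℂ) + y * Complex.I - s‖ := fun s => by
      simpa using Complex.abs_re_le_norm ((x : ℂ) + y * Complex.I - s)
    have h2 := h1 (-t)
    rw [sub_neg_eq_add, Complex.ofReal_neg, sub_neg_eq_add] at h2
    rw [show x ^ 2 - t ^ 2 = (x - t) * (x + t) by ring,
      show ((x : ℂ) + y * Complex.I) ^ 2 - (t : ℂ) ^ 2 =
        ((x : ℂ) + y * Complex.I - t) * ((x : ℂ) + y * Complex.I + t) by ring, abs_mul, norm_mul]
    exact mul_le_mul (h1 t) h2 (abs_nonneg _) (norm_nonneg _)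
  have h1 := h 1
  rw [one_pow, Complex.ofReal_one, one_pow] at h1
  exact mul_le_mul h1 (h k) (abs_nonneg _) (norm_nonneg _)

theorem norm_sq_le_norm_Q (hk0 : 0 < k) (hk1 : k < 1) {z : ℂ} (hz : 2 ≤ ‖z‖) :
    ‖z‖ ^ 2 / 2 ≤ ‖Q k z‖ := by
  refine le_of_sq_le_sq ?_ (norm_nonneg _)
  rw [norm_Q_sq]
  have h1 : ‖z‖ ^ 2 / 2 ≤ ‖z ^ 2 - 1‖ := by
    have := norm_sub_norm_le (z ^ 2) 1
    rw [norm_pow, norm_one] at this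
    nlinarith
  have h2 : ‖z‖ ^ 2 / 2 ≤ ‖z ^ 2 - k ^ 2‖ := by
    have := norm_sub_norm_le (z ^ 2) ((k : ℂ) ^ 2)
    rw [norm_pow, norm_pow, Complex.norm_real, Real.norm_eq_abs, sq_abs] at this
    nlinarith
  rw [sq (‖z‖ ^ 2 / 2)]
  gcongr

/-- The square root singularities at the tips are of order `|Im z|^{-1/2}`. -/
theorem im_le_norm_Q_sq (hk0 : 0 < k) (hk1 : k < 1) {z : ℂ} (hz : 0 ≤ z.im) :
    (1 - k ^ 2) / 2 * k * z.im ≤ ‖Q k z‖ ^ 2 := by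
  rw [norm_Q_sq]
  have h : ∀ t : ℝ, 0 < t → t * z.im ≤ ‖z ^ 2 - (t : ℂ) ^ 2‖ := by
    intro t ht
    have i1 : z.im ≤ ‖z - t‖ := by
      have := (le_abs_self _).trans (Complex.abs_im_le_norm (z - t)); simpa using this
    have i2 : z.im ≤ ‖z + t‖ := by
      have := (le_abs_self _).trans (Complex.abs_im_le_norm (z + t)); simpa using this
    have i3 : 2 * t ≤ ‖z + t‖ + ‖z - t‖ := by
      have := norm_sub_le (z + t) (z - t)
      rw [show z + t - (z - t) = ((2 * t : ℝ) : ℂ) by push_cast; ring, Complex.norm_real,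
        Real.norm_of_nonneg (by positivity)] at this
      exact this
    rw [show z ^ 2 - (t : ℂ) ^ 2 = (z - t) * (z + t) by ring, norm_mul]
    rcases le_total t ‖z + t‖ with h | h
    · rw [mul_comm]; gcongr
    · gcongr; linarith
  have h1 := h 1 one_pos
  rw [Complex.ofReal_one, one_pow, one_mul] at h1
  have h2 := h k hk0
  have h3 : 1 - k ^ 2 ≤ ‖z ^ 2 - k ^ 2‖ + ‖z ^ 2 - 1‖ := by
    have := norm_sub_le (z ^ 2 - k ^ 2) (z ^ 2 - 1)
    rw [show z ^ 2 - (k : ℂ) ^ 2 - (z ^ 2 - 1) = ((1 - k ^ 2 : ℝ) : ℂ) by push_cast; ring,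
      Complex.norm_real, Real.norm_of_nonneg (by nlinarith)] at this
    exact this
  have hk : 0 < 1 - k ^ 2 := by nlinarith
  rcases le_total ((1 - k ^ 2) / 2) ‖z ^ 2 - 1‖ with h | h
  · rw [mul_assoc]; gcongr
  · have h4 : (1 - k ^ 2) / 2 ≤ ‖z ^ 2 - k ^ 2‖ := by linarith
    calc (1 - k ^ 2) / 2 * k * z.im = z.im * ((1 - k ^ 2) / 2 * k) := by ring
      _ ≤ z.im * ((1 - k ^ 2) / 2) := by
          gcongr; exact mul_le_of_le_one_right (by linarith) hk1.le
      _ ≤ _ := by gcongr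

/-! ### Integrability of `1 / |q|` -/

/-- Of two factors with sum at least `δ`, only one can be small. -/
theorem inv_sqrt_mul_le {a b δ : ℝ} (ha : 0 ≤ a) (hb : 0 ≤ b) (hδ : 0 < δ) (h : δ ≤ a + b) :
    (√(a * b))⁻¹ ≤ (√δ)⁻¹ * ((√a)⁻¹ + (√b)⁻¹) := by
  rcases ha.eq_or_lt with rfl | ha'
  · simp; positivity
  rcases hb.eq_or_lt with rfl | hb'
  · simp; positivity
  have hsa := Real.sqrt_pos.2 ha'
  have hsb := Real.sqrt_pos.2 hb'
  have hsd := Real.sqrt_pos.2 hδ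
  have h1 : √δ ≤ √a + √b := by
    rw [Real.sqrt_le_left (by positivity)]
    nlinarith [Real.sq_sqrt ha, Real.sq_sqrt hb, mul_pos hsa hsb]
  rw [Real.sqrt_mul ha, ← sub_nonneg]
  have : (√δ)⁻¹ * ((√a)⁻¹ + (√b)⁻¹) - (√a * √b)⁻¹ = (√a + √b - √δ) * (√δ * √a * √b)⁻¹ := by
    field_simp
    ring
  rw [this]
  exact mul_nonneg (by linarith) (by positivity)

theorem integrable_inv_sqrt_abs_indicator :
    Integrable ((Metric.ball (0 : ℝ) 4).indicator fun x : ℝ => (√|x|)⁻¹) := by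
  have h : LocallyIntegrable (fun x : ℝ => (√|x|)⁻¹) := by
    refine locallyIntegrable_of_norm_le_rpow (C := 1) (α := 1 / 2) (by simp)
      (by norm_num) (ae_of_all _ fun x => ?_) ?_
    · rw [Real.norm_of_nonneg (by positivity), one_mul, Real.norm_eq_abs,
        Real.rpow_neg (abs_nonneg _), Real.sqrt_eq_rpow]
    · exact Measurable.aestronglyMeasurable (by fun_prop)
  rw [integrable_indicator_iff measurableSet_ball]
  exact (h.integrableOn_isCompact (isCompact_closedBall (0 : ℝ) 4)).mono_set
    Metric.ball_subset_closedBall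

theorem integrable_inv_absq (hk0 : 0 < k) (hk1 : k < 1) : Integrable fun x => (absq k x)⁻¹ := by
  set h : ℝ → ℝ := (Metric.ball (0 : ℝ) 4).indicator fun x : ℝ => (√|x|)⁻¹ with hh
  have hi : ∀ t, Integrable fun x => h (x - t) := fun t =>
    integrable_inv_sqrt_abs_indicator.comp_sub_right t
  have hnn : ∀ x, 0 ≤ h x := fun x => Set.indicator_nonneg (fun x _ => by positivity) x
  have hkk : 0 < 1 - k ^ 2 := by nlinarith
  set A := (√(1 - k ^ 2))⁻¹
  -- one inverse square root for each tip, and the decay `O(x⁻²)` at infinity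
  set G : ℝ → ℝ := fun x => A * ((√2)⁻¹ * (h (x - 1) + h (x - (-1))) +
      (√(2 * k))⁻¹ * (h (x - k) + h (x - (-k)))) + 2 * (1 + x ^ 2)⁻¹ with hG
  have hGi : Integrable G :=
    ((((hi 1).add (hi (-1))).const_mul _).add (((hi k).add (hi (-k))).const_mul _)).const_mul _
      |>.add (integrable_inv_one_add_sq.const_mul 2)
  refine hGi.mono' (by fun_prop) (ae_of_all _ fun x => ?_)
  rw [Real.norm_of_nonneg (inv_nonneg.2 (absq_nonneg _ _))]
  rcases le_or_gt |x| 2 with hx | hx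
  · have hval : ∀ t, |t| ≤ 1 → h (x - t) = (√|x - t|)⁻¹ := by
      intro t ht
      rw [hh, Set.indicator_of_mem]
      rw [Metric.mem_ball, dist_zero_right, Real.norm_eq_abs]
      have := abs_sub x t
      linarith
    have hfac : ∀ t, 0 < t → t ≤ 1 → (√|x ^ 2 - t ^ 2|)⁻¹ ≤
        (√(2 * t))⁻¹ * (h (x - t) + h (x - -t)) := by
      intro t ht ht1
      rw [hval t (by rwa [abs_of_pos ht]), hval (-t) (by rwa [abs_neg, abs_of_pos ht]),
        show x ^ 2 - t ^ 2 = (x - t) * (x - -t) by ring, abs_mul]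
      refine inv_sqrt_mul_le (abs_nonneg _) (abs_nonneg _) (by positivity) ?_
      have := abs_sub (x - -t) (x - t)
      rw [show x - -t - (x - t) = 2 * t by ring, abs_of_pos (by positivity)] at this
      linarith
    have h1 := hfac 1 one_pos le_rfl
    have h2 := hfac k hk0 hk1.le
    rw [one_pow, mul_one] at h1
    have h3 : (absq k x)⁻¹ ≤ A * ((√|x ^ 2 - 1|)⁻¹ + (√|x ^ 2 - k ^ 2|)⁻¹) := by
      unfold absq
      rw [abs_mul]
      refine inv_sqrt_mul_le (abs_nonneg _) (abs_nonneg _) hkk ?_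
      have := abs_sub (x ^ 2 - k ^ 2) (x ^ 2 - 1)
      rw [show x ^ 2 - k ^ 2 - (x ^ 2 - 1) = 1 - k ^ 2 by ring, abs_of_pos hkk] at this
      linarith
    have hA : 0 ≤ A := by positivity
    have h4 : 0 ≤ 2 * (1 + x ^ 2)⁻¹ := by positivity
    calc (absq k x)⁻¹ ≤ A * ((√|x ^ 2 - 1|)⁻¹ + (√|x ^ 2 - k ^ 2|)⁻¹) := h3
      _ ≤ A * ((√2)⁻¹ * (h (x - 1) + h (x - (-1))) +
          (√(2 * k))⁻¹ * (h (x - k) + h (x - (-k)))) := by gcongr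
      _ ≤ G x := by rw [hG]; simp only; linarith
  · have hx2 : 4 ≤ x ^ 2 := by rw [← sq_abs]; nlinarith
    have h1 : (1 + x ^ 2) / 2 ≤ absq k x := by
      refine le_of_sq_le_sq ?_ (absq_nonneg _ _)
      rw [absq_sq, abs_of_pos (by linarith), abs_of_pos (by nlinarith), sq]
      have h1 : (1 + x ^ 2) / 2 ≤ x ^ 2 - k ^ 2 := by nlinarith
      have h2 : (1 + x ^ 2) / 2 ≤ x ^ 2 - 1 := by linarith
      exact mul_le_mul h2 h1 (by positivity) (by linarith)
    have h2 : (absq k x)⁻¹ ≤ 2 * (1 + x ^ 2)⁻¹ := by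
      calc (absq k x)⁻¹ ≤ ((1 + x ^ 2) / 2)⁻¹ := by gcongr
        _ = 2 * (1 + x ^ 2)⁻¹ := by rw [inv_div]; ring
    have h3 : 0 ≤ A * ((√2)⁻¹ * (h (x - 1) + h (x - (-1))) +
          (√(2 * k))⁻¹ * (h (x - k) + h (x - (-k)))) := by
      have := hnn (x - 1); have := hnn (x - (-1)); have := hnn (x - k); have := hnn (x - (-k))
      positivity
    rw [hG]
    simp only
    linarith

end

section

/-! ### Functions on the slit domain and their boundary values -/

variable {k : ℝ}

theorem mem_slitDomain_iff {z : ℂ} : z ∈ slitDomain k ↔ ∀ j, ∀ ξ ∈ slit k j, (ξ : ℂ) ≠ z := by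
  simp [slitDomain]

theorem mem_slitDomain_of_im_ne_zero {z : ℂ} (hz : z.im ≠ 0) : z ∈ slitDomain k := by
  rw [mem_slitDomain_iff]
  rintro j ξ - rfl
  exact hz (Complex.ofReal_im ξ)

theorem ofReal_mem_slitDomain_iff {x : ℝ} : (x : ℂ) ∈ slitDomain k ↔ ∀ j, x ∉ slit k j := by
  rw [mem_slitDomain_iff]
  refine forall_congr' fun j => ⟨fun h hx => h x hx rfl, fun h ξ hξ he => h ?_⟩
  rwa [← Complex.ofReal_injective he]

theorem isOpen_slitDomain (k : ℝ) : IsOpen (slitDomain k) := by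
  unfold slitDomain
  rw [isOpen_compl_iff]
  refine isClosed_iUnion_of_finite fun j => ?_
  exact (isCompact_Icc.image Complex.continuous_ofReal).isClosed

theorem abs_le_one_of_mem_slit (hk0 : 0 < k) {j : Fin 2} {x : ℝ}
    (hx : x ∈ slit k j) : k ≤ |x| ∧ |x| ≤ 1 := by
  rcases mem_slits_iff.1 ⟨j, hx⟩ with h | h
  · rw [abs_of_nonpos (by linarith [h.2])]
    exact ⟨by linarith [h.2], by linarith [h.1]⟩
  · rw [abs_of_nonneg (by linarith [h.1])]
    exact ⟨h.1, h.2⟩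

theorem ne_zero_of_mem_slit (hk0 : 0 < k) {j : Fin 2} {x : ℝ}
    (hx : x ∈ slit k j) : x ≠ 0 :=
  abs_pos.1 (hk0.trans_le (abs_le_one_of_mem_slit hk0 hx).1)

theorem mem_slitDomain_of_one_lt_norm (hk0 : 0 < k) {z : ℂ} (hz : 1 < ‖z‖) :
    z ∈ slitDomain k := by
  rw [mem_slitDomain_iff]
  rintro j ξ hξ rfl
  rw [Complex.norm_real, Real.norm_eq_abs] at hz
  linarith [(abs_le_one_of_mem_slit hk0 hξ).2]

theorem bankFilter_one (ξ : ℝ) : bankFilter 1 ξ = 𝓝[{z : ℂ | 0 < z.im}] (ξ : ℂ) := by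
  unfold bankFilter; simp

theorem bankFilter_neg_one (ξ : ℝ) : bankFilter (-1) ξ = 𝓝[{z : ℂ | z.im < 0}] (ξ : ℂ) := by
  unfold bankFilter; simp

theorem ofReal_mem_closure (ξ : ℝ) : (ξ : ℂ) ∈ closure {z : ℂ | 0 < z.im} := by
  rw [Complex.closure_setOfPred_lt_im]; simp

theorem bankFilter_neBot {σ : ℝ} (hσ : σ = 1 ∨ σ = -1) (ξ : ℝ) : (bankFilter σ ξ).NeBot := by
  have h : Tendsto (fun y : ℝ => (ξ : ℂ) + σ * y * Complex.I) (𝓝[>] 0) (bankFilter σ ξ) := by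
    refine tendsto_nhdsWithin_iff.2 ⟨?_, ?_⟩
    · have : Tendsto (fun y : ℝ => (ξ : ℂ) + σ * y * Complex.I) (𝓝 0)
          (𝓝 ((ξ : ℂ) + σ * (0 : ℝ) * Complex.I)) := by
        apply Continuous.tendsto; fun_prop
      rw [Complex.ofReal_zero, mul_zero, zero_mul, add_zero] at this
      exact this.mono_left nhdsWithin_le_nhds
    · filter_upwards [self_mem_nhdsWithin] with y (hy : 0 < y)
      have h2 : 0 < σ * σ := by rcases hσ with rfl | rfl <;> norm_num
      simp only [Complex.add_im, Complex.ofReal_im, Complex.mul_im,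
        Complex.mul_re, Complex.ofReal_re, Complex.I_im, Complex.I_re, mul_one, mul_zero,
        sub_zero, add_zero, zero_add, zero_mul]
      nlinarith
  exact h.neBot

theorem tendsto_conj_bankFilter (σ ξ : ℝ) :
    Tendsto (fun z : ℂ => conj z) (bankFilter σ ξ) (bankFilter (-σ) ξ) := by
  refine tendsto_nhdsWithin_iff.2 ⟨?_, ?_⟩
  · have := (Complex.continuous_conj.tendsto (ξ : ℂ)).mono_left
      (nhdsWithin_le_nhds (s := {z : ℂ | 0 < σ * z.im}))
    rwa [Complex.conj_ofReal] at this
  · filter_upwards [self_mem_nhdsWithin] with z hz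
    simpa using hz

theorem tendsto_neg_bankFilter (σ ξ : ℝ) :
    Tendsto (fun z : ℂ => -z) (bankFilter σ ξ) (bankFilter (-σ) (-ξ)) := by
  refine tendsto_nhdsWithin_iff.2 ⟨?_, ?_⟩
  · have := (continuous_neg.tendsto (ξ : ℂ)).mono_left
      (nhdsWithin_le_nhds (s := {z : ℂ | 0 < σ * z.im}))
    rwa [← Complex.ofReal_neg] at this
  · filter_upwards [self_mem_nhdsWithin] with z hz
    simpa using hz

theorem tendsto_inv_cocompact : Tendsto (fun u : ℂ => u⁻¹) (𝓝[≠] 0) (cocompact ℂ) := by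
  rw [← Metric.cobounded_eq_cocompact]
  exact tendsto_inv₀_nhdsNE_zero

/-- A function analytic near infinity approaches its limit at the rate `O(1/|z|)`. -/
theorem exists_bound_at_infinity {F : ℂ → ℂ} {P : ℂ} (hd : DifferentiableOn ℂ F {z | 1 < ‖z‖})
    (hP : Tendsto F (cocompact ℂ) (𝓝 P)) :
    ∃ C R : ℝ, 1 ≤ R ∧ ∀ z, R ≤ ‖z‖ → ‖F z - P‖ ≤ C / ‖z‖ := by
  -- the inversion `u = 1/z` has a removable singularity at the origin
  set G : ℂ → ℂ := Function.update (fun u => F u⁻¹) 0 P with hG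
  have hopen : IsOpen {z : ℂ | 1 < ‖z‖} := isOpen_lt continuous_const continuous_norm
  have hGne : ∀ u : ℂ, u ≠ 0 → G u = F u⁻¹ := fun u hu => Function.update_of_ne hu _ _
  have hc : ContinuousAt G 0 := by
    rw [hG, continuousAt_update_same]
    exact hP.comp tendsto_inv_cocompact
  have hda : ∀ᶠ u in 𝓝[≠] (0 : ℂ), DifferentiableAt ℂ G u := by
    filter_upwards [self_mem_nhdsWithin,
      nhdsWithin_le_nhds (Metric.ball_mem_nhds (0 : ℂ) one_pos)] with u hu hu1
    have hu0 : u ≠ 0 := hu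
    rw [mem_ball_zero_iff] at hu1
    have h1 : DifferentiableAt ℂ F u⁻¹ := hd.differentiableAt (hopen.mem_nhds (by
      rw [Set.mem_ofPred_eq, norm_inv]
      exact (one_lt_inv₀ (norm_pos_iff.2 hu0)).2 hu1))
    refine (DifferentiableAt.comp u h1 (differentiableAt_inv hu0)).congr_of_eventuallyEq ?_
    filter_upwards [isOpen_ne.mem_nhds hu0] with v hv using hGne v hv
  have han := Complex.analyticAt_of_differentiable_on_punctured_nhds_of_continuousAt hda hc
  obtain ⟨C, hC⟩ := han.differentiableAt.hasDerivAt.isBigO_sub.bound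
  obtain ⟨r, hr, hrC⟩ := Metric.eventually_nhds_iff.1 hC
  refine ⟨C, max 1 (2 / r), le_max_left _ _, fun z hz => ?_⟩
  have hz1 : 1 ≤ ‖z‖ := (le_max_left _ _).trans hz
  have hz2 : 2 / r ≤ ‖z‖ := (le_max_right _ _).trans hz
  have hz0 : z ≠ 0 := norm_pos_iff.1 (by linarith)
  have h0 : G 0 = P := Function.update_self _ _ _
  have := hrC (y := z⁻¹) (by
    rw [dist_zero_right, norm_inv, inv_lt_comm₀ (by linarith) hr]
    refine lt_of_lt_of_le ?_ hz2
    rw [inv_eq_one_div]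
    gcongr
    norm_num)
  rwa [hGne _ (inv_ne_zero hz0), inv_inv, h0, sub_zero, norm_inv, ← div_eq_mul_inv] at this

/-- A continuous function on the closed upper half plane, analytic in the interior, with
`U = P + O(1/|z|)` at infinity. -/
structure IsUpperExt (U : ℂ → ℂ) (P : ℂ) : Prop where
  cont : ContinuousOn U {z | 0 ≤ z.im}
  diff : DifferentiableOn ℂ U {z | 0 < z.im}
  inf : ∃ C R : ℝ, 1 ≤ R ∧ ∀ z : ℂ, 0 < z.im → R ≤ ‖z‖ → ‖U z - P‖ ≤ C / ‖z‖

namespace IsUpperExt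

variable {U : ℂ → ℂ} {P : ℂ}

theorem continuous_ofReal (h : IsUpperExt U P) : Continuous fun x : ℝ => U x :=
  h.cont.comp_continuous Complex.continuous_ofReal fun x => by simp

theorem tendsto (h : IsUpperExt U P) (x : ℝ) :
    Tendsto (fun y : ℝ => U (x + y * Complex.I)) (𝓝[>] 0) (𝓝 (U x)) := by
  have h1 := h.cont x (by simp)
  exact (h1.mono_left (nhdsWithin_mono _ fun z (hz : 0 < z.im) => hz.le)).comp (tendsto_add_mul_I x)

theorem bounded (h : IsUpperExt U P) : ∃ B : ℝ, 0 ≤ B ∧ ∀ z : ℂ, 0 < z.im → ‖U z‖ ≤ B := by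
  obtain ⟨C, R, hR, hC⟩ := h.inf
  have hcl : IsClosed {z : ℂ | 0 ≤ z.im} := isClosed_le continuous_const Complex.continuous_im
  have hcomp : IsCompact ({z : ℂ | 0 ≤ z.im} ∩ Metric.closedBall 0 R) :=
    (isCompact_closedBall 0 R).inter_left hcl
  obtain ⟨B, hB⟩ := hcomp.exists_bound_of_continuousOn (h.cont.mono Set.inter_subset_left)
  refine ⟨|B| + (|C| + ‖P‖), by positivity, fun z hz => ?_⟩
  rcases le_or_gt ‖z‖ R with hzR | hzR
  · have := hB z ⟨le_of_lt hz, mem_closedBall_zero_iff.2 hzR⟩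
    linarith [le_abs_self B, abs_nonneg C, norm_nonneg P]
  · have h1 := hC z hz hzR.le
    have h2 : C / ‖z‖ ≤ |C| := by
      refine (div_le_div_of_nonneg_right (le_abs_self C) (norm_nonneg _)).trans ?_
      exact div_le_self (abs_nonneg C) (by linarith)
    have h3 := norm_add_le (U z - P) P
    rw [sub_add_cancel] at h3
    linarith [abs_nonneg B]

theorem isUpper_sub (h : IsUpperExt U P) : IsUpper fun z => U z - P := by
  obtain ⟨B, hB0, hB⟩ := h.bounded
  obtain ⟨C, R, hR, hC⟩ := h.inf
  refine ⟨h.diff.sub_const P, (h.continuous_ofReal.sub continuous_const).measurable,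
    ⟨fun x => ((B + ‖P‖) * (1 + R) + 2 * |C|) * (1 + |x|)⁻¹, ?_, ?_⟩,
    ⟨C, R, by linarith, hC⟩, ae_of_all _ fun x => (h.tendsto x).sub_const P⟩
  · refine (integrable_inv_one_add_sq.const_mul ((B + ‖P‖) * (1 + R) + 2 * |C|)).mono'
      (by fun_prop) (ae_of_all _ fun x => ?_)
    rw [Real.norm_of_nonneg (by positivity), mul_comm, mul_assoc, ← mul_inv]
    gcongr
    nlinarith [abs_nonneg x, sq_abs x]
  · refine ae_of_all _ fun x y hy _ => ?_
    have him : 0 < ((x : ℂ) + y * Complex.I).im := by simpa using hy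
    have hxn : |x| ≤ ‖(x : ℂ) + y * Complex.I‖ := by
      simpa using Complex.abs_re_le_norm ((x : ℂ) + y * Complex.I)
    have hb : ‖U (x + y * Complex.I) - P‖ ≤ B + ‖P‖ :=
      (norm_sub_le _ _).trans (by gcongr; exact hB _ him)
    simp only
    rw [← div_eq_mul_inv, le_div_iff₀ (by positivity)]
    rcases le_or_gt |x| R with hx | hx
    · calc _ ≤ (B + ‖P‖) * (1 + R) := by gcongr
        _ ≤ _ := by linarith [abs_nonneg C]
    · have h1 := hC _ him (hx.le.trans hxn)
      have h2 : ‖U (x + y * Complex.I) - P‖ ≤ |C| / |x| := by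
        refine h1.trans ?_
        have : 0 < |x| := by linarith
        gcongr
        exact le_abs_self C
      calc _ ≤ |C| / |x| * (1 + |x|) := by gcongr
        _ ≤ |C| / |x| * (2 * |x|) := by gcongr; linarith
        _ = 2 * |C| := by
          have : 0 < |x| := by linarith
          field_simp
        _ ≤ _ := by
          have : 0 ≤ (B + ‖P‖) * (1 + R) := by positivity
          linarith

theorem ae_absq_ne_zero (k : ℝ) : ∀ᵐ x : ℝ, absq k x ≠ 0 := by
  filter_upwards [Measure.ae_ne volume 1, Measure.ae_ne volume (-1), Measure.ae_ne volume k,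
    Measure.ae_ne volume (-k)] with x h1 h2 h3 h4
  refine (absq_pos ?_ ?_).ne'
  · intro h; rcases sq_eq_one_iff.1 h with h | h <;> contradiction
  · intro h; rcases sq_eq_sq_iff_eq_or_eq_neg.1 h with h | h <;> contradiction

theorem norm_div_Q_le {B : ℝ} (hB : ∀ z : ℂ, 0 < z.im → ‖U z‖ ≤ B) :
    ∀ᵐ x : ℝ, ∀ y : ℝ, 0 < y → y ≤ 1 →
      ‖U (x + y * Complex.I) / Q k (x + y * Complex.I)‖ ≤ B * (absq k x)⁻¹ := by
  filter_upwards [ae_absq_ne_zero k] with x hx y hy _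
  rw [norm_div, div_eq_mul_inv]
  have h0 := lt_of_le_of_ne (absq_nonneg k x) hx.symm
  have h1 := hB (x + y * Complex.I) (by simpa using hy)
  have h2 := absq_le_norm_Q k x y
  have h3 := (norm_nonneg _).trans h1
  gcongr

theorem norm_div_Q_le_at_infinity (hk0 : 0 < k) (hk1 : k < 1) {B : ℝ} (hB0 : 0 ≤ B)
    (hB : ∀ z : ℂ, 0 < z.im → ‖U z‖ ≤ B) {z : ℂ} (hz : 0 < z.im) (hz2 : 2 ≤ ‖z‖) :
    ‖U z / Q k z‖ ≤ 2 * B / ‖z‖ ^ 2 := by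
  have h1 := norm_sq_le_norm_Q hk0 hk1 hz2
  have hz0 : 0 < ‖z‖ := by linarith
  rw [norm_div]
  calc ‖U z‖ / ‖Q k z‖ ≤ B / (‖z‖ ^ 2 / 2) := by gcongr; exact hB z hz
    _ = _ := by field_simp

theorem isUpper_div_Q (h : IsUpperExt U P) (hk0 : 0 < k) (hk1 : k < 1) :
    IsUpper fun z => U z / Q k z := by
  obtain ⟨B, hB0, hB⟩ := h.bounded
  refine ⟨h.diff.div (differentiableOn_Q k) fun z hz => Q_ne_zero k hz,
    h.continuous_ofReal.measurable.div (continuous_Q_ofReal k).measurable,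
    ⟨fun x => B * (absq k x)⁻¹, ?_, norm_div_Q_le hB⟩, ⟨B, 2, by norm_num, fun z hz hz2 => ?_⟩, ?_⟩
  · refine ((integrable_inv_absq hk0 hk1).const_mul B).bdd_mul (c := 1)
      (Measurable.aestronglyMeasurable (by fun_prop)) (ae_of_all _ fun x => ?_)
    rw [Real.norm_of_nonneg (by positivity)]
    exact inv_le_one_of_one_le₀ (by linarith [abs_nonneg x])
  · refine (norm_div_Q_le_at_infinity hk0 hk1 hB0 hB hz hz2).trans ?_
    have hz0 : 0 < ‖z‖ := by linarith
    rw [div_le_div_iff₀ (by positivity) hz0]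
    nlinarith [mul_nonneg hB0 hz0.le, mul_nonneg (mul_nonneg hB0 hz0.le) (sub_nonneg.2 hz2)]
  · filter_upwards [ae_absq_ne_zero k] with x hx
    refine (h.tendsto x).div ?_ ?_
    · exact (((continuousOn_Q k) x (by simp)).mono_left (nhdsWithin_mono _
        fun z (hz : 0 < z.im) => hz.le)).comp (tendsto_add_mul_I x)
    · rwa [← norm_ne_zero_iff, norm_Q_ofReal]

end IsUpperExt

end

section

variable {k : ℝ} {p q : ℂ} {F G : ℂ → ℂ}

theorem bank_eq {σ ξ : ℝ} (hσ : σ = 1 ∨ σ = -1) {w : ℂ} (h : Tendsto F (bankFilter σ ξ) (𝓝 w)) :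
    bank σ F ξ = w :=
  haveI := bankFilter_neBot hσ ξ
  h.limUnder_eq

theorem IsSlitAnalytic.tendsto_bank (h : IsSlitAnalytic k 0 p F) {σ : ℝ} (hσ : σ = 1 ∨ σ = -1)
    {j : Fin 2} {ξ : ℝ} (hξ : ξ ∈ slit k j) : Tendsto F (bankFilter σ ξ) (𝓝 (bank σ F ξ)) :=
  tendsto_nhds_limUnder (h.banks σ hσ j ξ hξ)

theorem IsSlitAnalytic.tendsto_infinity (h : IsSlitAnalytic k 0 p F) :
    Tendsto F (cocompact ℂ) (𝓝 (valueAtInfinity F)) :=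
  tendsto_nhds_limUnder h.infinity

theorem valueAtInfinity_eq {w : ℂ} (h : Tendsto F (cocompact ℂ) (𝓝 w)) : valueAtInfinity F = w :=
  h.limUnder_eq

/-! #### Operations on functions of the class -/

theorem isSlitAnalytic_const (k : ℝ) (w : ℂ) : IsSlitAnalytic k 0 0 fun _ => w where
  differentiableOn := differentiableOn_const w
  pole := ⟨w, by simp⟩
  infinity := ⟨w, tendsto_const_nhds⟩
  banks _ _ _ _ _ := ⟨w, tendsto_const_nhds⟩
  tips _ _ := ⟨w, tendsto_const_nhds⟩

theorem IsSlitAnalytic.add (hF : IsSlitAnalytic k 0 p F) (hG : IsSlitAnalytic k 0 q G) :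
    IsSlitAnalytic k 0 (p + q) fun z => F z + G z where
  differentiableOn := hF.differentiableOn.add hG.differentiableOn
  pole := by
    obtain ⟨u, hu⟩ := hF.pole
    obtain ⟨v, hv⟩ := hG.pole
    exact ⟨u + v, (hu.add hv).congr fun z => by ring⟩
  infinity := ⟨_, hF.tendsto_infinity.add hG.tendsto_infinity⟩
  banks σ hσ _ _ hξ := ⟨_, (hF.tendsto_bank hσ hξ).add (hG.tendsto_bank hσ hξ)⟩
  tips ξ hξ := by
    obtain ⟨u, hu⟩ := hF.tips ξ hξ
    obtain ⟨v, hv⟩ := hG.tips ξ hξ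
    exact ⟨u + v, hu.add hv⟩

theorem IsSlitAnalytic.const_mul (hF : IsSlitAnalytic k 0 p F) (w : ℂ) :
    IsSlitAnalytic k 0 (w * p) fun z => w * F z where
  differentiableOn := hF.differentiableOn.const_mul w
  pole := by
    obtain ⟨u, hu⟩ := hF.pole
    exact ⟨w * u, (hu.const_mul w).congr fun z => by ring⟩
  infinity := ⟨_, hF.tendsto_infinity.const_mul w⟩
  banks σ hσ _ _ hξ := ⟨_, (hF.tendsto_bank hσ hξ).const_mul w⟩
  tips ξ hξ := by
    obtain ⟨u, hu⟩ := hF.tips ξ hξ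
    exact ⟨w * u, hu.const_mul w⟩

theorem isSlitAnalytic_inv (hk0 : 0 < k) : IsSlitAnalytic k 0 1 fun z => z⁻¹ where
  differentiableOn := fun z hz => (differentiableAt_inv (by simpa using hz.2)).differentiableWithinAt
  pole := ⟨0, by simp⟩
  infinity := ⟨0, by
    rw [← Metric.cobounded_eq_cocompact]
    exact tendsto_inv₀_cobounded⟩
  banks σ _ j ξ hξ := ⟨(ξ : ℂ)⁻¹, ((continuousAt_inv₀ (by
    exact_mod_cast ne_zero_of_mem_slit hk0 hξ)).tendsto.mono_left nhdsWithin_le_nhds)⟩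
  tips ξ hξ := ⟨(ξ : ℂ)⁻¹, ((continuousAt_inv₀ (by
    have : ξ ≠ 0 := by rcases hξ with rfl | rfl | rfl | rfl <;> linarith
    exact_mod_cast this)).tendsto.mono_left nhdsWithin_le_nhds)⟩

theorem neg_mem_slit {j : Fin 2} {ξ : ℝ} (hξ : ξ ∈ slit k j) : -ξ ∈ slit k (1 - j) := by
  fin_cases j
  · have h : -1 ≤ ξ ∧ ξ ≤ -k := hξ
    exact (⟨by linarith, by linarith⟩ : k ≤ -ξ ∧ -ξ ≤ 1)
  · have h : k ≤ ξ ∧ ξ ≤ 1 := hξ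
    exact (⟨by linarith, by linarith⟩ : -1 ≤ -ξ ∧ -ξ ≤ -k)

theorem neg_mem_slitDomain {z : ℂ} (hz : z ∈ slitDomain k) : -z ∈ slitDomain k := by
  rw [mem_slitDomain_iff] at hz ⊢
  intro j ξ hξ h
  refine hz _ _ (neg_mem_slit hξ) ?_
  rw [Complex.ofReal_neg, h, neg_neg]

theorem conj_mem_slitDomain {z : ℂ} (hz : z ∈ slitDomain k) : conj z ∈ slitDomain k := by
  rw [mem_slitDomain_iff] at hz ⊢
  intro j ξ hξ h
  refine hz _ _ hξ ?_
  rw [← Complex.conj_conj z, ← h, Complex.conj_ofReal]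

theorem neg_bank {σ : ℝ} (hσ : σ = 1 ∨ σ = -1) : -σ = 1 ∨ -σ = -1 := by
  rcases hσ with rfl | rfl <;> norm_num

theorem tendsto_neg_punctured : Tendsto (fun z : ℂ => -z) (𝓝[≠] 0) (𝓝[≠] 0) := by
  refine tendsto_nhdsWithin_iff.2 ⟨?_, ?_⟩
  · have := (continuous_neg.tendsto (0 : ℂ)).mono_left (nhdsWithin_le_nhds (s := {(0 : ℂ)}ᶜ))
    rwa [neg_zero] at this
  · filter_upwards [self_mem_nhdsWithin] with z hz using neg_ne_zero.2 hz

theorem tendsto_conj_punctured : Tendsto (fun z : ℂ => conj z) (𝓝[≠] 0) (𝓝[≠] 0) := by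
  refine tendsto_nhdsWithin_iff.2 ⟨?_, ?_⟩
  · have := (Complex.continuous_conj.tendsto (0 : ℂ)).mono_left
      (nhdsWithin_le_nhds (s := {(0 : ℂ)}ᶜ))
    rwa [map_zero] at this
  · filter_upwards [self_mem_nhdsWithin] with z hz using (map_ne_zero _).2 hz

theorem tendsto_conj_cocompact : Tendsto (fun z : ℂ => conj z) (cocompact ℂ) (cocompact ℂ) :=
  Complex.conjCLE.toHomeomorph.isClosedEmbedding.tendsto_cocompact

theorem IsSlitAnalytic.comp_neg (hF : IsSlitAnalytic k 0 p F) :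
    IsSlitAnalytic k 0 (-p) fun z => F (-z) where
  differentiableOn := hF.differentiableOn.comp differentiableOn_id.neg fun z hz =>
    ⟨neg_mem_slitDomain hz.1, by simpa using hz.2⟩
  pole := by
    obtain ⟨u, hu⟩ := hF.pole
    rw [Complex.ofReal_zero] at hu ⊢
    refine ⟨u, (hu.comp tendsto_neg_punctured).congr fun z => ?_⟩
    simp only [Function.comp_apply, sub_zero]
    rw [div_neg, neg_div]
  infinity := ⟨_, hF.tendsto_infinity.comp
    (Homeomorph.neg ℂ).isClosedEmbedding.tendsto_cocompact⟩
  banks σ hσ _ ξ hξ := ⟨_, (hF.tendsto_bank (neg_bank hσ) (neg_mem_slit hξ)).comp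
    (tendsto_neg_bankFilter σ ξ)⟩
  tips ξ hξ := by
    obtain ⟨u, hu⟩ := hF.tips (-ξ) (by rcases hξ with rfl | rfl | rfl | rfl <;> simp)
    refine ⟨u, hu.comp (tendsto_nhdsWithin_iff.2 ⟨?_, ?_⟩)⟩
    · have := (continuous_neg.tendsto (ξ : ℂ)).mono_left (nhdsWithin_le_nhds (s := slitDomain k))
      rwa [← Complex.ofReal_neg] at this
    · filter_upwards [self_mem_nhdsWithin] with z hz using neg_mem_slitDomain hz

theorem IsSlitAnalytic.conj_conj (hF : IsSlitAnalytic k 0 p F) :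
    IsSlitAnalytic k 0 (conj p) fun z => conj (F (conj z)) where
  differentiableOn := by
    intro z hz
    have hz' : conj z ∈ slitDomain k \ {((0 : ℝ) : ℂ)} :=
      ⟨conj_mem_slitDomain hz.1, by simpa using hz.2⟩
    have ho : IsOpen (slitDomain k \ {((0 : ℝ) : ℂ)}) :=
      (isOpen_slitDomain k).sdiff isClosed_singleton
    have h1 := (hF.differentiableOn.differentiableAt (ho.mem_nhds hz')).conj_conj
    rw [Complex.conj_conj] at h1
    exact h1.differentiableWithinAt
  pole := by
    obtain ⟨u, hu⟩ := hF.pole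
    rw [Complex.ofReal_zero] at hu ⊢
    refine ⟨conj u, (((Complex.continuous_conj.tendsto u).comp hu).comp
      tendsto_conj_punctured).congr fun z => ?_⟩
    simp [map_sub, map_div₀]
  infinity := ⟨_, ((Complex.continuous_conj.tendsto _).comp hF.tendsto_infinity).comp
    tendsto_conj_cocompact⟩
  banks σ hσ _ ξ hξ := ⟨_, ((Complex.continuous_conj.tendsto _).comp
    (hF.tendsto_bank (neg_bank hσ) hξ)).comp (tendsto_conj_bankFilter σ ξ)⟩
  tips ξ hξ := by
    obtain ⟨u, hu⟩ := hF.tips ξ hξ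
    refine ⟨conj u, ((Complex.continuous_conj.tendsto _).comp hu).comp
      (tendsto_nhdsWithin_iff.2 ⟨?_, ?_⟩)⟩
    · have := (Complex.continuous_conj.tendsto (ξ : ℂ)).mono_left
        (nhdsWithin_le_nhds (s := slitDomain k))
      rwa [Complex.conj_ofReal] at this
    · filter_upwards [self_mem_nhdsWithin] with z hz using conj_mem_slitDomain hz

/-! #### Values of the operations on the banks and at infinity -/

section values

variable {σ : ℝ} {j : Fin 2} {ξ : ℝ}

theorem bank_add (hF : IsSlitAnalytic k 0 p F) (hG : IsSlitAnalytic k 0 q G)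
    (hσ : σ = 1 ∨ σ = -1) (hξ : ξ ∈ slit k j) :
    bank σ (fun z => F z + G z) ξ = bank σ F ξ + bank σ G ξ :=
  bank_eq hσ ((hF.tendsto_bank hσ hξ).add (hG.tendsto_bank hσ hξ))

theorem bank_const_mul (hF : IsSlitAnalytic k 0 p F) (w : ℂ) (hσ : σ = 1 ∨ σ = -1)
    (hξ : ξ ∈ slit k j) : bank σ (fun z => w * F z) ξ = w * bank σ F ξ :=
  bank_eq hσ ((hF.tendsto_bank hσ hξ).const_mul w)

theorem bank_const (w : ℂ) (hσ : σ = 1 ∨ σ = -1) (ξ : ℝ) : bank σ (fun _ => w) ξ = w :=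
  bank_eq hσ tendsto_const_nhds

theorem bank_comp_neg (hF : IsSlitAnalytic k 0 p F) (hσ : σ = 1 ∨ σ = -1)
    (hξ : ξ ∈ slit k j) : bank σ (fun z => F (-z)) ξ = bank (-σ) F (-ξ) :=
  bank_eq hσ ((hF.tendsto_bank (neg_bank hσ) (neg_mem_slit hξ)).comp (tendsto_neg_bankFilter σ ξ))

theorem bank_conj_conj (hF : IsSlitAnalytic k 0 p F) (hσ : σ = 1 ∨ σ = -1)
    (hξ : ξ ∈ slit k j) : bank σ (fun z => conj (F (conj z))) ξ = conj (bank (-σ) F ξ) :=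
  bank_eq hσ (((Complex.continuous_conj.tendsto _).comp
    (hF.tendsto_bank (neg_bank hσ) hξ)).comp (tendsto_conj_bankFilter σ ξ))

theorem bank_inv (hk0 : 0 < k) (hσ : σ = 1 ∨ σ = -1) (hξ : ξ ∈ slit k j) :
    bank σ (fun z => z⁻¹) ξ = (ξ : ℂ)⁻¹ :=
  bank_eq hσ ((continuousAt_inv₀ (by
    exact_mod_cast ne_zero_of_mem_slit hk0 hξ)).tendsto.mono_left nhdsWithin_le_nhds)

theorem valueAtInfinity_add (hF : IsSlitAnalytic k 0 p F) (hG : IsSlitAnalytic k 0 q G) :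
    valueAtInfinity (fun z => F z + G z) = valueAtInfinity F + valueAtInfinity G :=
  valueAtInfinity_eq (hF.tendsto_infinity.add hG.tendsto_infinity)

theorem valueAtInfinity_const_mul (hF : IsSlitAnalytic k 0 p F) (w : ℂ) :
    valueAtInfinity (fun z => w * F z) = w * valueAtInfinity F :=
  valueAtInfinity_eq (hF.tendsto_infinity.const_mul w)

theorem valueAtInfinity_comp_neg (hF : IsSlitAnalytic k 0 p F) :
    valueAtInfinity (fun z => F (-z)) = valueAtInfinity F :=
  valueAtInfinity_eq (hF.tendsto_infinity.comp
    (Homeomorph.neg ℂ).isClosedEmbedding.tendsto_cocompact)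

theorem valueAtInfinity_conj_conj (hF : IsSlitAnalytic k 0 p F) :
    valueAtInfinity (fun z => conj (F (conj z))) = conj (valueAtInfinity F) :=
  valueAtInfinity_eq (((Complex.continuous_conj.tendsto _).comp hF.tendsto_infinity).comp
    tendsto_conj_cocompact)

end values

/-! ### The boundary pair -/

theorem IsSlitAnalytic.continuousAt (h : IsSlitAnalytic k 0 p F) {z : ℂ} (hz : z ∈ slitDomain k)
    (h0 : z ≠ 0) : ContinuousAt F z :=
  (h.differentiableOn.differentiableAt
    (((isOpen_slitDomain k).sdiff isClosed_singleton).mem_nhds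
      ⟨hz, by simpa using h0⟩)).continuousAt

/-- Off the slits, the regular part of `F` has a limit at every real point, `0` included. -/
theorem IsSlitAnalytic.exists_tendsto_gap (h : IsSlitAnalytic k 0 p F) {x : ℝ}
    (hx : ∀ j, x ∉ slit k j) :
    ∃ w, Tendsto (fun z => F z - p / z) (𝓝[≠] (x : ℂ)) (𝓝 w) := by
  rcases eq_or_ne x 0 with rfl | h0
  · simpa using h.pole
  · have h0' : (x : ℂ) ≠ 0 := by exact_mod_cast h0
    have hc : ContinuousAt (fun z => F z - p / z) (x : ℂ) :=
      (h.continuousAt (ofReal_mem_slitDomain_iff.2 hx) h0').sub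
        (continuousAt_const.div continuousAt_id h0')
    exact ⟨_, hc.tendsto.mono_left nhdsWithin_le_nhds⟩

/-- The regular part `F - p / ζ` extends continuously to the closed upper half plane; on the slits
the extension gives the values on the upper banks. -/
theorem IsSlitAnalytic.exists_upperExt (hk0 : 0 < k) (h : IsSlitAnalytic k 0 p F) :
    ∃ U : ℂ → ℂ, IsUpperExt U (valueAtInfinity F) ∧
      ∀ x : ℝ, Tendsto (fun z => F z - p / z) (𝓝[{z : ℂ | 0 < z.im}] (x : ℂ)) (𝓝 (U x)) := by
  set Φ : ℂ → ℂ := fun z => F z - p / z with hΦ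
  have hd : DifferentiableOn ℂ Φ {z | 0 < z.im} := by
    intro z (hz : 0 < z.im)
    have hz0 : z ≠ 0 := by rintro rfl; simp at hz
    have h1 : DifferentiableAt ℂ F z := h.differentiableOn.differentiableAt
      (((isOpen_slitDomain k).sdiff isClosed_singleton).mem_nhds
        ⟨mem_slitDomain_of_im_ne_zero hz.ne', by simpa using hz0⟩)
    exact (h1.sub ((differentiableAt_const p).div differentiableAt_id hz0)).differentiableWithinAt
  have hreal : ∀ x : ℝ, ∃ w, Tendsto Φ (𝓝[{z : ℂ | 0 < z.im}] (x : ℂ)) (𝓝 w) := by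
    intro x
    by_cases hx : ∀ j, x ∉ slit k j
    · obtain ⟨w, hw⟩ := h.exists_tendsto_gap hx
      refine ⟨w, hw.mono_left (nhdsWithin_mono _ fun z (hz : 0 < z.im) hzx => ?_)⟩
      rw [Set.mem_singleton_iff.1 hzx] at hz
      simp at hz
    · push Not at hx
      obtain ⟨j, hj⟩ := hx
      have h1 := h.tendsto_bank (Or.inl rfl) hj
      rw [bankFilter_one] at h1
      have h0 : (x : ℂ) ≠ 0 := by exact_mod_cast ne_zero_of_mem_slit hk0 hj
      exact ⟨_, h1.sub ((continuousAt_const.div continuousAt_id h0).tendsto.mono_left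
        nhdsWithin_le_nhds)⟩
  have hcl : closure {z : ℂ | 0 < z.im} = {z | 0 ≤ z.im} := Complex.closure_setOfPred_lt_im 0
  set U := extendFrom {z : ℂ | 0 < z.im} Φ with hU
  have hUeq : ∀ z : ℂ, 0 < z.im → U z = Φ z :=
    extendFrom_extends (A := {z : ℂ | 0 < z.im}) hd.continuousOn
  refine ⟨U, ⟨?_, ?_, ?_⟩, fun x => tendsto_extendFrom (hreal x)⟩
  · refine continuousOn_extendFrom hcl.ge fun z hz => ?_
    rcases eq_or_lt_of_le (show 0 ≤ z.im from hz) with h0 | h0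
    · obtain ⟨w, hw⟩ := hreal z.re
      have : ((z.re : ℝ) : ℂ) = z := Complex.ext rfl h0
      rw [this] at hw
      exact ⟨w, hw⟩
    · exact ⟨_, hd.continuousOn z h0⟩
  · exact hd.congr hUeq
  · obtain ⟨C, R, hR, hC⟩ := exists_bound_at_infinity (F := F) (h.differentiableOn.mono (by
      intro z (hz : 1 < ‖z‖)
      refine ⟨mem_slitDomain_of_one_lt_norm hk0 hz, ?_⟩
      rintro h0
      rw [Set.mem_singleton_iff.1 h0] at hz
      simp at hz
      linarith)) h.tendsto_infinity
    refine ⟨C + ‖p‖, R, hR, fun z hz hzR => ?_⟩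
    rw [hUeq z hz, hΦ]
    have h1 := hC z hzR
    calc ‖F z - p / z - valueAtInfinity F‖ = ‖(F z - valueAtInfinity F) - p / z‖ := by
          congr 1; ring
      _ ≤ C / ‖z‖ + ‖p‖ / ‖z‖ := (norm_sub_le _ _).trans (by rw [norm_div]; gcongr)
      _ = (C + ‖p‖) / ‖z‖ := by ring

/-- A function of the class is encoded by the continuous extensions `U`, `V` to the closed upper
half plane of `F - p / ζ` and of its conjugate reflection. -/
theorem IsSlitAnalytic.exists_pair (hk0 : 0 < k) (h : IsSlitAnalytic k 0 p F) :
    ∃ U V : ℂ → ℂ, IsUpperExt U (valueAtInfinity F) ∧ IsUpperExt V (conj (valueAtInfinity F)) ∧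
      (∀ x : ℝ, (∀ j, x ∉ slit k j) → U x = conj (V x)) ∧
      ∀ j, ∀ x ∈ slit k j, bank 1 F x = U x + p / x ∧ bank (-1) F x = conj (V x) + p / x := by
  obtain ⟨U, hU, hUt⟩ := h.exists_upperExt hk0
  have h' := h.conj_conj
  obtain ⟨V, hV, hVt⟩ := h'.exists_upperExt hk0
  rw [valueAtInfinity_conj_conj h] at hV
  have hnb : ∀ x : ℝ, (𝓝[{z : ℂ | 0 < z.im}] (x : ℂ)).NeBot := fun x => by
    rw [← bankFilter_one]; exact bankFilter_neBot (Or.inl rfl) x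
  have hbank : ∀ {p : ℂ} {F U : ℂ → ℂ}, IsSlitAnalytic k 0 p F →
      (∀ x : ℝ, Tendsto (fun z => F z - p / z) (𝓝[{z : ℂ | 0 < z.im}] (x : ℂ)) (𝓝 (U x))) →
      ∀ j, ∀ x ∈ slit k j, bank 1 F x = U x + p / x := by
    intro p F U _ hUt j x hx
    refine bank_eq (Or.inl rfl) ?_
    rw [bankFilter_one]
    have h0 : (x : ℂ) ≠ 0 := by exact_mod_cast ne_zero_of_mem_slit hk0 hx
    refine ((hUt x).add ((continuousAt_const.div continuousAt_id h0).tendsto.mono_left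
      nhdsWithin_le_nhds : Tendsto (fun z : ℂ => p / z) _ (𝓝 (p / (x : ℂ))))).congr fun z => ?_
    exact sub_add_cancel (F z) (p / z)
  refine ⟨U, V, hU, hV, fun x hx => ?_, fun j x hx => ⟨hbank h hUt j x hx, ?_⟩⟩
  · obtain ⟨w, hw⟩ := h.exists_tendsto_gap hx
    have hsub : {z : ℂ | 0 < z.im} ⊆ {(x : ℂ)}ᶜ := fun z (hz : 0 < z.im) hzx => by
      rw [Set.mem_singleton_iff.1 hzx] at hz
      simp at hz
    have e1 : U x = w := haveI := hnb x
      tendsto_nhds_unique (hUt x) (hw.mono_left (nhdsWithin_mono _ hsub))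
    have hcj : Tendsto (fun z : ℂ => conj z) (𝓝[{z : ℂ | 0 < z.im}] (x : ℂ)) (𝓝[≠] (x : ℂ)) := by
      have := tendsto_conj_bankFilter 1 x
      rw [bankFilter_one, bankFilter_neg_one] at this
      refine this.mono_right (nhdsWithin_mono _ fun z (hz : z.im < 0) hzx => ?_)
      rw [Set.mem_singleton_iff.1 hzx] at hz
      simp at hz
    have e2 : V x = conj w := by
      have := hnb x
      refine tendsto_nhds_unique (hVt x)
        ((((Complex.continuous_conj.tendsto w).comp hw).comp hcj).congr fun z => ?_)
      simp [map_sub, map_div₀]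
    rw [e1, e2, Complex.conj_conj]
  · have := hbank h' hVt j x hx
    rw [bank_conj_conj h (Or.inl rfl) hx] at this
    have := congrArg conj this
    rwa [Complex.conj_conj, map_add, map_div₀, Complex.conj_conj, Complex.conj_ofReal] at this

end

section

/-! ### Relations between the boundary values on the two banks -/

/-- The truncated integrals over the two slits have a limit when added up. -/
def HasPVSum (k ξ : ℝ) (φ : Fin 2 → ℝ → ℝ) (L : ℝ) : Prop :=
  (∀ i, ∀ ε > 0, IntegrableOn (φ i) {η : ℝ | η ∈ Set.Icc (lo k i) (hi k i) ∧ ε < |η - ξ|}) ∧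
    Tendsto (fun ε => ∑ i, truncIntegral (lo k i) (hi k i) ξ (φ i) ε) (𝓝[>] 0) (𝓝 L)

variable {k ξ L : ℝ} {p : ℂ} {F : ℂ → ℂ}

theorem HasPVSum.congr {φ ψ : Fin 2 → ℝ → ℝ} (h : HasPVSum k ξ φ L)
    (he : ∀ i, ∀ᵐ x ∂volume.restrict (Set.Icc (lo k i) (hi k i)), φ i x = ψ i x) :
    HasPVSum k ξ ψ L := by
  have h' : ∀ i, ∀ ε : ℝ, φ i =ᵐ[volume.restrict
      {η : ℝ | η ∈ Set.Icc (lo k i) (hi k i) ∧ ε < |η - ξ|}] ψ i :=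
    fun i ε => ae_restrict_of_ae_restrict_of_subset (fun _ hη => hη.1) (he i)
  refine ⟨fun i ε hε => (h.1 i ε hε).congr (h' i ε), h.2.congr' ?_⟩
  filter_upwards with ε
  exact Finset.sum_congr rfl fun i _ => integral_congr_ae (h' i ε)

theorem HasPVSum.eq_sum {φ : Fin 2 → ℝ → ℝ} (h : HasPVSum k ξ φ L) {v : Fin 2 → ℝ}
    (hv : ∀ i, HasPV (lo k i) (hi k i) ξ (φ i) (v i)) : L = ∑ i, v i :=
  tendsto_nhds_unique h.2 (tendsto_finsetSum _ fun i _ => (hv i).2)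

theorem HasPVSum.add {φ ψ : Fin 2 → ℝ → ℝ} {M : ℝ} (h : HasPVSum k ξ φ L)
    (h' : HasPVSum k ξ ψ M) : HasPVSum k ξ (fun i x => φ i x + ψ i x) (L + M) := by
  refine ⟨fun i ε hε => (h.1 i ε hε).add (h'.1 i ε hε), (h.2.add h'.2).congr' ?_⟩
  filter_upwards [self_mem_nhdsWithin] with ε hε
  rw [← Finset.sum_add_distrib]
  exact Finset.sum_congr rfl fun i _ => (integral_add (h.1 i ε hε) (h'.1 i ε hε)).symm

theorem HasPVSum.const_mul {φ : Fin 2 → ℝ → ℝ} (h : HasPVSum k ξ φ L) (c : ℝ) :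
    HasPVSum k ξ (fun i x => c * φ i x) (c * L) := by
  refine ⟨fun i ε hε => (h.1 i ε hε).const_mul c, (h.2.const_mul c).congr' ?_⟩
  filter_upwards with ε
  rw [Finset.mul_sum]
  exact Finset.sum_congr rfl fun i _ => (integral_const_mul c _).symm

theorem HasPVSum.hasPV_one {φ : Fin 2 → ℝ → ℝ} (h : HasPVSum k ξ φ L) {v : ℝ}
    (hv : HasPV (lo k 0) (hi k 0) ξ (φ 0) v) : HasPV (lo k 1) (hi k 1) ξ (φ 1) (L - v) := by
  refine ⟨h.1 1, (h.2.sub hv.2).congr fun ε => ?_⟩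
  rw [Fin.sum_univ_two]
  ring

theorem measurableSet_abs_gt (ε ξ : ℝ) : MeasurableSet {x : ℝ | ε < |x - ξ|} :=
  measurableSet_lt measurable_const (show Measurable fun x : ℝ => |x - ξ| by fun_prop)

/-- The integral of a function vanishing off the slits. -/
theorem setIntegral_eq_sum_slits (hk0 : 0 < k) {φ : ℝ → ℂ} (hφ : ∀ x, (∀ j, x ∉ slit k j) → φ x = 0)
    {T : Set ℝ} (hT : MeasurableSet T) (hi : IntegrableOn φ T) :
    ∫ x in T, φ x = ∑ i, ∫ x in {x : ℝ | x ∈ Set.Icc (lo k i) (TwoSlit.hi k i) ∧ x ∈ T}, φ x := by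
  rw [Fin.sum_univ_two]
  have hm : ∀ i, MeasurableSet {x : ℝ | x ∈ Set.Icc (lo k i) (TwoSlit.hi k i) ∧ x ∈ T} :=
    fun i => measurableSet_Icc.inter hT
  rw [← setIntegral_union ?_ (hm 1) (hi.mono_set fun x hx => hx.2) (hi.mono_set fun x hx => hx.2)]
  · refine setIntegral_eq_of_subset_of_forall_sdiff_eq_zero hT ?_ ?_
    · rintro x (hx | hx) <;> exact hx.2
    · rintro x ⟨hxT, hx⟩
      refine hφ x fun j hj => hx ?_
      rcases (Fin.exists_fin_two (p := fun j => x ∈ slit k j)).1 ⟨j, hj⟩ with h | h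
      · exact Or.inl ⟨h, hxT⟩
      · exact Or.inr ⟨h, hxT⟩
  · refine Set.disjoint_left.2 ?_
    rintro x ⟨⟨_, h1⟩, _⟩ ⟨⟨h2, _⟩, _⟩
    have h1' : x ≤ -k := h1
    have h2' : k ≤ x := h2
    linarith

theorem hasPVSum_of_tendsto (hk0 : 0 < k) {φ : ℝ → ℂ}
    (hφ : ∀ x, (∀ j, x ∉ slit k j) → φ x = 0) {z : ℂ}
    (h1 : ∀ ε > 0, IntegrableOn φ {x : ℝ | ε < |x - ξ|})
    (h2 : Tendsto (fun ε : ℝ => ∫ x in {x : ℝ | ε < |x - ξ|}, φ x) (𝓝[>] 0) (𝓝 z)) :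
    HasPVSum k ξ (fun _ x => (φ x).re) z.re ∧ HasPVSum k ξ (fun _ x => (φ x).im) z.im := by
  have hI : ∀ i, ∀ ε > 0,
      IntegrableOn φ {x : ℝ | x ∈ Set.Icc (lo k i) (hi k i) ∧ ε < |x - ξ|} :=
    fun i ε hε => (h1 ε hε).mono_set fun x hx => hx.2
  refine ⟨⟨fun i ε hε => (hI i ε hε).re, ?_⟩, ⟨fun i ε hε => (hI i ε hε).im, ?_⟩⟩
  · refine ((Complex.continuous_re.tendsto z).comp h2).congr' ?_
    filter_upwards [self_mem_nhdsWithin] with ε hε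
    rw [Function.comp_apply, setIntegral_eq_sum_slits hk0 hφ (measurableSet_abs_gt ε ξ) (h1 ε hε),
      Complex.re_sum]
    exact Finset.sum_congr rfl fun i _ => (integral_re (hI i ε hε)).symm
  · refine ((Complex.continuous_im.tendsto z).comp h2).congr' ?_
    filter_upwards [self_mem_nhdsWithin] with ε hε
    rw [Function.comp_apply, setIntegral_eq_sum_slits hk0 hφ (measurableSet_abs_gt ε ξ) (h1 ε hε),
      Complex.im_sum]
    exact Finset.sum_congr rfl fun i _ => (integral_im (hI i ε hε)).symm

theorem slit_one_of {x : ℝ} (h1 : k < x) (h2 : x < 1) : x ∈ slit k 1 :=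
  (⟨h1.le, h2.le⟩ : k ≤ x ∧ x ≤ 1)

theorem integrable_of_slit_support {φ : ℝ → ℂ} (hk0 : 0 < k) (hc : Continuous φ)
    (hφ : ∀ x, (∀ j, x ∉ slit k j) → φ x = 0) : Integrable φ := by
  refine hc.integrable_of_hasCompactSupport (HasCompactSupport.intro (isCompact_Icc (a := -1)
    (b := (1 : ℝ))) fun x hx => hφ x fun j hj => hx ?_)
  exact abs_le.1 (abs_le_one_of_mem_slit hk0 hj).2

/-- The jump of `F` across the slits determines the mean of its boundary values: the
Sokhotski–Plemelj relation for the regular part of `F`, whose jump is supported on the slits. Only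
the real part of the relation is stated; the other part is the statement for `-iF`. -/
theorem IsSlitAnalytic.hasPVSum_jump (hk0 : 0 < k) (h : IsSlitAnalytic k 0 p F)
    (h1 : k < ξ) (h2 : ξ < 1) :
    HasPVSum k ξ (fun _ x => (bank 1 F x - bank (-1) F x).re / (x - ξ))
      (-Real.pi * (bank 1 F ξ + bank (-1) F ξ - 2 * p / ξ - 2 * valueAtInfinity F).im) := by
  obtain ⟨U, V, hU, hV, hgap, hbank⟩ := h.exists_pair hk0
  set P := valueAtInfinity F
  have hj0 : ∀ x : ℝ, (∀ j, x ∉ slit k j) → (U x - P) - conj (V x - conj P) = 0 := by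
    intro x hx
    rw [hgap x hx, map_sub, Complex.conj_conj, sub_self]
  have hcont : Continuous fun x : ℝ => (U x - P) - conj (V x - conj P) :=
    (hU.continuous_ofReal.sub continuous_const).sub
      (Complex.continuous_conj.comp (hV.continuous_ofReal.sub continuous_const))
  obtain ⟨g1, g2⟩ := hU.isUpper_sub.plemelj hV.isUpper_sub
    (integrable_of_slit_support hk0 hcont hj0) (ξ := ξ)
    (hU.continuous_ofReal.sub continuous_const).continuousAt
    (hV.continuous_ofReal.sub continuous_const).continuousAt
  have h3 := (hasPVSum_of_tendsto hk0 (fun x hx => by rw [hj0 x hx, zero_div]) g1 g2).1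
  obtain ⟨b1, b2⟩ := hbank 1 ξ (slit_one_of h1 h2)
  have hval : (Complex.I * Real.pi * (U ξ - P + conj (V ξ - conj P))).re =
      -Real.pi * (bank 1 F ξ + bank (-1) F ξ - 2 * p / ξ - 2 * P).im := by
    rw [b1, b2, map_sub, Complex.conj_conj,
      show U ξ + p / ξ + (conj (V ξ) + p / ξ) - 2 * p / ξ - 2 * P =
        U ξ - P + (conj (V ξ) - P) by ring]
    simp
  rw [hval] at h3
  refine h3.congr fun i => ?_
  filter_upwards [self_mem_ae_restrict measurableSet_Icc] with x hx
  obtain ⟨b1, b2⟩ := hbank i x hx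
  rw [b1, b2, map_sub, Complex.conj_conj, ← Complex.ofReal_sub, Complex.div_ofReal_re]
  congr 2
  ring

theorem IsUpperExt.norm_ofReal_le {U : ℂ → ℂ} {P : ℂ} (hU : IsUpperExt U P) {B : ℝ}
    (hB : ∀ z : ℂ, 0 < z.im → ‖U z‖ ≤ B) (x : ℝ) : ‖U x‖ ≤ B := by
  refine le_of_tendsto (hU.tendsto x).norm ?_
  filter_upwards [self_mem_nhdsWithin] with y hy
  exact hB _ (by simpa using hy)

theorem Q_ofReal_slit (hk0 : 0 < k) {i : Fin 2} {x : ℝ} (hx : x ∈ slit k i) :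
    Q k x = -(-1) ^ (i : ℕ) * Complex.I * absq k x := by
  fin_cases i
  · rw [Q_ofReal_left hk0 hx]; simp
  · rw [Q_ofReal_right hk0 hx]; simp

/-- The two quotients `U / q`, `V / q` as functions on the two sides of the axis: their difference
on the slits, where `q` is imaginary. -/
theorem div_Q_sub_conj (hk0 : 0 < k) {i : Fin 2} {x : ℝ} (hx : x ∈ slit k i) (u v : ℂ) :
    u / Q k x - conj (v / Q k x) = Complex.I * ((-1) ^ (i : ℕ) * ((u + conj v) / absq k x)) := by
  rw [map_div₀, Q_ofReal_slit hk0 hx]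
  have hc : conj (-(-1 : ℂ) ^ (i : ℕ) * Complex.I * absq k x) =
      (-1) ^ (i : ℕ) * Complex.I * absq k x := by simp
  rw [hc]
  rcases eq_or_ne (absq k x : ℂ) 0 with h0 | h0
  · rw [h0]; simp
  · have hI := Complex.I_ne_zero
    fin_cases i
    · simp only [pow_zero]
      field_simp
      linear_combination (-(u + conj v)) * Complex.I_sq
    · simp only [pow_one]
      field_simp
      linear_combination (u + conj v) * Complex.I_sq

theorem IsUpperExt.integrable_div_Q_sub (hk0 : 0 < k) (hk1 : k < 1) {U V : ℂ → ℂ} {P P' : ℂ}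
    (hU : IsUpperExt U P) (hV : IsUpperExt V P') :
    Integrable fun x : ℝ => U x / Q k x - conj (V x / Q k x) := by
  have key : ∀ {U : ℂ → ℂ} {P : ℂ}, IsUpperExt U P → Integrable fun x : ℝ => U x / Q k x := by
    intro U P hU
    obtain ⟨B, hB0, hB⟩ := hU.bounded
    refine ((integrable_inv_absq hk0 hk1).const_mul B).mono'
      (hU.isUpper_div_Q hk0 hk1).meas.aestronglyMeasurable (ae_of_all _ fun x => ?_)
    rw [norm_div, norm_Q_ofReal, div_eq_mul_inv]
    exact mul_le_mul_of_nonneg_right (hU.norm_ofReal_le hB x) (inv_nonneg.2 (absq_nonneg _ _))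
  exact (key hU).sub (Complex.conjCLE.toContinuousLinearMap.integrable_comp (key hV))

/-- The mean of the boundary values of `F` determines the jump across the slits: the same relation
for the regular part divided by `q`, which is imaginary and changes sign across the slits, so that
the quotient turns means into jumps. -/
theorem IsSlitAnalytic.hasPVSum_mean (hk0 : 0 < k) (hk1 : k < 1) (h : IsSlitAnalytic k 0 p F)
    (h1 : k < ξ) (h2 : ξ < 1) :
    HasPVSum k ξ (fun i x => (-1) ^ (i : ℕ) *
      ((bank 1 F x + bank (-1) F x - 2 * p / x).re / (absq k x * (x - ξ))))
      (Real.pi * ((bank 1 F ξ - bank (-1) F ξ).im / absq k ξ)) := by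
  obtain ⟨U, V, hU, hV, hgap, hbank⟩ := h.exists_pair hk0
  have hj0 : ∀ x : ℝ, (∀ j, x ∉ slit k j) → U x / Q k x - conj (V x / Q k x) = 0 := by
    intro x hx
    rw [hgap x hx, map_div₀, conj_Q_ofReal hk0 hk1 hx, sub_self]
  have hq0 : absq k ξ ≠ 0 := by
    have hξ : |ξ| = ξ := abs_of_pos (hk0.trans h1)
    exact (absq_pos_of_abs hk0 (by rwa [hξ]) (by rwa [hξ])).ne'
  have hQ0 : Q k ξ ≠ 0 := by rwa [← norm_ne_zero_iff, norm_Q_ofReal]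
  obtain ⟨g1, g2⟩ := (hU.isUpper_div_Q hk0 hk1).plemelj (hV.isUpper_div_Q hk0 hk1)
    (hU.integrable_div_Q_sub hk0 hk1 hV) (ξ := ξ)
    (hU.continuous_ofReal.continuousAt.div (continuous_Q_ofReal k).continuousAt hQ0)
    (hV.continuous_ofReal.continuousAt.div (continuous_Q_ofReal k).continuousAt hQ0)
  have h3 := (hasPVSum_of_tendsto hk0 (fun x hx => by rw [hj0 x hx, zero_div]) g1 g2).2
  obtain ⟨b1, b2⟩ := hbank 1 ξ (slit_one_of h1 h2)
  have hval : (Complex.I * Real.pi * (U ξ / Q k ξ + conj (V ξ / Q k ξ))).im =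
      Real.pi * ((bank 1 F ξ - bank (-1) F ξ).im / absq k ξ) := by
    have e := div_Q_sub_conj hk0 (slit_one_of h1 h2) (U ξ) (-V ξ)
    rw [neg_div, map_neg, sub_neg_eq_add] at e
    rw [e, b1, b2, ← Complex.div_ofReal_im, map_neg]
    have : Complex.I * (Real.pi : ℂ) * (Complex.I * ((-1) ^ ((1 : Fin 2) : ℕ) *
        ((U ξ + -conj (V ξ)) / (absq k ξ : ℂ)))) = (Real.pi : ℂ) *
        ((U ξ + p / ξ - (conj (V ξ) + p / ξ)) / (absq k ξ : ℂ)) := by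
      simp only [Fin.val_one, pow_one]
      linear_combination (-(Real.pi : ℂ) * ((U ξ - conj (V ξ)) / (absq k ξ : ℂ))) * Complex.I_sq
    rw [this, Complex.im_ofReal_mul]
  rw [hval] at h3
  refine h3.congr fun i => ?_
  filter_upwards [self_mem_ae_restrict measurableSet_Icc] with x hx
  obtain ⟨b1, b2⟩ := hbank i x hx
  rw [div_Q_sub_conj hk0 hx, b1, b2,
    show U x + p / x + (conj (V x) + p / x) - 2 * p / x = U x + conj (V x) by ring]
  have : Complex.I * ((-1) ^ (i : ℕ) * ((U x + conj (V x)) / (absq k x : ℂ))) / ((x : ℂ) - ξ) =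
      Complex.I * (((-1 : ℝ) ^ (i : ℕ) : ℝ) : ℂ) * (U x + conj (V x)) /
        ((absq k x * (x - ξ) : ℝ) : ℂ) := by
    push_cast
    rw [← div_div]
    ring
  rw [this, Complex.div_ofReal_im, mul_assoc, Complex.I_mul_im, Complex.re_ofReal_mul]
  ring

/-- Cauchy's theorem for the regular part divided by `q`, which is `O(|ζ|⁻²)` at infinity. -/
theorem IsSlitAnalytic.sum_integral_mean_eq_zero (hk0 : 0 < k) (hk1 : k < 1)
    (h : IsSlitAnalytic k 0 p F) :
    ∑ i : Fin 2, (-1 : ℝ) ^ (i : ℕ) * ∫ x in Set.Icc (lo k i) (hi k i),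
      (bank 1 F x + bank (-1) F x - 2 * p / x).re / absq k x = 0 := by
  obtain ⟨U, V, hU, hV, hgap, hbank⟩ := h.exists_pair hk0
  have hj0 : ∀ x : ℝ, (∀ j, x ∉ slit k j) → U x / Q k x - conj (V x / Q k x) = 0 := by
    intro x hx
    rw [hgap x hx, map_div₀, conj_Q_ofReal hk0 hk1 hx, sub_self]
  obtain ⟨B, hB0, hB⟩ := hU.bounded
  obtain ⟨B', hB0', hB'⟩ := hV.bounded
  have hmax : ∀ z : ℂ, 0 < z.im → 2 ≤ ‖z‖ →
      2 * B / ‖z‖ ^ 2 ≤ 2 * max B B' / ‖z‖ ^ 2 ∧ 2 * B' / ‖z‖ ^ 2 ≤ 2 * max B B' / ‖z‖ ^ 2 :=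
    fun z _ _ => ⟨by gcongr; exact le_max_left _ _, by gcongr; exact le_max_right _ _⟩
  have h0 := integral_jump_eq_zero (hU.isUpper_div_Q hk0 hk1) (hV.isUpper_div_Q hk0 hk1)
    ((integrable_inv_absq hk0 hk1).const_mul B) (IsUpperExt.norm_div_Q_le hB)
    ((integrable_inv_absq hk0 hk1).const_mul B') (IsUpperExt.norm_div_Q_le hB') two_pos
    (fun z hz hz2 => (IsUpperExt.norm_div_Q_le_at_infinity hk0 hk1 hB0 hB hz hz2).trans
      (hmax z hz hz2).1)
    (fun z hz hz2 => (IsUpperExt.norm_div_Q_le_at_infinity hk0 hk1 hB0' hB' hz hz2).trans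
      (hmax z hz hz2).2)
  have hint := hU.integrable_div_Q_sub hk0 hk1 hV
  rw [← setIntegral_univ, setIntegral_eq_sum_slits hk0 hj0 MeasurableSet.univ hint.integrableOn]
    at h0
  have h1 := congrArg Complex.im h0
  rw [Complex.im_sum, Complex.zero_im] at h1
  rw [← h1]
  refine Finset.sum_congr rfl fun i _ => ?_
  simp only [Set.mem_univ, and_true]
  rw [← integral_const_mul]
  refine Eq.trans ?_ (integral_im (𝕜 := ℂ) hint.integrableOn)
  refine setIntegral_congr_fun measurableSet_Icc fun x hx => ?_
  obtain ⟨b1, b2⟩ := hbank i x hx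
  simp only [RCLike.im_to_complex]
  rw [div_Q_sub_conj hk0 hx, b1, b2,
    show U x + p / x + (conj (V x) + p / x) - 2 * p / x = U x + conj (V x) by ring]
  have : Complex.I * ((-1) ^ (i : ℕ) * ((U x + conj (V x)) / (absq k x : ℂ))) =
      Complex.I * ((((-1 : ℝ) ^ (i : ℕ) : ℝ) : ℂ) * ((U x + conj (V x)) / (absq k x : ℂ))) := by
    push_cast; ring
  rw [this, Complex.I_mul_im, Complex.re_ofReal_mul, Complex.div_ofReal_re]

end

/-! ### Primitives on the closed upper half plane -/

theorem intervalIntegrable_inv_sqrt_one_sub :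
    IntervalIntegrable (fun t : ℝ => (√(1 - t))⁻¹) volume 0 1 := by
  rw [intervalIntegrable_iff_integrableOn_Ioc_of_le zero_le_one]
  have h := (integrable_inv_sqrt_abs_indicator.comp_sub_left 1).integrableOn (s := Set.Ioc 0 1)
  refine h.congr_fun (fun t ht => ?_) measurableSet_Ioc
  have h1 : |1 - t| < 4 := by rw [abs_lt]; constructor <;> linarith [ht.1, ht.2]
  simp only
  rw [Set.indicator_of_mem (by simpa using h1), abs_of_nonneg (by linarith [ht.2])]

theorem convex_upperHalf : Convex ℝ {z : ℂ | 0 < z.im} := convex_halfSpace_im_gt 0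

theorem isOpen_upperHalf : IsOpen {z : ℂ | 0 < z.im} :=
  isOpen_lt continuous_const Complex.continuous_im

/-- A derivative growing at most like `(Im z)^{-1/2}` at the real axis has a primitive that is
continuous on the closed half plane: the integral over the segment from the point `i`. -/
theorem exists_primitive_continuousOn {e : ℂ → ℂ} (he : DifferentiableOn ℂ e {z | 0 < z.im})
    (hb : ∀ R : ℝ, ∃ C : ℝ, 0 ≤ C ∧ ∀ z : ℂ, 0 < z.im → ‖z‖ ≤ R → ‖e z‖ ≤ C * (√z.im)⁻¹) :
    ∃ E : ℂ → ℂ, ContinuousOn E {z | 0 ≤ z.im} ∧ ∀ z : ℂ, 0 < z.im → HasDerivAt E (e z) z := by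
  obtain ⟨E₀, hE₀⟩ := convex_upperHalf.exists_forall_hasDerivWithinAt he
  have hE₀' : ∀ z : ℂ, 0 < z.im → HasDerivAt E₀ (e z) z := fun z hz =>
    (hE₀ z hz).hasDerivAt (isOpen_upperHalf.mem_nhds hz)
  set γ : ℂ → ℝ → ℂ := fun z t => Complex.I + t * (z - Complex.I) with hγ
  have him : ∀ z t, (γ z t).im = (1 - t) + t * z.im := by
    intro z t
    simp [hγ]
    ring
  have hγpos : ∀ z : ℂ, 0 ≤ z.im → ∀ t : ℝ, 0 ≤ t → t < 1 → 0 < (γ z t).im := by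
    intro z hz t h0 h1
    rw [him]
    nlinarith [mul_nonneg h0 hz]
  set E : ℂ → ℂ := fun z => ∫ t in (0 : ℝ)..1, (z - Complex.I) * e (γ z t) with hE
  have hEq : ∀ z : ℂ, 0 < z.im → E z = E₀ z - E₀ Complex.I := by
    intro z hz
    have hpos : ∀ t ∈ Set.uIcc (0 : ℝ) 1, 0 < (γ z t).im := by
      intro t ht
      rw [Set.uIcc_of_le zero_le_one] at ht
      rw [him]
      rcases eq_or_lt_of_le ht.1 with rfl | h
      · norm_num
      · nlinarith [mul_pos h hz, ht.2]
    have hγd : ∀ t : ℝ, HasDerivAt (γ z) (z - Complex.I) t := by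
      intro t
      have h1 : HasDerivAt (fun t : ℝ => (t : ℂ)) 1 t := Complex.ofRealCLM.hasDerivAt
      exact ((h1.mul_const (z - Complex.I)).const_add Complex.I).congr_deriv (one_mul _)
    have h1 : ∀ t ∈ Set.uIcc (0 : ℝ) 1,
        HasDerivAt (fun t => E₀ (γ z t)) ((z - Complex.I) * e (γ z t)) t := by
      intro t ht
      rw [mul_comm]
      exact (hE₀' _ (hpos t ht)).comp t (hγd t)
    have h2 : ContinuousOn (fun t => (z - Complex.I) * e (γ z t)) (Set.uIcc (0 : ℝ) 1) :=
      continuousOn_const.mul (he.continuousOn.comp (by fun_prop) hpos)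
    have h3 := intervalIntegral.integral_eq_sub_of_hasDerivAt h1 h2.intervalIntegrable
    rw [hE]
    simp only
    rw [h3]
    simp [hγ]
  refine ⟨E, ?_, fun z hz => ?_⟩
  · intro z₀ hz₀
    obtain ⟨C, hC0, hC⟩ := hb (‖z₀‖ + 2)
    refine intervalIntegral.continuousWithinAt_of_dominated_interval
      (bound := fun t => (‖z₀‖ + 2) * (C * (√(1 - t))⁻¹)) ?_ ?_
      ((intervalIntegrable_inv_sqrt_one_sub.const_mul C).const_mul _) ?_
    · filter_upwards [self_mem_nhdsWithin] with z hz
      rw [Set.uIoc_of_le zero_le_one, ← Measure.restrict_congr_set Ioo_ae_eq_Ioc]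
      refine ContinuousOn.aestronglyMeasurable ?_ measurableSet_Ioo
      exact continuousOn_const.mul (he.continuousOn.comp (by fun_prop)
        fun t ht => hγpos z hz t ht.1.le ht.2)
    · filter_upwards [self_mem_nhdsWithin,
        nhdsWithin_le_nhds (Metric.ball_mem_nhds z₀ one_pos)] with z hz hzb
      filter_upwards [Measure.ae_ne volume 1] with t ht1 ht
      rw [Set.uIoc_of_le zero_le_one] at ht
      have ht1' : t < 1 := lt_of_le_of_ne ht.2 ht1
      have hz1 : ‖z‖ ≤ ‖z₀‖ + 1 := by
        have := norm_sub_norm_le z z₀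
        rw [Metric.mem_ball, dist_eq_norm] at hzb
        linarith
      have hn1 : ‖z - Complex.I‖ ≤ ‖z₀‖ + 2 := by
        have := norm_sub_le z Complex.I
        rw [Complex.norm_I] at this
        linarith
      have hn2 : ‖γ z t‖ ≤ ‖z₀‖ + 2 := by
        have : γ z t = ((1 - t : ℝ) : ℂ) * Complex.I + (t : ℂ) * z := by
          simp only [hγ]; push_cast; ring
        rw [this]
        refine (norm_add_le _ _).trans ?_
        rw [norm_mul, norm_mul, Complex.norm_I, Complex.norm_real, Complex.norm_real,
          Real.norm_of_nonneg (by linarith), Real.norm_of_nonneg ht.1.le]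
        have : t * ‖z‖ ≤ 1 * ‖z‖ := by gcongr
        linarith [ht.1]
      rw [norm_mul]
      have h1 := hC _ (hγpos z hz t ht.1.le ht1') hn2
      have h2 : (√(γ z t).im)⁻¹ ≤ (√(1 - t))⁻¹ := by
        have : 0 < 1 - t := by linarith
        have h3 : 1 - t ≤ (γ z t).im := by
          rw [him]
          have := mul_nonneg ht.1.le (show 0 ≤ z.im from hz)
          linarith
        gcongr
      have h4 : ‖e (γ z t)‖ ≤ C * (√(1 - t))⁻¹ := h1.trans (by gcongr)
      gcongr
    · filter_upwards [Measure.ae_ne volume 1] with t ht1 ht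
      rw [Set.uIoc_of_le zero_le_one] at ht
      have ht1' : t < 1 := lt_of_le_of_ne ht.2 ht1
      have h1 : ContinuousAt e (γ z₀ t) := he.continuousOn.continuousAt
        (isOpen_upperHalf.mem_nhds (hγpos z₀ hz₀ t ht.1.le ht1'))
      have h2 : ContinuousAt (fun z => γ z t) z₀ := by simp only [hγ]; fun_prop
      exact ((continuousAt_id.sub continuousAt_const).mul
        (ContinuousAt.comp (f := fun z => γ z t) h1 h2)).continuousWithinAt
  · refine ((hE₀' z hz).sub_const (E₀ Complex.I)).congr_of_eventuallyEq ?_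
    filter_upwards [isOpen_upperHalf.mem_nhds hz] with w hw using hEq w hw

/-- If the complex derivative in the open upper half plane has a limit at a real point, it is the
derivative there within the closed half plane. -/
theorem hasFDerivWithinAt_of_tendsto_deriv {f f' : ℂ → ℂ} {x r : ℝ} (hr : 0 < r) {w : ℂ}
    (hc : ContinuousOn f ({z | 0 ≤ z.im} ∩ Metric.ball (x : ℂ) r))
    (hd : ∀ z : ℂ, 0 < z.im → z ∈ Metric.ball (x : ℂ) r → HasDerivAt f (f' z) z)
    (hlim : Tendsto f' (𝓝[{z | 0 < z.im}] (x : ℂ)) (𝓝 w)) :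
    HasFDerivWithinAt f (ContinuousLinearMap.mul ℝ ℂ w) {z | 0 ≤ z.im} (x : ℂ) := by
  set s : Set ℂ := {z : ℂ | 0 < z.im} ∩ Metric.ball (x : ℂ) (r / 2) with hs
  have hsub : ∀ z ∈ s, 0 < z.im ∧ z ∈ Metric.ball (x : ℂ) r := fun z hz =>
    ⟨hz.1, Metric.ball_subset_ball (by linarith) hz.2⟩
  have hfd : ∀ z ∈ s, HasFDerivAt f (ContinuousLinearMap.mul ℝ ℂ (f' z)) z := by
    intro z hz
    have h1 := (hd z (hsub z hz).1 (hsub z hz).2).hasFDerivAt.restrictScalars ℝ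
    refine h1.congr_fderiv ?_
    ext v
    simp [mul_comm]
  have hso : IsOpen s := isOpen_upperHalf.inter Metric.isOpen_ball
  have hcl : closure s ⊆ {z : ℂ | 0 ≤ z.im} ∩ Metric.ball (x : ℂ) r := by
    intro z hz
    have h1 := closure_inter_subset_inter_closure _ _ hz
    refine ⟨?_, ?_⟩
    · have := h1.1
      rwa [Complex.closure_setOfPred_lt_im] at this
    · have := Metric.closure_ball_subset_closedBall h1.2
      exact Metric.closedBall_subset_ball (by linarith) this
  have hmulc : Continuous fun w : ℂ => ContinuousLinearMap.mul ℝ ℂ w :=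
    (ContinuousLinearMap.mul ℝ ℂ).continuous
  have key := hasFDerivWithinAt_closure_of_tendsto_fderiv (s := s) (x := (x : ℂ))
    (f' := ContinuousLinearMap.mul ℝ ℂ w)
    (fun z hz => (hfd z hz).differentiableAt.differentiableWithinAt)
    (convex_upperHalf.inter (convex_ball _ _)) hso
    (fun y hy => (hc y (hcl hy)).mono (subset_closure.trans hcl)) (by
      refine ((hmulc.tendsto w).comp (hlim.mono_left (nhdsWithin_mono _
        Set.inter_subset_left))).congr' ?_
      filter_upwards [self_mem_nhdsWithin] with z hz
      exact (hfd z hz).fderiv.symm)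
  have hmem : {z : ℂ | 0 ≤ z.im} ∩ Metric.ball (x : ℂ) (r / 2) ⊆ closure s := by
    rw [← Complex.closure_setOfPred_lt_im]
    exact Metric.isOpen_ball.closure_inter
  refine (hasFDerivWithinAt_inter (Metric.ball_mem_nhds (x : ℂ) (half_pos hr))).1 (key.mono hmem)

theorem hasDerivAt_ofReal_of_hasFDerivWithinAt {f : ℂ → ℂ} {x : ℝ} {w : ℂ}
    (h : HasFDerivWithinAt f (ContinuousLinearMap.mul ℝ ℂ w) {z | 0 ≤ z.im} (x : ℂ)) :
    HasDerivAt (fun t : ℝ => f t) w x := by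
  have h1 : HasDerivWithinAt (fun t : ℝ => (t : ℂ)) 1 Set.univ x :=
    (Complex.ofRealCLM.hasDerivAt (x := x)).hasDerivWithinAt
  have h2 := h.comp_hasDerivWithinAt x h1 (fun t _ => by simp)
  exact (h2.hasDerivAt univ_mem).congr_deriv (by simp)

/-! ### Gluing across the real axis by conjugate symmetry -/

/-- The extension of a function on the closed upper half plane by `f (conj z) = conj (f z)`. -/
noncomputable def glue (f : ℂ → ℂ) (z : ℂ) : ℂ := open Classical in
  if 0 ≤ z.im then f z else conj (f (conj z))

theorem glue_of_nonneg {f : ℂ → ℂ} {z : ℂ} (hz : 0 ≤ z.im) : glue f z = f z := if_pos hz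

theorem glue_of_neg {f : ℂ → ℂ} {z : ℂ} (hz : z.im < 0) : glue f z = conj (f (conj z)) :=
  if_neg (not_le.2 hz)

theorem tendsto_glue {f : ℂ → ℂ} {l : Filter ℂ} {r : ℂ} (hl : Tendsto (fun z : ℂ => conj z) l l)
    (h : Tendsto f (l ⊓ 𝓟 {z | 0 ≤ z.im}) (𝓝 r)) (hr : conj r = r) :
    Tendsto (glue f) l (𝓝 r) := by
  have h1 : Tendsto (glue f) (l ⊓ 𝓟 {z | 0 ≤ z.im}) (𝓝 r) := by
    refine h.congr' ?_
    filter_upwards [mem_inf_of_right (mem_principal_self _)] with z hz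
    exact (glue_of_nonneg hz).symm
  have hc : Tendsto (fun z : ℂ => conj z) (l ⊓ 𝓟 {z | 0 ≤ z.im}ᶜ) (l ⊓ 𝓟 {z | 0 ≤ z.im}) := by
    refine tendsto_inf.2 ⟨hl.mono_left inf_le_left, tendsto_principal.2 ?_⟩
    filter_upwards [mem_inf_of_right (mem_principal_self _)] with z hz
    have hz' : z.im < 0 := not_le.1 hz
    simpa using hz'.le
  have h2 : Tendsto (glue f) (l ⊓ 𝓟 {z | 0 ≤ z.im}ᶜ) (𝓝 r) := by
    rw [← hr]
    refine (((Complex.continuous_conj.tendsto r).comp h).comp hc).congr' ?_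
    filter_upwards [mem_inf_of_right (mem_principal_self _)] with z hz
    exact (glue_of_neg (not_le.1 hz)).symm
  have := h1.sup h2
  rwa [← inf_sup_left, sup_principal, Set.union_compl_self, principal_univ, inf_top_eq] at this

/-- Schwarz reflection for the derivative at a point of the real axis. -/
theorem differentiableAt_glue {f : ℂ → ℂ} {x : ℝ} {w : ℂ}
    (h : HasFDerivWithinAt f (ContinuousLinearMap.mul ℝ ℂ w) {z | 0 ≤ z.im} (x : ℂ))
    (hw : conj w = w) (hreal : ∀ᶠ t : ℝ in 𝓝 x, conj (f t) = f t) :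
    DifferentiableAt ℂ (glue f) (x : ℂ) := by
  have hup : HasFDerivWithinAt (glue f) (ContinuousLinearMap.mul ℝ ℂ w) {z | 0 ≤ z.im} (x : ℂ) :=
    h.congr (fun z hz => glue_of_nonneg hz) (glue_of_nonneg (by simp))
  have hlow0 : HasFDerivWithinAt (fun z => conj (f (conj z))) (ContinuousLinearMap.mul ℝ ℂ w)
      {z | z.im ≤ 0} (x : ℂ) := by
    have hcj : HasFDerivWithinAt (fun z : ℂ => conj z)
        (Complex.conjCLE.toContinuousLinearMap : ℂ →L[ℝ] ℂ) {z | z.im ≤ 0} (x : ℂ) :=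
      Complex.conjCLE.toContinuousLinearMap.hasFDerivWithinAt
    have hx : conj (x : ℂ) = (x : ℂ) := Complex.conj_ofReal x
    have h' : HasFDerivWithinAt f (ContinuousLinearMap.mul ℝ ℂ w) {z | 0 ≤ z.im} (conj (x : ℂ)) := by
      rwa [hx]
    have h1 := h'.comp (x : ℂ) hcj (fun z (hz : z.im ≤ 0) => by simpa using hz)
    have h2 := (Complex.conjCLE.toContinuousLinearMap.hasFDerivAt
      (x := f (conj (x : ℂ)))).comp_hasFDerivWithinAt (x : ℂ) h1
    refine h2.congr_fderiv ?_
    ext v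
    simp [hw]
  have hlow : HasFDerivWithinAt (glue f) (ContinuousLinearMap.mul ℝ ℂ w) {z | z.im ≤ 0} (x : ℂ) := by
    have heq : ∀ t : ℝ, conj (f t) = f t → glue f t = conj (f (conj (t : ℂ))) := by
      intro t ht
      rw [glue_of_nonneg (by simp), Complex.conj_ofReal, ht]
    refine hlow0.congr_of_eventuallyEq ?_ (heq x hreal.self_of_nhds)
    have hre : ∀ᶠ z : ℂ in 𝓝 (x : ℂ), conj (f (z.re : ℂ)) = f (z.re : ℂ) := by
      have : Tendsto Complex.re (𝓝 (x : ℂ)) (𝓝 x) := by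
        simpa using Complex.continuous_re.tendsto (x : ℂ)
      exact this.eventually hreal
    filter_upwards [self_mem_nhdsWithin, nhdsWithin_le_nhds hre] with z (hz : z.im ≤ 0) hzr
    rcases eq_or_lt_of_le hz with h0 | h0
    · have hzz : ((z.re : ℝ) : ℂ) = z := Complex.ext rfl h0.symm
      rw [← hzz]
      exact heq _ hzr
    · exact glue_of_neg h0
  have hun := hup.union hlow
  have hset : {z : ℂ | 0 ≤ z.im} ∪ {z : ℂ | z.im ≤ 0} = Set.univ := by
    ext z; simp [le_total]
  rw [hset, hasFDerivWithinAt_univ] at hun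
  have hH : (ContinuousLinearMap.mul ℂ ℂ w).restrictScalars ℝ = ContinuousLinearMap.mul ℝ ℂ w := by
    ext v
    simp
  exact (hasFDerivAt_of_restrictScalars ℝ hun hH).differentiableAt

section

/-! ### Existence: an elliptic integral of the second kind

Throughout, `E` is a primitive of `(z² + s) / q` on the closed upper half plane. -/

variable {k s : ℝ} {E : ℂ → ℂ}

theorem exists_elliptic_primitive (hk0 : 0 < k) (hk1 : k < 1) (s : ℝ) :
    ∃ E : ℂ → ℂ, ContinuousOn E {z | 0 ≤ z.im} ∧
      ∀ z : ℂ, 0 < z.im → HasDerivAt E ((z ^ 2 + s) / Q k z) z := by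
  refine exists_primitive_continuousOn (e := fun z => (z ^ 2 + s) / Q k z)
    (((differentiableOn_id.pow 2).add_const _).div (differentiableOn_Q k)
      fun z hz => Q_ne_zero k hz) fun R => ?_
  set c : ℝ := (1 - k ^ 2) / 2 * k with hc
  have hc0 : 0 < c := mul_pos (by nlinarith) hk0
  refine ⟨(R ^ 2 + |s|) * (√c)⁻¹, by positivity, fun z hz hzR => ?_⟩
  have hlow : √c * √z.im ≤ ‖Q k z‖ := by
    rw [← Real.sqrt_mul hc0.le]
    exact Real.sqrt_le_iff.2 ⟨norm_nonneg _, im_le_norm_Q_sq hk0 hk1 hz.le⟩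
  have hnum : ‖z ^ 2 + s‖ ≤ R ^ 2 + |s| := by
    refine (norm_add_le _ _).trans ?_
    rw [norm_pow, Complex.norm_real, Real.norm_eq_abs]
    gcongr
  have := Real.sqrt_pos.2 hc0
  have := Real.sqrt_pos.2 hz
  rw [norm_div]
  calc ‖z ^ 2 + s‖ / ‖Q k z‖ ≤ (R ^ 2 + |s|) / (√c * √z.im) := by gcongr
    _ = _ := by field_simp

theorem intervalIntegrable_elliptic (hk0 : 0 < k) (hk1 : k < 1) (s a b : ℝ) :
    IntervalIntegrable (fun x : ℝ => ((x : ℂ) ^ 2 + s) / Q k x) volume a b := by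
  have h1 : IntervalIntegrable (fun x : ℝ => (Q k x)⁻¹) volume a b := by
    refine Integrable.intervalIntegrable ((integrable_inv_absq hk0 hk1).mono'
      (continuous_Q_ofReal k).measurable.inv.aestronglyMeasurable (ae_of_all _ fun x => ?_))
    rw [norm_inv, norm_Q_ofReal]
  simp_rw [div_eq_mul_inv]
  exact h1.continuousOn_mul (by fun_prop)

/-- The fundamental theorem of calculus along the real axis, up to the tips. -/
theorem elliptic_integral_eq_sub (hk0 : 0 < k) (hk1 : k < 1) (hc : ContinuousOn E {z | 0 ≤ z.im})
    (hd : ∀ z : ℂ, 0 < z.im → HasDerivAt E ((z ^ 2 + s) / Q k z) z) {a b : ℝ} (hab : a ≤ b)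
    (hne : ∀ x ∈ Set.Ioo a b, absq k x ≠ 0) :
    ∫ x in a..b, ((x : ℂ) ^ 2 + s) / Q k x = E b - E a := by
  refine intervalIntegral.integral_eq_sub_of_hasDerivAt_of_le (f := fun x : ℝ => E x) hab
    ((hc.comp_continuous Complex.continuous_ofReal fun x => by simp).continuousOn)
    (fun x hx => ?_) (intervalIntegrable_elliptic hk0 hk1 s a b)
  have hQ : Q k x ≠ 0 := by rw [← norm_ne_zero_iff, norm_Q_ofReal]; exact hne x hx
  refine hasDerivAt_ofReal_of_hasFDerivWithinAt (hasFDerivWithinAt_of_tendsto_deriv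
    (f' := fun z => (z ^ 2 + s) / Q k z) one_pos (hc.mono Set.inter_subset_left)
    (fun z hz _ => hd z hz) ?_)
  have h1 : ContinuousWithinAt (fun z : ℂ => (z ^ 2 + s) / Q k z) {z | 0 ≤ z.im} (x : ℂ) :=
    ((continuous_id.pow 2).add continuous_const).continuousWithinAt.div
      (continuousOn_Q k _ (by simp)) hQ
  exact h1.mono_left (nhdsWithin_mono _ fun z (hz : 0 < z.im) => hz.le)

/-- Along a gap between the slits `q` is real, and so is the increment of `E`. -/
theorem elliptic_im_eq_of_gap (hk0 : 0 < k) (hk1 : k < 1) (hc : ContinuousOn E {z | 0 ≤ z.im})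
    (hd : ∀ z : ℂ, 0 < z.im → HasDerivAt E ((z ^ 2 + s) / Q k z) z) {a b : ℝ} (hab : a ≤ b)
    (hne : ∀ x ∈ Set.Ioo a b, ∀ j, x ∉ slit k j) : (E b).im = (E a).im := by
  have htip : ∀ x : ℝ, absq k x = 0 → ∃ j, x ∈ slit k j := by
    intro x hx
    have h1 : ¬ (x ^ 2 ≠ 1 ∧ x ^ 2 ≠ k ^ 2) := fun h => (absq_pos h.1 h.2).ne' hx
    rw [mem_slits_iff]
    by_cases h2 : x ^ 2 = 1
    · rcases sq_eq_one_iff.1 h2 with rfl | rfl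
      · exact Or.inr ⟨hk1.le, le_rfl⟩
      · exact Or.inl ⟨le_rfl, by linarith⟩
    · have h3 : x ^ 2 = k ^ 2 := by by_contra h3; exact h1 ⟨h2, h3⟩
      rcases sq_eq_sq_iff_eq_or_eq_neg.1 h3 with rfl | rfl
      · exact Or.inr ⟨le_rfl, hk1.le⟩
      · exact Or.inl ⟨by linarith, le_rfl⟩
  have h := elliptic_integral_eq_sub hk0 hk1 hc hd hab fun x hx h0 => by
    obtain ⟨j, hj⟩ := htip x h0
    exact hne x hx j hj
  have hreal : ∫ x in a..b, ((x : ℂ) ^ 2 + s) / Q k x =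
      ((∫ x in a..b, (x ^ 2 + s) / (Q k x).re : ℝ) : ℂ) := by
    rw [← intervalIntegral.integral_ofReal]
    refine intervalIntegral.integral_congr_ae ?_
    filter_upwards [Measure.ae_ne volume b] with x hxb hx
    rw [Set.uIoc_of_le hab] at hx
    have hQ := conj_Q_ofReal hk0 hk1 (hne x ⟨hx.1, lt_of_le_of_ne hx.2 hxb⟩)
    rw [Complex.conj_eq_iff_re] at hQ
    push_cast
    rw [hQ]
  rw [hreal] at h
  have := congrArg Complex.im h
  rw [Complex.ofReal_im, Complex.sub_im] at this
  linarith

/-- Along a slit `q`, and so the increment of `E`, is imaginary. -/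
theorem elliptic_sub_of_slit (hk0 : 0 < k) (hk1 : k < 1) (hc : ContinuousOn E {z | 0 ≤ z.im})
    (hd : ∀ z : ℂ, 0 < z.im → HasDerivAt E ((z ^ 2 + s) / Q k z) z) (j : Fin 2) {a b : ℝ}
    (hab : a ≤ b) (ha : a ∈ slit k j) (hb : b ∈ slit k j) :
    E b - E a = Complex.I * (((-1) ^ (j : ℕ) * ∫ x in a..b, (x ^ 2 + s) / absq k x : ℝ) : ℂ) := by
  have hsl : ∀ x ∈ Set.Icc a b, x ∈ slit k j := fun x hx =>
    ⟨ha.1.trans hx.1, hx.2.trans hb.2⟩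
  rw [← elliptic_integral_eq_sub hk0 hk1 hc hd hab fun x hx => ?_]
  · rw [← intervalIntegral.integral_const_mul, ← intervalIntegral.integral_ofReal,
      ← intervalIntegral.integral_const_mul]
    refine intervalIntegral.integral_congr fun x hx => ?_
    rw [Set.uIcc_of_le hab] at hx
    rw [Q_ofReal_slit hk0 (hsl x hx)]
    rcases eq_or_ne (absq k x) 0 with h0 | h0
    · rw [h0]; simp
    · have h0' : (absq k x : ℂ) ≠ 0 := by exact_mod_cast h0
      have hI := Complex.I_ne_zero
      fin_cases j
      · simp only [pow_zero]
        push_cast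
        field_simp
        linear_combination (-((x : ℂ) ^ 2 + s)) * Complex.I_sq
      · simp only [pow_one]
        push_cast
        field_simp
        linear_combination ((x : ℂ) ^ 2 + s) * Complex.I_sq
  · have hx' := hsl x ⟨hx.1.le, hx.2.le⟩
    have h1 : k < |x| ∧ |x| < 1 := by
      fin_cases j
      · have h1 : -1 ≤ a := ha.1
        have h2 : b ≤ -k := hb.2
        rw [abs_of_neg (by linarith [hx.2])]
        constructor <;> linarith [hx.1, hx.2]
      · have h1 : k ≤ a := ha.1
        have h2 : b ≤ 1 := hb.2
        rw [abs_of_pos (by linarith [hx.1])]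
        constructor <;> linarith [hx.1, hx.2]
    exact (absq_pos_of_abs hk0 h1.1 h1.2).ne'

theorem intervalIntegrable_inv_absq (hk0 : 0 < k) (hk1 : k < 1) (a b : ℝ) :
    IntervalIntegrable (fun x => 1 / absq k x) volume a b := by
  simp_rw [one_div]
  exact (integrable_inv_absq hk0 hk1).intervalIntegrable

theorem ellI_pos (hk0 : 0 < k) (hk1 : k < 1) : 0 < ellI k := by
  refine intervalIntegral.intervalIntegral_pos_of_pos_on
    (intervalIntegrable_inv_absq hk0 hk1 k 1) (fun x hx => ?_) hk1
  have hx0 : |x| = x := abs_of_pos (hk0.trans hx.1)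
  exact one_div_pos.2 (absq_pos_of_abs hk0 (by rw [hx0]; exact hx.1) (by rw [hx0]; exact hx.2))

/-- The constant for which the elliptic integral has no period across the slit. -/
theorem exists_zero_period (hk0 : 0 < k) (hk1 : k < 1) :
    ∃ s : ℝ, ∫ x in k..1, (x ^ 2 + s) / absq k x = 0 := by
  have h1 := intervalIntegrable_inv_absq hk0 hk1 k 1
  have h2 : IntervalIntegrable (fun x => x ^ 2 * (1 / absq k x)) volume k 1 :=
    h1.continuousOn_mul (by fun_prop)
  refine ⟨-(∫ x in k..1, x ^ 2 * (1 / absq k x)) / ellI k, ?_⟩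
  set s := -(∫ x in k..1, x ^ 2 * (1 / absq k x)) / ellI k with hs
  have h3 : ∀ x : ℝ, (x ^ 2 + s) / absq k x = x ^ 2 * (1 / absq k x) + s * (1 / absq k x) :=
    fun x => by ring
  simp_rw [h3]
  rw [intervalIntegral.integral_add h2 (h1.const_mul s), intervalIntegral.integral_const_mul,
    show (∫ x in k..1, 1 / absq k x) = ellI k from rfl, hs, div_mul_cancel₀ _ (ellI_pos hk0 hk1).ne']
  ring

/-- An antiderivative of a function of order `O(|z|⁻²)` on the half plane has a limit at infinity:
after the inversion `u = -1/z` the derivative is bounded. -/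
theorem exists_tendsto_infinity {f f' : ℂ → ℂ} (hc : ContinuousOn f ({z | 0 ≤ z.im} \ {0}))
    (hd : ∀ z : ℂ, 0 < z.im → HasDerivAt f (f' z) z) {C : ℝ} (hC0 : 0 ≤ C)
    (hC : ∀ z : ℂ, 0 < z.im → 2 ≤ ‖z‖ → ‖f' z‖ ≤ C / ‖z‖ ^ 2) :
    ∃ L, Tendsto f (cocompact ℂ ⊓ 𝓟 {z | 0 ≤ z.im}) (𝓝 L) := by
  set D : Set ℂ := {u : ℂ | 0 < u.im} ∩ Metric.ball 0 (1 / 2) with hD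
  have hinv : ∀ z : ℂ, 0 < z.im → 0 < (-z⁻¹).im := by
    intro z hz
    have hz0 : z ≠ 0 := by rintro rfl; simp at hz
    rw [Complex.neg_im, Complex.inv_im, neg_div, neg_neg]
    exact div_pos hz (Complex.normSq_pos.2 hz0)
  have hWd : ∀ u ∈ D, HasDerivWithinAt (fun u => f (-u⁻¹)) (f' (-u⁻¹) * (u ^ 2)⁻¹) D u := by
    intro u hu
    have hu0 : u ≠ 0 := by rintro rfl; simp [hD] at hu
    have h1 : HasDerivAt (fun u : ℂ => -u⁻¹) ((u ^ 2)⁻¹) u := by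
      have := (hasDerivAt_inv hu0).neg
      rwa [neg_neg] at this
    exact ((hd _ (hinv u hu.1)).comp u h1).hasDerivWithinAt
  have hWb : ∀ u ∈ D, ‖f' (-u⁻¹) * (u ^ 2)⁻¹‖ ≤ C := by
    intro u hu
    have hu0 : u ≠ 0 := by rintro rfl; simp [hD] at hu
    have hun : 0 < ‖u‖ := norm_pos_iff.2 hu0
    have h2 : ‖u‖ < 1 / 2 := mem_ball_zero_iff.1 hu.2
    have h3 := hC _ (hinv u hu.1) (by
      rw [norm_neg, norm_inv, le_inv_comm₀ two_pos hun]
      linarith)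
    rw [norm_neg, norm_inv] at h3
    rw [norm_mul, norm_inv, norm_pow]
    calc ‖f' (-u⁻¹)‖ * (‖u‖ ^ 2)⁻¹ ≤ C / ‖u‖⁻¹ ^ 2 * (‖u‖ ^ 2)⁻¹ := by gcongr
      _ = C := by field_simp
  have hlip := Convex.lipschitzOnWith_of_nnnorm_hasDerivWithin_le (C := ⟨C, hC0⟩)
    (convex_upperHalf.inter (convex_ball (0 : ℂ) (1 / 2))) hWd fun u hu => hWb u hu
  have hcl0 : (0 : ℂ) ∈ closure D := by
    have h1 : (0 : ℂ) ∈ closure {u : ℂ | 0 < u.im} := by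
      have := ofReal_mem_closure 0
      rwa [Complex.ofReal_zero] at this
    refine mem_closure_iff_nhds.2 fun V hV => ?_
    obtain ⟨u, hu1, hu2⟩ := mem_closure_iff_nhds.1 h1 _
      (inter_mem hV (Metric.ball_mem_nhds (0 : ℂ) (by norm_num : (0 : ℝ) < 1 / 2)))
    exact ⟨u, hu1.1, hu2, hu1.2⟩
  have hne : (𝓝[D] (0 : ℂ)).NeBot := mem_closure_iff_nhdsWithin_neBot.1 hcl0
  have hcau : Cauchy (map (fun u => f (-u⁻¹)) (𝓝[D] (0 : ℂ))) :=
    (cauchy_nhds.mono nhdsWithin_le_nhds).map_of_le hlip.uniformContinuousOn inf_le_right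
  obtain ⟨L, hL⟩ := CompleteSpace.complete hcau
  have hopen : Tendsto f (cocompact ℂ ⊓ 𝓟 {z | 0 < z.im}) (𝓝 L) := by
    have hto : Tendsto (fun z : ℂ => -z⁻¹) (cocompact ℂ ⊓ 𝓟 {z | 0 < z.im}) (𝓝[D] 0) := by
      have h0 : Tendsto (fun z : ℂ => -z⁻¹) (cocompact ℂ ⊓ 𝓟 {z | 0 < z.im}) (𝓝 0) := by
        have := (tendsto_inv₀_cobounded (α := ℂ)).neg
        rw [neg_zero, Metric.cobounded_eq_cocompact] at this
        exact this.mono_left inf_le_left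
      refine tendsto_nhdsWithin_iff.2 ⟨h0, ?_⟩
      filter_upwards [h0 (Metric.ball_mem_nhds (0 : ℂ) (by norm_num : (0 : ℝ) < 1 / 2)),
        mem_inf_of_right (mem_principal_self _)] with z h1 h2
      exact ⟨hinv z h2, h1⟩
    have h1 : Tendsto (fun u => f (-u⁻¹)) (𝓝[D] (0 : ℂ)) (𝓝 L) := hL
    refine (h1.comp hto).congr fun z => ?_
    simp [inv_neg]
  refine ⟨L, ?_⟩
  rw [Metric.nhds_basis_closedBall.tendsto_right_iff] at hopen ⊢
  intro ε hε
  have h1 := hopen ε hε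
  rw [← Metric.cobounded_eq_cocompact, eventually_inf_principal,
    (hasBasis_cobounded_norm (E := ℂ)).eventually_iff] at h1 ⊢
  obtain ⟨R, -, hR⟩ := h1
  refine ⟨max R 1, trivial, fun z hzR hz => ?_⟩
  have hzR' : max R 1 ≤ ‖z‖ := hzR
  have hz1 : R ≤ ‖z‖ := (le_max_left _ _).trans hzR'
  have hz0 : z ≠ 0 := norm_pos_iff.1 (lt_of_lt_of_le one_pos ((le_max_right _ _).trans hzR'))
  rcases eq_or_lt_of_le (show 0 ≤ z.im from hz) with h0 | h0
  · have hzz : ((z.re : ℝ) : ℂ) = z := Complex.ext rfl h0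
    have hcz := (hc z ⟨hz, hz0⟩).mono_left (nhdsWithin_mono (t := {z | 0 ≤ z.im} \ {0})
      (s := {z : ℂ | 0 < z.im}) z fun w (hw : 0 < w.im) =>
        ⟨hw.le, fun h => by rw [Set.mem_singleton_iff.1 h] at hw; simp at hw⟩)
    rw [← hzz] at hcz
    have hlim := hcz.comp (tendsto_add_mul_I z.re)
    rw [hzz] at hlim
    refine Metric.isClosed_closedBall.mem_of_tendsto hlim ?_
    filter_upwards [self_mem_nhdsWithin] with y (hy : 0 < y)
    refine hR ?_ (by simpa [← h0] using hy)
    refine hz1.trans ?_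
    have h2 := Complex.abs_re_le_norm (z + y * Complex.I)
    have h3 : ‖z‖ = |z.re| := by rw [← hzz, Complex.norm_real, Complex.ofReal_re, Real.norm_eq_abs]
    rw [h3]
    simpa using h2
  · exact hR hz1 h0

/-- The elliptic integral without periods, normalised to be real at the real points off the slits
and at the tips. -/
theorem exists_elliptic_real (hk0 : 0 < k) (hk1 : k < 1) :
    ∃ (s : ℝ) (E : ℂ → ℂ), ContinuousOn E {z | 0 ≤ z.im} ∧
      (∀ z : ℂ, 0 < z.im → HasDerivAt E ((z ^ 2 + s) / Q k z) z) ∧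
      (∀ x : ℝ, ((∀ j, x ∉ slit k j) ∨ x ∈ ({-1, -k, k, 1} : Set ℝ)) → (E x).im = 0) ∧
      ∀ j, ∃ β, ∀ x ∈ slit k j, (E x).re = β := by
  obtain ⟨s, hs⟩ := exists_zero_period hk0 hk1
  obtain ⟨E, hc, hd⟩ := exists_elliptic_primitive hk0 hk1 s
  have hs' : ∫ x in (-1)..(-k), (x ^ 2 + s) / absq k x = 0 := by
    rw [← hs, ← intervalIntegral.integral_comp_neg]
    simp [absq_neg]
  have hmid : ∀ x : ℝ, -k ≤ x → x ≤ k → (E x).im = (E (-k : ℝ)).im := fun x h1 h2 =>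
    elliptic_im_eq_of_gap hk0 hk1 hc hd h1 fun y hy j hj => by
      have h3 := (abs_le_one_of_mem_slit hk0 hj).1
      have h4 : |y| < k := abs_lt.2 ⟨hy.1, hy.2.trans_le h2⟩
      linarith
  have h1 : (E (1 : ℝ)).im = (E (-k : ℝ)).im := by
    rw [← hmid k (by linarith) le_rfl]
    have h := elliptic_sub_of_slit hk0 hk1 hc hd 1 hk1.le (show k ∈ slit k 1 from ⟨le_rfl, hk1.le⟩)
      (show 1 ∈ slit k 1 from ⟨hk1.le, le_rfl⟩)
    rw [hs, mul_zero, Complex.ofReal_zero, mul_zero, sub_eq_zero] at h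
    rw [h]
  have hm1 : (E (-1 : ℝ)).im = (E (-k : ℝ)).im := by
    have h := elliptic_sub_of_slit hk0 hk1 hc hd 0 (neg_le_neg hk1.le)
      (show -1 ∈ slit k 0 from ⟨le_rfl, by simpa [hi] using hk1.le⟩)
      (show -k ∈ slit k 0 from ⟨by simpa [lo] using hk1.le, le_rfl⟩)
    rw [hs', mul_zero, Complex.ofReal_zero, mul_zero, sub_eq_zero] at h
    rw [h]
  have hreal : ∀ x : ℝ, ((∀ j, x ∉ slit k j) ∨ x ∈ ({-1, -k, k, 1} : Set ℝ)) →
      (E x).im = (E (-k : ℝ)).im := by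
    rintro x (hx | hx)
    · have h0 : ¬ (-1 ≤ x ∧ x ≤ -k) := hx 0
      have h2 : ¬ (k ≤ x ∧ x ≤ 1) := hx 1
      rcases lt_or_ge x (-1) with h3 | h3
      · rw [← hm1]
        exact (elliptic_im_eq_of_gap hk0 hk1 hc hd h3.le fun y hy j hj => by
          have h4 := (abs_le.1 (abs_le_one_of_mem_slit hk0 hj).2).1
          linarith [hy.2]).symm
      · rcases lt_or_ge 1 x with h4 | h4
        · rw [← h1]
          exact elliptic_im_eq_of_gap hk0 hk1 hc hd h4.le fun y hy j hj => by
            have h4 := (abs_le.1 (abs_le_one_of_mem_slit hk0 hj).2).2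
            linarith [hy.1]
        · refine hmid x ?_ ?_
          · by_contra h; exact h0 ⟨h3, by linarith⟩
          · by_contra h; exact h2 ⟨by linarith, h4⟩
    · rcases hx with rfl | rfl | rfl | rfl
      · exact hm1
      · rfl
      · exact hmid _ (by linarith) le_rfl
      · exact h1
  refine ⟨s, fun z => E z - Complex.I * (E (-k : ℝ)).im, hc.sub continuousOn_const,
    fun z hz => (hd z hz).sub_const _, fun x hx => ?_, fun j => ⟨(E (lo k j)).re, fun x hx => ?_⟩⟩
  · simp [hreal x hx]
  · have h := congrArg Complex.re (elliptic_sub_of_slit hk0 hk1 hc hd j hx.1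
      (⟨le_rfl, hx.1.trans hx.2⟩ : lo k j ∈ slit k j) hx)
    rw [Complex.re_mul_ofReal, Complex.I_re, zero_mul, Complex.sub_re] at h
    simp
    linarith

/-- The function `z ↦ (E z - q z / z) / k`. Its residue at the origin is `1`, because `q 0 = -k`,
and the terms growing linearly at infinity cancel. -/
noncomputable def schwarzAux (k : ℝ) (E : ℂ → ℂ) (z : ℂ) : ℂ := (E z - Q k z / z) / k

theorem hasDerivAt_schwarzAux (hk0 : 0 < k)
    (hd : ∀ z : ℂ, 0 < z.im → HasDerivAt E ((z ^ 2 + s) / Q k z) z) {z : ℂ} (hz : 0 < z.im) :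
    HasDerivAt (schwarzAux k E) ((s + k ^ 2 / z ^ 2) / (k * Q k z)) z := by
  have hz0 : z ≠ 0 := by rintro rfl; simp at hz
  have hQ := Q_ne_zero k hz
  have hk : (k : ℂ) ≠ 0 := by exact_mod_cast hk0.ne'
  -- the derivative of `q` from `2 q q' = (q²)'`
  have h1 : HasDerivAt (Q k) (deriv (Q k) z) z :=
    ((differentiableOn_Q k).differentiableAt (isOpen_upperHalf.mem_nhds hz)).hasDerivAt
  have h2 : 2 * Q k z * deriv (Q k) z = 4 * z ^ 3 - 2 * (1 + k ^ 2) * z := by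
    have h3 := h1.pow 2
    have h4 : HasDerivAt (fun z : ℂ => (z ^ 2 - 1) * (z ^ 2 - (k : ℂ) ^ 2))
        (2 * z * (z ^ 2 - k ^ 2) + (z ^ 2 - 1) * (2 * z)) z := by
      have h5 : ∀ w : ℂ, HasDerivAt (fun z : ℂ => z ^ 2 - w) (2 * z) z := fun w => by
        simpa using (hasDerivAt_pow 2 z).sub_const w
      exact (h5 1).mul (h5 _)
    rw [← funext (Q_sq k)] at h4
    have h6 := h3.unique h4
    simp only [Nat.cast_ofNat, Nat.add_one_sub_one, pow_one] at h6
    rw [h6]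
    ring
  refine (((hd z hz).sub (h1.div (hasDerivAt_id z) hz0)).div_const (k : ℂ)).congr_deriv ?_
  have h7 := Q_sq k z
  simp only [id]
  field_simp
  linear_combination (-z / 2) * h2 + h7

theorem continuousOn_schwarzAux (hc : ContinuousOn E {z | 0 ≤ z.im}) :
    ContinuousOn (schwarzAux k E) ({z | 0 ≤ z.im} \ {0}) :=
  ((hc.mono Set.sdiff_subset).sub (((continuousOn_Q k).mono Set.sdiff_subset).div continuousOn_id
    fun _ hz => hz.2)).div_const _

theorem conj_schwarzAux (hk0 : 0 < k) (hk1 : k < 1) {x : ℝ}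
    (hx : (∀ j, x ∉ slit k j) ∨ x ∈ ({-1, -k, k, 1} : Set ℝ)) (hE : (E x).im = 0) :
    conj (schwarzAux k E x) = schwarzAux k E x := by
  have hQ : conj (Q k x) = Q k x := by
    rcases hx with hx | hx
    · exact conj_Q_ofReal hk0 hk1 hx
    · have h0 : Q k x = 0 := by
        rw [← norm_eq_zero, norm_Q_ofReal]
        unfold absq
        rcases hx with rfl | rfl | rfl | rfl <;> simp
      rw [h0, map_zero]
  unfold schwarzAux
  rw [map_div₀, map_sub, map_div₀, hQ, Complex.conj_eq_iff_im.2 hE, Complex.conj_ofReal,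
    Complex.conj_ofReal]

theorem schwarzAux_re_of_slit (hk0 : 0 < k) {j : Fin 2} {x : ℝ} (hx : x ∈ slit k j) :
    (schwarzAux k E x).re = (E x).re / k := by
  unfold schwarzAux
  rw [Q_ofReal_slit hk0 hx, Complex.div_ofReal_re, Complex.sub_re, Complex.div_ofReal_re]
  have : (-(-1 : ℂ) ^ (j : ℕ) * Complex.I * absq k x).re = 0 := by
    fin_cases j <;> simp
  rw [this, zero_div, sub_zero]

theorem tendsto_schwarzAux_sub_inv (hk0 : 0 < k) (hc : ContinuousOn E {z | 0 ≤ z.im}) :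
    Tendsto (fun z => schwarzAux k E z - z⁻¹) (𝓝[≠] 0 ⊓ 𝓟 {z | 0 ≤ z.im}) (𝓝 (E 0 / k)) := by
  have hk : (k : ℂ) ≠ 0 := by exact_mod_cast hk0.ne'
  have hle : (𝓝[≠] (0 : ℂ) ⊓ 𝓟 {z | 0 ≤ z.im}) ≤ 𝓝[{z | 0 ≤ z.im}] 0 :=
    inf_le_inf_right _ nhdsWithin_le_nhds
  have hQ : Tendsto (Q k) (𝓝[≠] (0 : ℂ) ⊓ 𝓟 {z | 0 ≤ z.im}) (𝓝 (-k)) := by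
    have := (continuousOn_Q k 0 (by simp)).tendsto
    rw [Q_zero hk0] at this
    exact this.mono_left hle
  have hz : Tendsto (fun z : ℂ => z) (𝓝[≠] (0 : ℂ) ⊓ 𝓟 {z | 0 ≤ z.im}) (𝓝 0) :=
    tendsto_id'.2 (inf_le_left.trans nhdsWithin_le_nhds)
  have hE : Tendsto E (𝓝[≠] (0 : ℂ) ⊓ 𝓟 {z | 0 ≤ z.im}) (𝓝 (E 0)) :=
    (hc 0 (by simp)).tendsto.mono_left hle
  have h2 : (-k - k : ℂ) ≠ 0 := by
    rw [show (-k - k : ℂ) = -2 * k by ring]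
    exact mul_ne_zero (by norm_num) hk
  have h3 : Tendsto (fun z => (E z - z * (z ^ 2 - 1 - k ^ 2) / (Q k z - k)) / k)
      (𝓝[≠] (0 : ℂ) ⊓ 𝓟 {z | 0 ≤ z.im})
      (𝓝 ((E 0 - 0 * (0 ^ 2 - 1 - k ^ 2) / (-k - k)) / k)) :=
    (hE.sub ((hz.mul (((hz.pow 2).sub_const 1).sub_const _)).div (hQ.sub_const _) h2)).div_const _
  rw [zero_mul, zero_div, sub_zero] at h3
  refine h3.congr' ?_
  filter_upwards [(hQ.sub_const (k : ℂ)).eventually_ne h2,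
    mem_inf_of_left self_mem_nhdsWithin] with z h4 (h5 : z ≠ 0)
  have h6 := Q_sq k z
  unfold schwarzAux
  field_simp
  linear_combination h6

/-- A function of the class with residue `1` whose real part on each slit is constant: the
function `schwarzAux`, continued by reflection across the gaps. -/
theorem exists_schwarz_kernel (hk0 : 0 < k) (hk1 : k < 1) :
    ∃ G : ℂ → ℂ, IsSlitAnalytic k 0 1 G ∧ ∃ β : Fin 2 → ℝ, ∀ σ : ℝ, (σ = 1 ∨ σ = -1) →
      ∀ j, ∀ ξ ∈ slit k j, (bank σ G ξ).re = β j := by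
  obtain ⟨s, E, hc, hd, hreal, hβ⟩ := exists_elliptic_real hk0 hk1
  choose β hβ using hβ
  have hk : (k : ℂ) ≠ 0 := by exact_mod_cast hk0.ne'
  set f := schwarzAux k E with hf
  have hcf : ContinuousOn f ({z | 0 ≤ z.im} \ {0}) := continuousOn_schwarzAux hc
  have hdf : ∀ z : ℂ, 0 < z.im → HasDerivAt f ((s + k ^ 2 / z ^ 2) / (k * Q k z)) z :=
    fun z hz => hasDerivAt_schwarzAux hk0 hd hz
  have hfr : ∀ x : ℝ, ((∀ j, x ∉ slit k j) ∨ x ∈ ({-1, -k, k, 1} : Set ℝ)) →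
      conj (f x) = f x := fun x hx => conj_schwarzAux hk0 hk1 hx (hreal x hx)
  have hlim : ∀ x : ℝ, x ≠ 0 → Tendsto f (𝓝[{z : ℂ | 0 ≤ z.im}] (x : ℂ)) (𝓝 (f x)) := by
    intro x hx
    have hx' : (x : ℂ) ≠ 0 := by exact_mod_cast hx
    refine (hcf x ⟨by simp, hx'⟩).tendsto.mono_left ?_
    refine le_inf nhdsWithin_le_nhds (le_principal_iff.2 ?_)
    filter_upwards [self_mem_nhdsWithin, mem_nhdsWithin_of_mem_nhds (isOpen_ne.mem_nhds hx')]
      with z h1 h2 using ⟨h1, h2⟩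
  have hup : ∀ ξ : ℝ, ξ ≠ 0 → Tendsto (glue f) (bankFilter 1 ξ) (𝓝 (f ξ)) := by
    intro ξ hξ
    rw [bankFilter_one]
    refine ((hlim ξ hξ).mono_left (nhdsWithin_mono _ fun z (hz : 0 < z.im) => hz.le)).congr' ?_
    filter_upwards [self_mem_nhdsWithin] with z (hz : 0 < z.im)
    exact (glue_of_nonneg hz.le).symm
  have hdown : ∀ ξ : ℝ, ξ ≠ 0 → Tendsto (glue f) (bankFilter (-1) ξ) (𝓝 (conj (f ξ))) := by
    intro ξ hξ
    have h1 := (Complex.continuous_conj.tendsto _).comp ((hup ξ hξ).comp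
      (by simpa using tendsto_conj_bankFilter (-1) ξ))
    refine h1.congr' ?_
    rw [bankFilter_neg_one]
    filter_upwards [self_mem_nhdsWithin] with z (hz : z.im < 0)
    simp only [Function.comp_apply]
    rw [glue_of_neg hz, glue_of_nonneg (by simpa using hz.le)]
  have hpt : ∀ x : ℝ, x ≠ 0 → ((∀ j, x ∉ slit k j) ∨ x ∈ ({-1, -k, k, 1} : Set ℝ)) →
      Tendsto (glue f) (𝓝 (x : ℂ)) (𝓝 (f x)) := by
    intro x hx0 hx
    refine tendsto_glue ?_ (hlim x hx0) (hfr x hx)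
    have := Complex.continuous_conj.tendsto (x : ℂ)
    rwa [Complex.conj_ofReal] at this
  refine ⟨glue f, ⟨?_, ?_, ?_, ?_, ?_⟩, fun j => β j / k, ?_⟩
  · rintro z ⟨hz, hz0⟩
    rw [Complex.ofReal_zero, Set.mem_singleton_iff] at hz0
    refine DifferentiableAt.differentiableWithinAt ?_
    rcases lt_trichotomy z.im 0 with h | h | h
    · have hcz : 0 < (conj z).im := by simpa using h
      have h1 : DifferentiableAt ℂ (fun z => conj (f (conj z))) z := by
        have := (hdf _ hcz).differentiableAt.conj_conj
        rwa [Complex.conj_conj] at this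
      refine h1.congr_of_eventuallyEq ?_
      filter_upwards [(isOpen_lt Complex.continuous_im continuous_const).mem_nhds h] with w hw
      exact glue_of_neg hw
    · have hzz : ((z.re : ℝ) : ℂ) = z := Complex.ext rfl h.symm
      rw [← hzz] at hz hz0 ⊢
      have hgap := ofReal_mem_slitDomain_iff.1 hz
      set x := z.re
      have hQ0 : Q k x ≠ 0 := by
        intro h0
        have h1 := Q_sq k x
        rw [h0] at h1
        have h2 : ((x ^ 2 - 1) * (x ^ 2 - k ^ 2) : ℝ) = 0 := by
          exact_mod_cast (by rw [← h1]; ring : ((x : ℂ) ^ 2 - 1) * ((x : ℂ) ^ 2 - k ^ 2) = 0)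
        rcases mul_eq_zero.1 h2 with h3 | h3
        · rcases sq_eq_one_iff.1 (sub_eq_zero.1 h3) with h4 | h4
          · exact hgap 1 (by rw [h4]; exact ⟨hk1.le, le_rfl⟩)
          · exact hgap 0 (by rw [h4]; exact ⟨le_rfl, (by linarith : (-1 : ℝ) ≤ -k)⟩)
        · rcases sq_eq_sq_iff_eq_or_eq_neg.1 (sub_eq_zero.1 h3) with h4 | h4
          · exact hgap 1 (by rw [h4]; exact ⟨le_rfl, hk1.le⟩)
          · exact hgap 0 (by rw [h4]; exact ⟨(by linarith : (-1 : ℝ) ≤ -k), le_rfl⟩)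
      have hx0 : x ≠ 0 := by exact_mod_cast hz0
      have hderiv : Tendsto (fun z : ℂ => (s + k ^ 2 / z ^ 2) / (k * Q k z))
          (𝓝[{z : ℂ | 0 < z.im}] (x : ℂ)) (𝓝 ((s + k ^ 2 / x ^ 2) / (k * Q k x))) := by
        have h1 : ContinuousWithinAt (fun z : ℂ => (s + (k : ℂ) ^ 2 / z ^ 2) / (k * Q k z))
            {z | 0 ≤ z.im} (x : ℂ) :=
          (continuousWithinAt_const.add (continuousWithinAt_const.div
            (continuousWithinAt_id.pow 2) (pow_ne_zero 2 hz0))).div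
            (continuousWithinAt_const.mul (continuousOn_Q k _ (by simp))) (mul_ne_zero hk hQ0)
        exact h1.mono_left (nhdsWithin_mono _ fun z (hz : 0 < z.im) => hz.le)
      refine differentiableAt_glue (hasFDerivWithinAt_of_tendsto_deriv (r := |x|)
        (abs_pos.2 hx0) (hcf.mono ?_) (fun z hz _ => hdf z hz) hderiv) ?_ ?_
      · rintro w ⟨hw, hw'⟩
        refine ⟨hw, fun h0 => ?_⟩
        rw [Set.mem_singleton_iff.1 h0, mem_ball_iff_norm, zero_sub, norm_neg, Complex.norm_real,
          Real.norm_eq_abs] at hw'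
        exact lt_irrefl _ hw'
      · simp only [map_div₀, map_add, map_mul, map_pow, Complex.conj_ofReal,
          conj_Q_ofReal hk0 hk1 hgap]
      · have h2 : ∀ᶠ t : ℝ in 𝓝 x, (t : ℂ) ∈ slitDomain k :=
          (Complex.continuous_ofReal.tendsto x).eventually ((isOpen_slitDomain k).mem_nhds hz)
        filter_upwards [h2] with t ht
        exact hfr t (Or.inl (ofReal_mem_slitDomain_iff.1 ht))
    · refine (hdf z h).differentiableAt.congr_of_eventuallyEq ?_
      filter_upwards [isOpen_upperHalf.mem_nhds h] with w (hw : 0 < w.im)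
      exact glue_of_nonneg hw.le
  · refine ⟨E 0 / k, ?_⟩
    rw [Complex.ofReal_zero]
    have hE0 : conj (E 0 / k) = E 0 / k := by
      have h0 : (E ((0 : ℝ) : ℂ)).im = 0 := hreal 0 (Or.inl fun j hj =>
        ne_zero_of_mem_slit hk0 hj rfl)
      rw [Complex.ofReal_zero] at h0
      rw [map_div₀, Complex.conj_eq_iff_im.2 h0, Complex.conj_ofReal]
    refine (tendsto_glue tendsto_conj_punctured (tendsto_schwarzAux_sub_inv hk0 hc)
      hE0).congr fun z => ?_
    rw [sub_zero, one_div]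
    rcases le_or_gt 0 z.im with h | h
    · rw [glue_of_nonneg h, glue_of_nonneg h]
    · rw [glue_of_neg h, glue_of_neg h, map_sub, map_inv₀, Complex.conj_conj]
  -- at infinity the limit exists on the upper side, and it is real by the values on `(1, ∞)`
  · obtain ⟨L, hL⟩ := exists_tendsto_infinity (C := (|s| + k ^ 2) * 2 / k) hcf hdf (by positivity)
      fun z hz hz2 => by
        have hz0 : 0 < ‖z‖ := by linarith
        have h1 := norm_sq_le_norm_Q hk0 hk1 hz2
        rw [norm_div, norm_mul, Complex.norm_real, Real.norm_of_nonneg hk0.le]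
        have h2 : ‖(s : ℂ) + k ^ 2 / z ^ 2‖ ≤ |s| + k ^ 2 := by
          refine (norm_add_le _ _).trans ?_
          rw [Complex.norm_real, Real.norm_eq_abs, norm_div, norm_pow, norm_pow, Complex.norm_real,
            Real.norm_of_nonneg hk0.le]
          gcongr
          exact div_le_self (sq_nonneg k) (one_le_pow₀ (by linarith))
        calc _ ≤ (|s| + k ^ 2) / (k * (‖z‖ ^ 2 / 2)) := by gcongr
          _ = _ := by field_simp
    refine ⟨L, tendsto_glue tendsto_conj_cocompact hL ?_⟩
    have hto : Tendsto (fun x : ℝ => (x : ℂ)) atTop (cocompact ℂ ⊓ 𝓟 {z | 0 ≤ z.im}) := by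
      refine tendsto_inf.2 ⟨?_, tendsto_principal.2 (by simp)⟩
      rw [← Metric.cobounded_eq_cocompact, ← tendsto_norm_atTop_iff_cobounded]
      simpa using tendsto_abs_atTop_atTop
    have h1 := hL.comp hto
    refine tendsto_nhds_unique (((Complex.continuous_conj.tendsto L).comp h1).congr' ?_) h1
    filter_upwards [eventually_gt_atTop 1] with x hx
    exact hfr x (Or.inl fun j hj =>
      absurd (abs_le.1 (abs_le_one_of_mem_slit hk0 hj).2).2 (not_le.2 hx))
  · rintro σ (rfl | rfl) j ξ hξ
    · exact ⟨_, hup ξ (ne_zero_of_mem_slit hk0 hξ)⟩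
    · exact ⟨_, hdown ξ (ne_zero_of_mem_slit hk0 hξ)⟩
  · intro ξ hξ
    refine ⟨_, (hpt ξ ?_ (Or.inr hξ)).mono_left nhdsWithin_le_nhds⟩
    rcases hξ with rfl | rfl | rfl | rfl <;> simp [hk0.ne']
  · rintro σ hσ j ξ hξ
    have hξ0 := ne_zero_of_mem_slit hk0 hξ
    have h1 : (f ξ).re = β j / k := by rw [hf, schwarzAux_re_of_slit hk0 hξ, hβ j ξ hξ]
    rcases hσ with rfl | rfl
    · rw [bank_eq (Or.inl rfl) (hup ξ hξ0), h1]
    · rw [bank_eq (Or.inr rfl) (hdown ξ hξ0), Complex.conj_re, h1]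

end

section

/-! ### The Schwarz problem with constant data on the slits -/

/-- `Y` solves the Schwarz problem with residue `p` at the origin and the constant boundary values
`Im Y = b j` on the slits. Both problems of the theorem are of this form. -/
structure IsSchwarz (k : ℝ) (p : ℂ) (b : Fin 2 → ℝ) (Y : ℂ → ℂ) : Prop where
  analytic : IsSlitAnalytic k 0 p Y
  boundary : ∀ σ : ℝ, (σ = 1 ∨ σ = -1) → ∀ j, ∀ ξ ∈ slit k j, (bank σ Y ξ).im = b j

variable {k ξ σ : ℝ} {p q : ℂ} {b c : Fin 2 → ℝ} {Y Z F : ℂ → ℂ}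

theorem IsSchwarz.add (hY : IsSchwarz k p b Y) (hZ : IsSchwarz k q c Z) :
    IsSchwarz k (p + q) (fun j => b j + c j) fun z => Y z + Z z where
  analytic := hY.analytic.add hZ.analytic
  boundary σ hσ j ξ hξ := by
    rw [bank_add hY.analytic hZ.analytic hσ hξ, Complex.add_im, hY.boundary σ hσ j ξ hξ,
      hZ.boundary σ hσ j ξ hξ]

theorem IsSchwarz.ofReal_mul (hY : IsSchwarz k p b Y) (t : ℝ) :
    IsSchwarz k (t * p) (fun j => t * b j) fun z => t * Y z where
  analytic := hY.analytic.const_mul t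
  boundary σ hσ j ξ hξ := by
    rw [bank_const_mul hY.analytic _ hσ hξ, Complex.im_ofReal_mul, hY.boundary σ hσ j ξ hξ]

theorem IsSchwarz.comp_neg (hY : IsSchwarz k p b Y) :
    IsSchwarz k (-p) (fun j => b (1 - j)) fun z => Y (-z) where
  analytic := hY.analytic.comp_neg
  boundary σ hσ j ξ hξ := by
    rw [bank_comp_neg hY.analytic hσ hξ, hY.boundary _ (neg_bank hσ) _ _ (neg_mem_slit hξ)]

theorem intervalIntegrable_inv_mul_absq (hk0 : 0 < k) (hk1 : k < 1) :
    IntervalIntegrable (fun x => 1 / (x * absq k x)) volume k 1 := by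
  have h : ContinuousOn (fun x : ℝ => x⁻¹) (Set.uIcc k 1) := continuousOn_inv₀.mono fun x hx => by
    rw [Set.uIcc_of_le hk1.le] at hx
    exact (hk0.trans_le hx.1).ne'
  have h1 := (intervalIntegrable_inv_absq hk0 hk1 k 1).continuousOn_mul h
  simp_rw [← one_div, one_div_mul_one_div] at h1
  exact h1

/-- A necessary condition on the constants: the regular part of `-iY`, divided by `q`, has total
integral zero over the boundary. -/
theorem IsSchwarz.sub_eq (hk0 : 0 < k) (hk1 : k < 1) (hY : IsSchwarz k p b Y) :
    b 1 - b 0 = 2 * (p.im * (ellI k)⁻¹ * ellJ k) := by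
  have h := (hY.analytic.const_mul (-Complex.I)).sum_integral_mean_eq_zero hk0 hk1
  have hval : ∀ i, ∀ x ∈ slit k i, (bank 1 (fun z => -Complex.I * Y z) x +
      bank (-1) (fun z => -Complex.I * Y z) x - 2 * (-Complex.I * p) / x).re / absq k x =
      2 * b i * (1 / absq k x) - 2 * p.im * (1 / (x * absq k x)) := by
    intro i x hx
    rw [bank_const_mul hY.analytic _ (Or.inl rfl) hx, bank_const_mul hY.analytic _ (Or.inr rfl) hx]
    have h1 := hY.boundary 1 (Or.inl rfl) i x hx
    have h2 := hY.boundary (-1) (Or.inr rfl) i x hx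
    have h3 := ne_zero_of_mem_slit hk0 hx
    rw [Complex.sub_re, Complex.div_ofReal_re]
    simp [h1, h2]
    field_simp
    ring
  have hI := intervalIntegrable_inv_absq hk0 hk1 k 1
  have hJ := intervalIntegrable_inv_mul_absq hk0 hk1
  have e1 : ∫ x in Set.Icc (lo k 1) (hi k 1), (bank 1 (fun z => -Complex.I * Y z) x +
      bank (-1) (fun z => -Complex.I * Y z) x - 2 * (-Complex.I * p) / x).re / absq k x =
      2 * b 1 * ellI k - 2 * p.im * ellJ k := by
    rw [setIntegral_congr_fun measurableSet_Icc (hval 1), integral_Icc_eq_integral_Ioc,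
      ← intervalIntegral.integral_of_le (show lo k 1 ≤ hi k 1 from hk1.le)]
    change ∫ x in k..1, _ = _
    rw [intervalIntegral.integral_sub (hI.const_mul _) (hJ.const_mul _),
      intervalIntegral.integral_const_mul, intervalIntegral.integral_const_mul]
    rfl
  have e0 : ∫ x in Set.Icc (lo k 0) (hi k 0), (bank 1 (fun z => -Complex.I * Y z) x +
      bank (-1) (fun z => -Complex.I * Y z) x - 2 * (-Complex.I * p) / x).re / absq k x =
      2 * b 0 * ellI k + 2 * p.im * ellJ k := by
    rw [setIntegral_congr_fun measurableSet_Icc (hval 0), integral_Icc_eq_integral_Ioc,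
      ← intervalIntegral.integral_of_le (show lo k 0 ≤ hi k 0 from neg_le_neg hk1.le)]
    change ∫ x in (-1)..(-k), _ = _
    rw [← intervalIntegral.integral_comp_neg]
    have : ∀ x : ℝ, 2 * b 0 * (1 / absq k (-x)) - 2 * p.im * (1 / (-x * absq k (-x))) =
        2 * b 0 * (1 / absq k x) + 2 * p.im * (1 / (x * absq k x)) := fun x => by
      rw [absq_neg, neg_mul, one_div_neg_eq_neg_one_div]
      ring
    simp_rw [this]
    rw [intervalIntegral.integral_add (hI.const_mul _) (hJ.const_mul _),
      intervalIntegral.integral_const_mul, intervalIntegral.integral_const_mul]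
    rfl
  rw [Fin.sum_univ_two, e0, e1] at h
  have hI0 := ellI_pos hk0 hk1
  field_simp
  simp only [Fin.val_zero, pow_zero, Fin.val_one, pow_one] at h
  linarith

/-- A solution is a combination of `1/ζ`, of the kernel `iG` and of a constant. The necessary
condition, applied to `iG`, gives the difference of its two boundary constants. -/
theorem exists_isSchwarz (hk0 : 0 < k) (hk1 : k < 1)
    (hb : b 1 - b 0 = 2 * (p.im * (ellI k)⁻¹ * ellJ k)) : ∃ Y, IsSchwarz k p b Y := by
  obtain ⟨G, hG, β, hβ⟩ := exists_schwarz_kernel hk0 hk1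
  have hS : IsSchwarz k (Complex.I * 1) β fun z => Complex.I * G z :=
    ⟨hG.const_mul _, fun σ hσ j ξ hξ => by
      rw [bank_const_mul hG _ hσ hξ, Complex.I_mul_im, hβ σ hσ j ξ hξ]⟩
  have hβ' := hS.sub_eq hk0 hk1
  rw [mul_one, Complex.I_im, one_mul] at hβ'
  have hinv : IsSchwarz k 1 (fun _ => 0) fun z => z⁻¹ :=
    ⟨isSlitAnalytic_inv hk0, fun σ hσ j ξ hξ => by
      rw [bank_inv hk0 hσ hξ, ← Complex.ofReal_inv, Complex.ofReal_im]⟩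
  set t : ℝ := b 0 - p.im * β 0
  have hconst : IsSchwarz k 0 (fun _ => t) fun _ => t * Complex.I :=
    ⟨isSlitAnalytic_const k _, fun σ hσ j ξ _ => by rw [bank_const _ hσ]; simp⟩
  have h := ((hinv.ofReal_mul p.re).add (hS.ofReal_mul p.im)).add hconst
  have hp : (p.re : ℂ) * 1 + p.im * (Complex.I * 1) + 0 = p := by
    rw [mul_one, mul_one, add_zero, Complex.re_add_im]
  have hbb : (fun j => p.re * 0 + p.im * β j + t) = b := by
    funext j
    fin_cases j
    · simp [t]
    · change p.re * 0 + p.im * β 1 + (b 0 - p.im * β 0) = b 1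
      linear_combination p.im * hβ' - hb
  rw [hp, hbb] at h
  exact ⟨_, h⟩

theorem exists_isSchwarz_iff (hk0 : 0 < k) (hk1 : k < 1) :
    (∃ Y, IsSchwarz k p b Y) ↔ b 1 - b 0 = 2 * (p.im * (ellI k)⁻¹ * ellJ k) :=
  ⟨fun ⟨_, h⟩ => h.sub_eq hk0 hk1, exists_isSchwarz hk0 hk1⟩

/-! ### Uniqueness -/

theorem IsSlitAnalytic.continuousOn_bank (hk0 : 0 < k) (hF : IsSlitAnalytic k 0 p F)
    (hσ : σ = 1 ∨ σ = -1) (j : Fin 2) : ContinuousOn (bank σ F) (slit k j) := by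
  obtain ⟨U, V, hU, hV, -, hb⟩ := hF.exists_pair hk0
  have hp : ContinuousOn (fun x : ℝ => p / (x : ℂ)) (slit k j) :=
    continuousOn_const.div Complex.continuous_ofReal.continuousOn fun x hx => by
      exact_mod_cast ne_zero_of_mem_slit hk0 hx
  rcases hσ with rfl | rfl
  · exact (hU.continuous_ofReal.continuousOn.add hp).congr fun x hx => (hb j x hx).1
  · exact ((Complex.continuous_conj.comp hV.continuous_ofReal).continuousOn.add hp).congr
      fun x hx => (hb j x hx).2

theorem ae_mem_slit_interior (k : ℝ) (hk0 : 0 < k) (i : Fin 2) :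
    ∀ᵐ x ∂volume.restrict (Set.Icc (lo k i) (hi k i)), x ∈ slit k i ∧ k < |x| ∧ |x| < 1 := by
  rw [ae_restrict_iff' measurableSet_Icc]
  filter_upwards [Measure.ae_ne volume k, Measure.ae_ne volume (-k), Measure.ae_ne volume 1,
    Measure.ae_ne volume (-1)] with x h1 h2 h3 h4 hx
  have h := abs_le_one_of_mem_slit hk0 (show x ∈ slit k i from hx)
  refine ⟨hx, lt_of_le_of_ne h.1 fun he => ?_, lt_of_le_of_ne h.2 fun he => ?_⟩
  · rcases abs_choice x with h5 | h5 <;> rw [h5] at he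
    · exact h1 he.symm
    · exact h2 (by rw [he, neg_neg])
  · rcases (abs_eq zero_le_one).1 he with h5 | h5
    · exact h3 h5
    · exact h4 h5

theorem HasPVSum.eq_zero {φ : Fin 2 → ℝ → ℝ} {L : ℝ} (h : HasPVSum k ξ φ L)
    (h0 : ∀ i, ∀ᵐ x ∂volume.restrict (Set.Icc (lo k i) (hi k i)), φ i x = 0) : L = 0 := by
  have hv : ∀ i, HasPV (lo k i) (hi k i) ξ (φ i) 0 := fun i => by
    have := HasPV.of_integrableOn (a := lo k i) (b := hi k i) ξ
      (integrableOn_zero (ε' := ℝ) (μ := volume))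
    rw [integral_zero] at this
    refine this.congr_ae ?_
    filter_upwards [h0 i] with x hx using hx.symm
  rw [h.eq_sum hv, Finset.sum_const_zero]

/-- If `Im Y` vanishes on the banks, both the jump and the mean of `Re (-iY)` do, which determines
the mean and the jump of `Re Y`. -/
theorem IsSchwarz.re_bank_eq (hk0 : 0 < k) (hk1 : k < 1) (hY : IsSchwarz k 0 (fun _ => 0) Y)
    (hσ : σ = 1 ∨ σ = -1) (h1 : k < ξ) (h2 : ξ < 1) :
    (bank σ Y ξ).re = (valueAtInfinity Y).re := by
  have hξ := slit_one_of h1 h2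
  have ha := hY.analytic.const_mul (-Complex.I)
  have hb : ∀ {σ : ℝ} (_ : σ = 1 ∨ σ = -1) {i : Fin 2} {x : ℝ} (_ : x ∈ slit k i),
      bank σ (fun z => -Complex.I * Y z) x = -Complex.I * bank σ Y x :=
    fun hσ _ _ hx => bank_const_mul hY.analytic _ hσ hx
  have hjump := (ha.hasPVSum_jump hk0 h1 h2).eq_zero fun i => by
    filter_upwards [ae_mem_slit_interior k hk0 i] with x hx
    rw [hb (Or.inl rfl) hx.1, hb (Or.inr rfl) hx.1]
    simp [hY.boundary 1 (Or.inl rfl) i x hx.1, hY.boundary (-1) (Or.inr rfl) i x hx.1]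
  have hmean := (ha.hasPVSum_mean hk0 hk1 h1 h2).eq_zero fun i => by
    filter_upwards [ae_mem_slit_interior k hk0 i] with x hx
    rw [hb (Or.inl rfl) hx.1, hb (Or.inr rfl) hx.1]
    simp [hY.boundary 1 (Or.inl rfl) i x hx.1, hY.boundary (-1) (Or.inr rfl) i x hx.1]
  rw [hb (Or.inl rfl) hξ, hb (Or.inr rfl) hξ, valueAtInfinity_const_mul hY.analytic] at hjump
  rw [hb (Or.inl rfl) hξ, hb (Or.inr rfl) hξ] at hmean
  have hq := absq_pos_of_abs hk0 (x := ξ) (by rwa [abs_of_pos (hk0.trans h1)])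
    (by rwa [abs_of_pos (hk0.trans h1)])
  simp [Real.pi_ne_zero, hq.ne'] at hjump hmean
  rcases hσ with rfl | rfl <;> linarith

/-- The homogeneous problem has only constant boundary values. -/
theorem IsSchwarz.bank_eq_valueAtInfinity (hk0 : 0 < k) (hk1 : k < 1)
    (hY : IsSchwarz k 0 (fun _ => 0) Y) (hσ : σ = 1 ∨ σ = -1) (hξ : ξ ∈ slit k 1) :
    bank σ Y ξ = valueAtInfinity Y := by
  have him : (valueAtInfinity Y).im = 0 := by
    obtain ⟨x₀, h1, h2⟩ := exists_between hk1
    -- `Re Y` is constant on both slits, hence has no jump, and this fixes the mean of `Im Y`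
    have hY' : IsSchwarz k 0 (fun _ => 0) fun z => Y (-z) := by simpa using hY.comp_neg
    have hre : ∀ {σ : ℝ} (_ : σ = 1 ∨ σ = -1) {i : Fin 2} {x : ℝ} (_ : x ∈ slit k i)
        (_ : k < |x|) (_ : |x| < 1), (bank σ Y x).re = (valueAtInfinity Y).re := by
      intro σ hσ i x hx h1 h2
      rcases abs_choice x with h | h <;> rw [h] at h1 h2
      · exact hY.re_bank_eq hk0 hk1 hσ h1 h2
      · have h3 := hY'.re_bank_eq hk0 hk1 (neg_bank hσ) h1 h2
        rwa [bank_comp_neg hY.analytic (neg_bank hσ) (neg_mem_slit hx), neg_neg, neg_neg,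
          valueAtInfinity_comp_neg hY.analytic] at h3
    have hjump := (hY.analytic.hasPVSum_jump hk0 h1 h2).eq_zero fun i => by
      filter_upwards [ae_mem_slit_interior k hk0 i] with x hx
      rw [Complex.sub_re, hre (Or.inl rfl) hx.1 hx.2.1 hx.2.2, hre (Or.inr rfl) hx.1 hx.2.1 hx.2.2,
        sub_self, zero_div]
    have hξ := slit_one_of h1 h2
    simpa [Real.pi_ne_zero, hY.boundary 1 (Or.inl rfl) 1 x₀ hξ,
      hY.boundary (-1) (Or.inr rfl) 1 x₀ hξ] using hjump
  -- the tips, by continuity of the boundary values along the slit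
  have hEq : Set.EqOn (bank σ Y) (fun _ => valueAtInfinity Y) (Set.Ioo k 1) := fun x hx =>
    Complex.ext (hY.re_bank_eq hk0 hk1 hσ hx.1 hx.2) (by
      rw [him, hY.boundary σ hσ 1 x (slit_one_of hx.1 hx.2)])
  exact hEq.of_subset_closure (hY.analytic.continuousOn_bank hk0 hσ 1) continuousOn_const
    Set.Ioo_subset_Icc_self (by rw [closure_Ioo hk1.ne]; exact subset_rfl) hξ

end

section

variable {k ξ σ : ℝ}

/-! ### The functions `g₀` and `g₁` -/

theorem integrableOn_div_absq (hk0 : 0 < k) (hk1 : k < 1) {φ : ℝ → ℝ} {a b : ℝ}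
    (hφ : ContinuousOn φ (Set.Icc a b)) : IntegrableOn (fun η => φ η / absq k η) (Set.Icc a b) := by
  simp_rw [div_eq_mul_inv]
  exact (integrable_inv_absq hk0 hk1).integrableOn.continuousOn_mul hφ isCompact_Icc

theorem differentiableAt_absq (hk0 : 0 < k) (h1 : k < |ξ|) (h2 : |ξ| < 1) :
    DifferentiableAt ℝ (absq k) ξ := by
  have h := absq_pos_of_abs hk0 h1 h2
  have h0 : |(ξ ^ 2 - 1) * (ξ ^ 2 - k ^ 2)| ≠ 0 := fun h0 => by
    unfold absq at h
    rw [h0, Real.sqrt_zero] at h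
    exact lt_irrefl _ h
  exact DifferentiableAt.sqrt (DifferentiableAt.abs (by fun_prop) (abs_ne_zero.1 h0)) h0

theorem integrableOn_div_absq_mul_sub (hk0 : 0 < k) (hk1 : k < 1) {φ : ℝ → ℝ} {j : Fin 2}
    (hφ : ContinuousOn φ (slit k j)) (hξ : ξ ∉ slit k j) :
    IntegrableOn (fun η => φ η / (absq k η * (η - ξ))) (Set.Icc (lo k j) (hi k j)) := by
  have h : ContinuousOn (fun η => φ η / (η - ξ)) (slit k j) :=
    hφ.div (by fun_prop) fun x hx => sub_ne_zero.2 fun he => hξ (he ▸ hx)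
  refine (integrableOn_div_absq hk0 hk1 h).congr_fun (fun x _ => ?_) measurableSet_Icc
  beta_reduce
  rw [div_div, mul_comm]

/-- The principal value exists at all points but the tips; `ξ` may lie on the slit `j` or not. -/
theorem exists_hasPV_div_absq (hk0 : 0 < k) (hk1 : k < 1) {φ : ℝ → ℝ} {j : Fin 2}
    (hφ : ∀ x ∈ slit k j, DifferentiableAt ℝ φ x) (h1 : k < |ξ|) (h2 : |ξ| < 1) :
    ∃ v, HasPV (lo k j) (hi k j) ξ (fun η => φ η / (absq k η * (η - ξ))) v := by
  have hc : ContinuousOn φ (slit k j) := fun x hx => (hφ x hx).continuousAt.continuousWithinAt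
  by_cases hξ : ξ ∈ slit k j
  · have hlt : lo k j < ξ ∧ ξ < hi k j := by
      refine ⟨lt_of_le_of_ne hξ.1 ?_, lt_of_le_of_ne hξ.2 ?_⟩ <;> rintro he
      · rw [← he] at h1 h2
        fin_cases j
        · simp [lo] at h2
        · simp [lo, abs_of_pos hk0] at h1
      · rw [he] at h1 h2
        fin_cases j
        · simp [hi, abs_of_pos hk0] at h1
        · simp [hi] at h2
    obtain ⟨v, hv⟩ := exists_hasPV_of_differentiableAt hlt.1 hlt.2 (integrableOn_div_absq hk0 hk1 hc)
      ((hφ ξ hξ).div (differentiableAt_absq hk0 h1 h2) (absq_pos_of_abs hk0 h1 h2).ne')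
    exact ⟨v, hv.congr fun η _ _ => div_div _ _ _⟩
  · exact ⟨_, HasPV.of_integrableOn ξ (integrableOn_div_absq_mul_sub hk0 hk1 hc hξ)⟩

section

variable {μ : ℝ} {τ τinf cm : ℂ} {a : Fin 2 → ℝ}

theorem g0_eq (μ μ' : ℝ) (τ τinf cm : ℂ) (ξ : ℝ) :
    g0 0 μ μ' τ τinf cm ξ = cStar μ μ' τ τinf cm / ξ := by
  unfold g0 cStar
  rw [← Complex.div_ofReal_re]
  congr 1
  push_cast
  ring

theorem g1Integrand_eq (k μ : ℝ) (τ τinf cm : ℂ) (a : Fin 2 → ℝ) (ξ : ℝ) (j : Fin 2) :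
    g1Integrand k 0 μ τ τinf cm a ξ j =
      fun η => (a j - (resF μ τ τinf cm).im / η) / (absq k η * (η - ξ)) := by
  funext η
  unfold g1Integrand
  rw [Complex.ofReal_zero, sub_zero, Complex.div_ofReal_im]

theorem exists_hasPV_g1Integrand (hk0 : 0 < k) (hk1 : k < 1) (h1 : k < |ξ|) (h2 : |ξ| < 1)
    (j : Fin 2) : ∃ v, HasPV (lo k j) (hi k j) ξ (g1Integrand k 0 μ τ τinf cm a ξ j) v := by
  rw [g1Integrand_eq]
  refine exists_hasPV_div_absq hk0 hk1 (fun x hx => ?_) h1 h2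
  have := ne_zero_of_mem_slit hk0 hx
  fun_prop (disch := assumption)

theorem g1_eq {v : Fin 2 → ℝ}
    (hv : ∀ j, HasPV (lo k j) (hi k j) ξ (g1Integrand k 0 μ τ τinf cm a ξ j) (v j)) :
    g1 k 0 μ τ τinf cm a ξ = absq k ξ / Real.pi * (v 0 - v 1) := by
  unfold g1
  rw [Fin.sum_univ_two, (hv 0).pv_eq, (hv 1).pv_eq, Fin.val_zero, Fin.val_one]
  ring

/-- For antisymmetric constants, reflection exchanges the two integrands. -/
theorem g1Integrand_neg (ha : a 1 = -a 0) (ξ η : ℝ) (j : Fin 2) :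
    g1Integrand k 0 μ τ τinf cm a ξ (1 - j) (-η) = g1Integrand k 0 μ τ τinf cm a (-ξ) j η := by
  have haj : a (1 - j) = -a j := by
    fin_cases j
    · exact ha
    · change a 0 = -a 1
      rw [ha, neg_neg]
  rw [g1Integrand_eq, g1Integrand_eq]
  beta_reduce
  rw [haj, absq_neg, show absq k η * (-η - ξ) = -(absq k η * (η - -ξ)) by ring, div_neg, ← neg_div,
    div_neg]
  congr 1
  ring

theorem HasPV.g1Integrand_neg (ha : a 1 = -a 0) {j : Fin 2} {v : ℝ}
    (h : HasPV (lo k (1 - j)) (hi k (1 - j)) ξ (g1Integrand k 0 μ τ τinf cm a ξ (1 - j)) v) :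
    HasPV (lo k j) (hi k j) (-ξ) (g1Integrand k 0 μ τ τinf cm a (-ξ) j) v := by
  have h1 := h.comp_neg
  have h2 : -hi k (1 - j) = lo k j ∧ -lo k (1 - j) = hi k j := by
    fin_cases j <;> simp [lo, hi]
  rw [h2.1, h2.2] at h1
  exact h1.congr fun η _ _ => TwoSlit.g1Integrand_neg ha ξ η j

theorem g1_neg (hk0 : 0 < k) (hk1 : k < 1) (ha : a 1 = -a 0) (h1 : k < |ξ|) (h2 : |ξ| < 1) :
    g1 k 0 μ τ τinf cm a (-ξ) = -g1 k 0 μ τ τinf cm a ξ := by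
  choose v hv using exists_hasPV_g1Integrand (μ := μ) (τ := τ) (τinf := τinf) (cm := cm) (a := a)
    hk0 hk1 h1 h2
  rw [g1_eq hv, g1_eq (v := fun j => v (1 - j)) fun j => (hv (1 - j)).g1Integrand_neg ha, absq_neg]
  simp only [sub_zero, sub_self]
  ring

theorem exists_hasPV_g1SymIntegrand (hk0 : 0 < k) (hk1 : k < 1) (h1 : k < |ξ|) (h2 : |ξ| < 1)
    (c'' a1 : ℝ) : ∃ v, HasPV k 1 |ξ| (g1SymIntegrand k c'' a1 ξ) v := by
  obtain ⟨v, hv⟩ := exists_hasPV_div_absq (φ := fun η => (c'' / η - a1) / (η + |ξ|)) (ξ := |ξ|)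
    (j := 1) hk0 hk1 (fun x hx => by
      have hx0 : k ≤ x := hx.1
      have h3 : x ≠ 0 := (hk0.trans_le hx0).ne'
      have h4 : x + |ξ| ≠ 0 := by linarith
      fun_prop (disch := assumption)) (by rwa [abs_abs]) (by rwa [abs_abs])
  refine ⟨v, hv.congr fun η _ _ => ?_⟩
  unfold g1SymIntegrand
  rw [div_div, ← sq_abs ξ]
  congr 1
  ring

/-- Reflection of the integral over the left slit, and
`1 / (η + ξ) - 1 / (η - ξ) = -2ξ / (η² - ξ²)`. -/
theorem g1_eq_pv (hk0 : 0 < k) (hk1 : k < 1) (ha : a 1 = -a 0) (h1 : k < |ξ|) (h2 : |ξ| < 1) :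
    g1 k 0 μ τ τinf cm a ξ = 2 * ξ * absq k ξ / Real.pi *
      pv k 1 |ξ| (g1SymIntegrand k (resF μ τ τinf cm).im (a 1) ξ) := by
  have key : ∀ x : ℝ, k < x → x < 1 → g1 k 0 μ τ τinf cm a x = 2 * x * absq k x / Real.pi *
      pv k 1 x (g1SymIntegrand k (resF μ τ τinf cm).im (a 1) x) := by
    intro x hx1 hx2
    have hx0 : 0 < x := hk0.trans hx1
    choose v hv using exists_hasPV_g1Integrand (μ := μ) (τ := τ) (τinf := τinf) (cm := cm) (a := a)
      hk0 hk1 (ξ := x) (by rwa [abs_of_pos hx0]) (by rwa [abs_of_pos hx0])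
    have hreg : IntegrableOn (g1Integrand k 0 μ τ τinf cm a (-x) 1)
        (Set.Icc (lo k 1) (hi k 1)) := by
      rw [g1Integrand_eq]
      refine integrableOn_div_absq_mul_sub hk0 hk1 (fun y hy => ?_) fun h => ?_
      · have := ne_zero_of_mem_slit hk0 hy
        exact ContinuousAt.continuousWithinAt (by fun_prop (disch := assumption))
      · have : k ≤ -x := h.1
        linarith
    have h0 : v 0 = ∫ η in Set.Icc (lo k 1) (hi k 1), g1Integrand k 0 μ τ τinf cm a (-x) 1 η :=
      (HasPV.g1Integrand_neg ha (j := 1) (by simpa using hv 0)).pv_eq.symm.trans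
        (HasPV.of_integrableOn (-x) hreg).pv_eq
    have h4 := ((HasPV.of_integrableOn x hreg).add ((hv 1).const_mul (-1))).const_mul (1 / (2 * x))
    have h5 : HasPV k 1 x (g1SymIntegrand k (resF μ τ τinf cm).im (a 1) x) _ := h4.congr
      fun η hη hne => by
        have hη' : k ≤ η := hη.1
        have hη0 : η + x ≠ 0 := by linarith
        have hη1 : η - x ≠ 0 := sub_ne_zero.2 hne
        rw [g1Integrand_eq, g1Integrand_eq]
        unfold g1SymIntegrand
        beta_reduce
        rw [sub_neg_eq_add, show η ^ 2 - x ^ 2 = (η + x) * (η - x) by ring]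
        rcases eq_or_ne (absq k η) 0 with h | h
        · rw [h]; simp
        · rw [← neg_sub (a 1) ((resF μ τ τinf cm).im / η)]
          generalize a 1 - (resF μ τ τinf cm).im / η = A
          field_simp
          ring
    rw [h5.pv_eq, g1_eq hv, ← h0]
    field_simp
    ring
  rcases abs_choice ξ with h | h <;> rw [h] at h1 h2 ⊢
  · exact key ξ h1 h2
  · have h3 := key _ h1 h2
    rw [g1_neg hk0 hk1 ha (by rwa [h]) (by rwa [h]), absq_neg] at h3
    have h4 : g1SymIntegrand k (resF μ τ τinf cm).im (a 1) (-ξ) =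
        g1SymIntegrand k (resF μ τ τinf cm).im (a 1) ξ := by
      funext η; unfold g1SymIntegrand; rw [neg_sq]
    rw [h4] at h3
    linear_combination -h3

/-! ### Boundary values of the solutions -/

variable {F ω : ℂ → ℂ} {d : Fin 2 → ℝ}

theorem FirstSchwarz.isSchwarz (hF : FirstSchwarz k 0 μ τ τinf cm a F) :
    IsSchwarz k (resF μ τ τinf cm) a F := ⟨hF.analytic, hF.boundary⟩

/-- The boundary values of `F` on the right slit: the mean comes from the absence of a jump of
`Im F`, the jump from the Cauchy integral of `F / q`. -/
theorem FirstSchwarz.re_bank (hk0 : 0 < k) (hk1 : k < 1)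
    (hF : FirstSchwarz k 0 μ τ τinf cm a F) (hσ : σ = 1 ∨ σ = -1) (h1 : k < ξ) (h2 : ξ < 1) :
    (bank σ F ξ).re =
      beta0 F + (resF μ τ τinf cm).re / ξ - σ * g1 k 0 μ τ τinf cm a ξ := by
  have hξ := slit_one_of h1 h2
  have hξ0 : |ξ| = ξ := abs_of_pos (hk0.trans h1)
  have ha := hF.analytic.const_mul (-Complex.I)
  have hb : ∀ {σ : ℝ} (_ : σ = 1 ∨ σ = -1) {i : Fin 2} {x : ℝ} (_ : x ∈ slit k i),
      bank σ (fun z => -Complex.I * F z) x = -Complex.I * bank σ F x :=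
    fun hσ _ _ hx => bank_const_mul hF.analytic _ hσ hx
  have hjump := (ha.hasPVSum_jump hk0 h1 h2).eq_zero fun i => by
    filter_upwards [ae_mem_slit_interior k hk0 i] with x hx
    rw [hb (Or.inl rfl) hx.1, hb (Or.inr rfl) hx.1]
    simp [hF.boundary 1 (Or.inl rfl) i x hx.1, hF.boundary (-1) (Or.inr rfl) i x hx.1]
  choose v hv using exists_hasPV_g1Integrand (μ := μ) (τ := τ) (τinf := τinf) (cm := cm) (a := a)
    hk0 hk1 (ξ := ξ) (by rwa [hξ0]) (by rwa [hξ0])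
  have hmean := ((ha.hasPVSum_mean hk0 hk1 h1 h2).congr (ψ := fun i x => (-1) ^ (i : ℕ) * 2 *
      g1Integrand k 0 μ τ τinf cm a ξ i x) fun i => by
    filter_upwards [ae_mem_slit_interior k hk0 i] with x hx
    rw [hb (Or.inl rfl) hx.1, hb (Or.inr rfl) hx.1, Complex.sub_re, Complex.div_ofReal_re,
      g1Integrand_eq]
    simp [hF.boundary 1 (Or.inl rfl) i x hx.1, hF.boundary (-1) (Or.inr rfl) i x hx.1]
    ring).eq_sum fun i => (hv i).const_mul _
  rw [hb (Or.inl rfl) hξ, hb (Or.inr rfl) hξ, valueAtInfinity_const_mul hF.analytic,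
    Complex.sub_im, Complex.sub_im, Complex.div_ofReal_im] at hjump
  rw [hb (Or.inl rfl) hξ, hb (Or.inr rfl) hξ, Fin.sum_univ_two] at hmean
  have hq := absq_pos_of_abs hk0 (x := ξ) (by rwa [hξ0]) (by rwa [hξ0])
  simp [Real.pi_ne_zero] at hjump hmean
  rw [g1_eq hv]
  unfold beta0
  have hpi := Real.pi_pos
  have hdiff : (bank 1 F ξ).re - (bank (-1) F ξ).re =
      -2 * (absq k ξ / Real.pi * (v 0 - v 1)) := by
    field_simp at hmean ⊢
    linear_combination -hmean
  rw [neg_div, mul_div_assoc] at hjump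
  rcases hσ with rfl | rfl <;> linarith

/-- `F(ζ) + F(-ζ)` is constant on the boundary: it is regular at the origin and, for
antisymmetric constants, its imaginary part vanishes on the slits. -/
theorem FirstSchwarz.bank_add_bank_neg (hk0 : 0 < k) (hk1 : k < 1)
    (hF : FirstSchwarz k 0 μ τ τinf cm a F) (ha : a 1 = -a 0) (hσ : σ = 1 ∨ σ = -1)
    (hξ : ξ ∈ slit k 1) : bank σ F ξ + bank (-σ) F (-ξ) = 2 * valueAtInfinity F := by
  have h : IsSchwarz k 0 (fun _ => 0) fun z => F z + F (-z) := by
    have h1 := hF.isSchwarz.add hF.isSchwarz.comp_neg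
    rw [add_neg_cancel] at h1
    convert h1 using 2 with j
    fin_cases j <;> simp [ha]
  have h1 := h.bank_eq_valueAtInfinity hk0 hk1 hσ hξ
  rw [bank_add hF.analytic hF.analytic.comp_neg hσ hξ, bank_comp_neg hF.analytic hσ hξ,
    valueAtInfinity_add hF.analytic hF.analytic.comp_neg, valueAtInfinity_comp_neg hF.analytic] at h1
  rw [h1, two_mul]

end

end

section

variable {k ξ σ μ : ℝ} {μi : Fin 2 → ℝ} {τ τinf cm : ℂ} {a d : Fin 2 → ℝ} {F ω : ℂ → ℂ}

/-! ### The second problem -/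

theorem kap_eq_iff (hμ : 0 < μ) {x y : ℝ} : kap μ x = kap μ y ↔ x = y :=
  div_left_inj' hμ.ne'

theorem lam_ne_zero {x : ℝ} (hx : 0 < x) (h1 : kap μ x ≠ 1) : lam μ x ≠ 0 :=
  div_ne_zero hx.ne' (sub_ne_zero.2 h1.symm)

theorem inv_lam (hμ : 0 < μ) {x : ℝ} (hx : 0 < x) : (lam μ x)⁻¹ = 1 / x - 1 / μ := by
  unfold lam kap
  field_simp

theorem mul_lamTilde (hμ : 0 < μ) (x : ℝ) : μ * lamTilde μ x = lam μ x := by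
  unfold lamTilde lam kap
  rw [← mul_div_assoc, mul_div_cancel₀ _ hμ.ne']

/-- `c_*` is the real part of the residue of `F - conj τ ω / λ`. -/
theorem cStar_eq (hμ : 0 < μ) {x : ℝ} (hx : 0 < x) (τ τinf cm : ℂ) :
    cStar μ x τ τinf cm = (resF μ τ τinf cm).re - (lam μ x)⁻¹ * (conj τ * cm).re := by
  rw [inv_lam hμ hx, ← Complex.re_ofReal_mul, ← Complex.sub_re]
  unfold cStar resF
  congr 1
  push_cast
  ring

/-- The second problem is a Schwarz problem for `i (conj τ ω / λ - F)`. -/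
theorem exists_secondSchwarz_iff {lm : ℝ} (hlm : lm ≠ 0) (hlam : ∀ j, lam μ (μi j) = lm)
    (hτ : τ ≠ 0) (hF : FirstSchwarz k 0 μ τ τinf cm a F) :
    (∃ ω, SecondSchwarz k 0 μ μi τ cm d F ω) ↔
      ∃ Y, IsSchwarz k (Complex.I * ((lm : ℂ)⁻¹ * conj τ * cm - resF μ τ τinf cm))
        (fun j => -d j) Y := by
  have hlm' : (lm : ℂ) ≠ 0 := by exact_mod_cast hlm
  have hτ' : conj τ ≠ 0 := (map_ne_zero _).2 hτ
  constructor
  · rintro ⟨ω, hω⟩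
    have hA := (hω.analytic.const_mul (Complex.I * ((lm : ℂ)⁻¹ * conj τ)))
    have hB := hF.analytic.const_mul (-Complex.I)
    have hAB := hA.add hB
    refine ⟨fun z => Complex.I * ((lm : ℂ)⁻¹ * conj τ) * ω z + -Complex.I * F z,
      ⟨?_, fun σ hσ j ξ hξ => ?_⟩⟩
    · convert hAB using 1
      ring
    · rw [bank_add hA hB hσ hξ, bank_const_mul hω.analytic _ hσ hξ,
        bank_const_mul hF.analytic _ hσ hξ]
      have h := hω.boundary σ hσ j ξ hξ
      rw [hlam] at h
      have h2 : (Complex.I * ((lm : ℂ)⁻¹ * conj τ) * bank σ ω ξ + -Complex.I * bank σ F ξ).im =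
          lm⁻¹ * (conj τ * bank σ ω ξ).re - (bank σ F ξ).re := by
        rw [← Complex.re_ofReal_mul, ← Complex.sub_re, ← Complex.I_mul_im]
        congr 1
        push_cast
        ring
      rw [h2, h, inv_mul_cancel_left₀ hlm]
      ring
  · rintro ⟨Y, hY⟩
    have hA := hF.analytic.const_mul (lm / conj τ)
    have hB := hY.analytic.const_mul (-Complex.I * lm / conj τ)
    have hAB := hA.add hB
    refine ⟨fun z => lm / conj τ * F z + -Complex.I * lm / conj τ * Y z, ⟨?_, ?_⟩⟩
    · convert hAB using 1
      field_simp
      linear_combination (conj τ * cm - lm * resF μ τ τinf cm) * Complex.I_sq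
    · intro σ hσ j ξ hξ
      rw [bank_add hA hB hσ hξ, bank_const_mul hF.analytic _ hσ hξ,
        bank_const_mul hY.analytic _ hσ hξ, hlam]
      have h2 : conj τ * (lm / conj τ * bank σ F ξ + -Complex.I * lm / conj τ * bank σ Y ξ) =
          (lm : ℂ) * (bank σ F ξ - Complex.I * bank σ Y ξ) := by
        field_simp
        ring
      rw [h2, Complex.re_ofReal_mul, Complex.sub_re, Complex.I_mul_re, hY.boundary σ hσ j ξ hξ]
      ring

theorem secondSchwarz_solvable_iff (hk0 : 0 < k) (hk1 : k < 1) (hμ : 0 < μ) {x : ℝ} (hx : 0 < x)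
    (hx1 : kap μ x ≠ 1) (hμi : ∀ j, μi j = x) (hτ : τ ≠ 0)
    (hF : FirstSchwarz k 0 μ τ τinf cm a F) :
    (∃ ω, SecondSchwarz k 0 μ μi τ cm d F ω) ↔ rho μ μi d F 1 - rho μ μi d F 0 =
      2 * (-(x * cStar μ x τ τinf cm / (1 - kap μ x)) * (ellI k)⁻¹ * ellJ k) := by
  have hlm := lam_ne_zero hx hx1
  rw [exists_secondSchwarz_iff hlm (fun j => by rw [hμi j]) hτ hF, exists_isSchwarz_iff hk0 hk1]
  have him : (Complex.I * ((lam μ x : ℂ)⁻¹ * conj τ * cm - resF μ τ τinf cm)).im =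
      -cStar μ x τ τinf cm := by
    rw [cStar_eq hμ hx, Complex.I_mul_im, Complex.sub_re, mul_assoc, ← Complex.ofReal_inv,
      Complex.re_ofReal_mul]
    ring
  have hl : x * cStar μ x τ τinf cm / (1 - kap μ x) = lam μ x * cStar μ x τ τinf cm := by
    unfold lam; ring
  rw [him, hl]
  unfold rho rho'
  rw [hμi, hμi]
  constructor
  · intro h
    linear_combination lam μ x * h
  · intro h
    refine mul_left_cancel₀ hlm ?_
    linear_combination h

theorem SecondSchwarz.sub_const (hω : SecondSchwarz k 0 μ μi τ cm d F ω) (hτ : τ ≠ 0) :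
    SecondSchwarz k 0 μ μi τ cm d F
        (fun ζ => ω ζ - (-Complex.I * (gamma0 τ ω : ℂ) / conj τ)) ∧
      gamma0 τ (fun ζ => ω ζ - (-Complex.I * (gamma0 τ ω : ℂ) / conj τ)) = 0 := by
  have hτ' : conj τ ≠ 0 := (map_ne_zero _).2 hτ
  have hc := isSlitAnalytic_const k (-(-Complex.I * (gamma0 τ ω : ℂ) / conj τ))
  have hA := hω.analytic.add hc
  rw [add_zero] at hA
  simp_rw [sub_eq_add_neg]
  refine ⟨⟨hA, fun σ hσ j ξ hξ => ?_⟩, ?_⟩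
  · rw [bank_add hω.analytic hc hσ hξ, bank_const _ hσ, ← hω.boundary σ hσ j ξ hξ, mul_add,
      Complex.add_re, ← neg_div, mul_div_cancel₀ _ hτ']
    simp
  · change (Complex.I * conj τ *
      valueAtInfinity fun ζ => ω ζ + -(-Complex.I * (gamma0 τ ω : ℂ) / conj τ)).re = 0
    rw [valueAtInfinity_add hω.analytic hc,
      valueAtInfinity_eq (w := -(-Complex.I * (gamma0 τ ω : ℂ) / conj τ)) tendsto_const_nhds,
      mul_add, Complex.add_re, ← neg_div, mul_assoc Complex.I (conj τ) (_ / _),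
      mul_div_cancel₀ _ hτ']
    change gamma0 τ ω + _ = 0
    simp

/-- The boundary values of `ω` are odd: `i (conj τ) (ω(ζ) + ω(-ζ))` solves the homogeneous Schwarz
problem, and its constant boundary value is its value `2γ₀ = 0` at infinity. -/
theorem SecondSchwarz.bank_eq_neg (hk0 : 0 < k) (hk1 : k < 1) {lm : ℝ} (hlm : lm ≠ 0)
    (hlam : ∀ j, lam μ (μi j) = lm) (hτ : τ ≠ 0) (hF : FirstSchwarz k 0 μ τ τinf cm a F)
    (ha : a 1 = -a 0) (hω : SecondSchwarz k 0 μ μi τ cm d F ω)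
    (hρ : rho μ μi d F 1 = -rho μ μi d F 0) (hγ : gamma0 τ ω = 0) (hσ : σ = 1 ∨ σ = -1)
    (hξ : ξ ∈ slit k 1) : bank σ ω ξ = -bank (-σ) ω (-ξ) := by
  have hτ' : conj τ ≠ 0 := (map_ne_zero _).2 hτ
  have hρ' : rho' d F 1 = -rho' d F 0 := by
    unfold rho at hρ
    rw [hlam, hlam] at hρ
    refine mul_left_cancel₀ hlm ?_
    rw [hρ]
    ring
  unfold rho' beta0 at hρ'
  have hS := hω.analytic.add hω.analytic.comp_neg
  rw [add_neg_cancel] at hS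
  have hS' := hS.const_mul (Complex.I * conj τ)
  rw [mul_zero] at hS'
  -- the boundary values of `i (conj τ) (ω(ζ) + ω(-ζ))` on the right slit are real
  have him : ∀ σ : ℝ, (σ = 1 ∨ σ = -1) → ∀ ξ ∈ slit k 1,
      (Complex.I * conj τ * (bank σ ω ξ + bank (-σ) ω (-ξ))).im = 0 := by
    intro σ hσ ξ hξ
    have h1 := hω.boundary σ hσ 1 ξ hξ
    have h2 := hω.boundary (-σ) (neg_bank hσ) 0 (-ξ) (neg_mem_slit hξ)
    have h3 := congrArg Complex.re (hF.bank_add_bank_neg hk0 hk1 ha hσ hξ)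
    rw [hlam] at h1 h2
    rw [mul_assoc, Complex.I_mul_im, mul_add, Complex.add_re, h1, h2]
    simp at h3
    linear_combination lm * h3 + lm * hρ'
  have hW : IsSchwarz k 0 (fun _ => 0) fun z => Complex.I * conj τ * (ω z + ω (-z)) := by
    refine ⟨hS', fun σ hσ j ξ hξ => ?_⟩
    rw [bank_const_mul hS _ hσ hξ, bank_add hω.analytic hω.analytic.comp_neg hσ hξ,
      bank_comp_neg hω.analytic hσ hξ]
    fin_cases j
    · have h := him (-σ) (neg_bank hσ) (-ξ) (neg_mem_slit hξ)
      rwa [neg_neg, neg_neg, add_comm] at h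
    · exact him σ hσ ξ hξ
  have h := hW.bank_eq_valueAtInfinity hk0 hk1 hσ hξ
  have h0 : valueAtInfinity (fun z => Complex.I * conj τ * (ω z + ω (-z))) = 0 := by
    refine Complex.ext ?_ ?_
    · rw [valueAtInfinity_const_mul hS, valueAtInfinity_add hω.analytic hω.analytic.comp_neg,
        valueAtInfinity_comp_neg hω.analytic, mul_add, Complex.add_re]
      unfold gamma0 at hγ
      rw [hγ]
      simp
    · rw [← h, hW.boundary σ hσ 1 ξ hξ]
      rfl
  rw [h0, bank_const_mul hS _ hσ hξ, bank_add hω.analytic hω.analytic.comp_neg hσ hξ,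
    bank_comp_neg hω.analytic hσ hξ] at h
  exact eq_neg_of_add_eq_zero_left ((mul_eq_zero.1 h).resolve_left
    (mul_ne_zero Complex.I_ne_zero hτ'))

/-! ### The boundary map -/

theorem SecondSchwarz.re_bank (hk0 : 0 < k) (hk1 : k < 1) (hμ : 0 < μ) {x : ℝ} (hx : 0 < x)
    (hx1 : kap μ x ≠ 1) (hμi : ∀ j, μi j = x) (hF : FirstSchwarz k 0 μ τ τinf cm a F)
    (hω : SecondSchwarz k 0 μ μi τ cm d F ω) (hσ : σ = 1 ∨ σ = -1) (h1 : k < ξ) (h2 : ξ < 1) :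
    (conj τ * bank σ ω ξ).re = (conj τ * cm).re / ξ +
      lam μ x * (-σ * g1 k 0 μ τ τinf cm a ξ + g0 0 μ x τ τinf cm ξ + rho' d F 1) := by
  rw [hω.boundary σ hσ 1 ξ (slit_one_of h1 h2), hF.re_bank hk0 hk1 hσ h1 h2, hμi, g0_eq,
    cStar_eq hμ hx]
  have h3 := lam_ne_zero hx hx1
  have h4 : ξ ≠ 0 := (hk0.trans h1).ne'
  unfold rho'
  field_simp
  ring

theorem absq_ne_zero_of_mem (hk0 : 0 < k) (h1 : k < ξ) (h2 : ξ < 1) : absq k ξ ≠ 0 := by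
  have h := abs_of_pos (hk0.trans h1)
  exact (absq_pos_of_abs hk0 (by rwa [h]) (by rwa [h])).ne'

/-- The component of `conj τ ω` that is not prescribed on the boundary. The mean and the jump of
`Re (conj τ ω)` are known on both slits; the relation for the jump plus `∓|q(ξ)|` times the one for
the mean isolates the imaginary part on a single bank. -/
theorem SecondSchwarz.map_formula (hk0 : 0 < k) (hk1 : k < 1) (hμ : 0 < μ) {x : ℝ} (hx : 0 < x)
    (hx1 : kap μ x ≠ 1) (hμi : ∀ j, μi j = x) (hτ : τ ≠ 0)
    (hF : FirstSchwarz k 0 μ τ τinf cm a F) (ha : a 1 = -a 0)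
    (hω : SecondSchwarz k 0 μ μi τ cm d F ω)
    (hρ : rho μ μi d F 1 = -rho μ μi d F 0) (hγ : gamma0 τ ω = 0) (hσ : σ = 1 ∨ σ = -1)
    (h1 : k < ξ) (h2 : ξ < 1) :
    ∃ v : Fin 2 → ℝ, (∀ j : Fin 2, HasPV k 1 ((-1 : ℝ) ^ (j : ℕ) * ξ)
      (mapIntegrand k (g0 0 μ x τ τinf cm) (g1 k 0 μ τ τinf cm a) (rho' d F 1) σ ξ
        ((-1 : ℝ) ^ (j : ℕ) * ξ)) (v j)) ∧
      (conj τ * bank σ ω ξ - conj τ * cm / ξ).im = -(lam μ x) / Real.pi * (v 0 - v 1) := by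
  have hlm := lam_ne_zero hx hx1
  set lm := lam μ x with hlmdef
  have hsym : ∀ {σ : ℝ} (_ : σ = 1 ∨ σ = -1) {y : ℝ} (_ : y ∈ slit k 1),
      bank σ ω y = -bank (-σ) ω (-y) := fun hσ _ hy =>
    hω.bank_eq_neg hk0 hk1 hlm (fun j => by rw [hμi j]) hτ hF ha hρ hγ hσ hy
  have hξ := slit_one_of h1 h2
  have hξ0 : 0 < ξ := hk0.trans h1
  have hA := hω.analytic.const_mul (conj τ)
  have hb : ∀ {σ : ℝ} (_ : σ = 1 ∨ σ = -1) {i : Fin 2} {y : ℝ} (_ : y ∈ slit k i),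
      bank σ (fun z => conj τ * ω z) y = conj τ * bank σ ω y :=
    fun hσ _ _ hy => bank_const_mul hω.analytic _ hσ hy
  set Ψ : ℂ → ℂ := fun z => conj τ * ω z with hΨ
  set p : ℂ := conj τ * cm with hp
  set G₀ := g0 0 μ x τ τinf cm with hG₀
  set G₁ := g1 k 0 μ τ τinf cm a with hG₁
  set r := rho' d F 1 with hr
  have hq := absq_pos_of_abs hk0 (x := ξ) (by rwa [abs_of_pos hξ0]) (by rwa [abs_of_pos hξ0])
  set D : ℝ → ℝ := fun y => (bank 1 Ψ y - bank (-1) Ψ y).re with hD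
  set S : ℝ → ℝ := fun y => (bank 1 Ψ y + bank (-1) Ψ y - 2 * p / y).re with hS
  -- the data on the right slit
  have hre : ∀ {σ : ℝ} (_ : σ = 1 ∨ σ = -1) {y : ℝ} (_ : k < y) (_ : y < 1),
      (bank σ Ψ y).re = p.re / y + lm * (-σ * G₁ y + G₀ y + r) := fun hσ _ h1 h2 => by
    rw [hb hσ (slit_one_of h1 h2)]
    exact hω.re_bank hk0 hk1 hμ hx hx1 hμi hF hσ h1 h2
  have hDr : ∀ y, k < y → y < 1 → D y = -2 * lm * G₁ y := fun y h1 h2 => by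
    rw [hD]
    beta_reduce
    rw [Complex.sub_re, hre (Or.inl rfl) h1 h2, hre (Or.inr rfl) h1 h2]
    ring
  have hSr : ∀ y, k < y → y < 1 → S y = 2 * lm * (G₀ y + r) := fun y h1 h2 => by
    rw [hS]
    beta_reduce
    rw [Complex.sub_re, Complex.add_re, hre (Or.inl rfl) h1 h2, hre (Or.inr rfl) h1 h2,
      Complex.div_ofReal_re]
    simp
    ring
  -- the data on the left slit, by the symmetry of the boundary values
  have hsymΨ : ∀ {σ : ℝ} (_ : σ = 1 ∨ σ = -1) {y : ℝ} (_ : y ∈ slit k 1),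
      bank σ Ψ (-y) = -bank (-σ) Ψ y := fun {σ} hσ y hy => by
    rw [hb hσ (neg_mem_slit hy), hb (neg_bank hσ) hy, hsym (neg_bank hσ) hy, neg_neg]
    ring
  have hDn : ∀ y ∈ slit k 1, D (-y) = D y := fun y hy => by
    rw [hD]
    beta_reduce
    rw [hsymΨ (Or.inl rfl) hy, hsymΨ (Or.inr rfl) hy, neg_neg]
    congr 1
    ring
  have hSn : ∀ y ∈ slit k 1, S (-y) = -S y := fun y hy => by
    rw [hS]
    beta_reduce
    rw [hsymΨ (Or.inl rfl) hy, hsymΨ (Or.inr rfl) hy, neg_neg, ← Complex.neg_re, Complex.ofReal_neg,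
      div_neg]
    congr 1
    ring
  -- the combination for which the right-hand sides add up to a multiple of the value on one bank
  have hsum := (hA.hasPVSum_jump hk0 h1 h2).add
    ((hA.hasPVSum_mean hk0 hk1 h1 h2).const_mul (-σ * absq k ξ))
  set L := -Real.pi * (bank 1 Ψ ξ + bank (-1) Ψ ξ - 2 * p / ξ - 2 * valueAtInfinity Ψ).im +
    -σ * absq k ξ * (Real.pi * ((bank 1 Ψ ξ - bank (-1) Ψ ξ).im / absq k ξ)) with hL
  have hnot : ξ ∉ slit k 0 := fun h => by
    have : ξ ≤ -k := h.2
    linarith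
  -- the integral over the left slit is regular
  have hcD : ContinuousOn D (slit k 0) := Complex.continuous_re.comp_continuousOn
    ((hA.continuousOn_bank hk0 (Or.inl rfl) 0).sub (hA.continuousOn_bank hk0 (Or.inr rfl) 0))
  have hcS : ContinuousOn S (slit k 0) := Complex.continuous_re.comp_continuousOn
    (((hA.continuousOn_bank hk0 (Or.inl rfl) 0).add (hA.continuousOn_bank hk0 (Or.inr rfl) 0)).sub
      (continuousOn_const.div Complex.continuous_ofReal.continuousOn fun y hy => by
        exact_mod_cast ne_zero_of_mem_slit hk0 hy))
  have hint : IntegrableOn (fun y => D y / (y - ξ) + -σ * absq k ξ * ((-1) ^ ((0 : Fin 2) : ℕ) *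
      (S y / (absq k y * (y - ξ))))) (Set.Icc (lo k 0) (hi k 0)) := by
    refine IntegrableOn.add ?_ (((integrableOn_div_absq_mul_sub hk0 hk1 hcS hnot).const_mul
      _).const_mul _)
    exact (hcD.div (by fun_prop) fun y hy => sub_ne_zero.2 fun he : y = ξ =>
      hnot (he ▸ hy)).integrableOn_compact isCompact_Icc
  have hleft := HasPV.of_integrableOn ξ hint
  set w := ∫ y in Set.Icc (lo k 0) (hi k 0), (D y / (y - ξ) + -σ * absq k ξ *
    ((-1) ^ ((0 : Fin 2) : ℕ) * (S y / (absq k y * (y - ξ))))) with hw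
  have hright := hsum.hasPV_one hleft
  have hneg := hleft.comp_neg
  have hends : -hi k 0 = k ∧ -lo k 0 = 1 := by simp [lo, hi]
  rw [hends.1, hends.2] at hneg
  have hae : ∀ᵐ y ∂volume.restrict (Set.Icc k 1), k < y ∧ y < 1 ∧ y ∈ slit k 1 := by
    filter_upwards [ae_mem_slit_interior k hk0 1] with y hy
    have hy0 : |y| = y := abs_of_nonneg (hk0.le.trans hy.1.1)
    rw [hy0] at hy
    exact ⟨hy.2.1, hy.2.2, hy.1⟩
  refine ⟨![1 / (2 * lm) * (L - w), -1 / (2 * lm) * w], fun j => ?_, ?_⟩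
  · fin_cases j
    · have h3 := hright.const_mul (1 / (2 * lm))
      simp only [Fin.zero_eta, pow_zero, one_mul]
      refine h3.congr_ae ?_
      filter_upwards [hae] with y hy
      rw [show (bank 1 Ψ y - bank (-1) Ψ y).re = D y from rfl,
        show (bank 1 Ψ y + bank (-1) Ψ y - 2 * p / y).re = S y from rfl,
        hDr y hy.1 hy.2.1, hSr y hy.1 hy.2.1]
      unfold mapIntegrand
      have hy0 := absq_ne_zero_of_mem hk0 hy.1 hy.2.1
      simp only [Fin.val_one, pow_one]
      generalize y - ξ = δ
      field_simp
    · have h3 := hneg.const_mul (-1 / (2 * lm))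
      simp only [Fin.mk_one, pow_one, neg_one_mul]
      refine h3.congr_ae ?_
      filter_upwards [hae] with y hy
      rw [hDn y hy.2.2, hSn y hy.2.2, hDr y hy.1 hy.2.1, hSr y hy.1 hy.2.1, absq_neg]
      unfold mapIntegrand
      have hy0 := absq_ne_zero_of_mem hk0 hy.1 hy.2.1
      rw [Fin.val_zero, pow_zero, one_mul, show -y - ξ = -(y - -ξ) by ring]
      generalize y - -ξ = δ
      field_simp
      ring
  · have hP : (valueAtInfinity Ψ).im = 0 := by
      unfold gamma0 at hγ
      rw [hΨ, valueAtInfinity_const_mul hω.analytic]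
      rw [mul_assoc, Complex.I_mul_re] at hγ
      linarith
    rw [← hb hσ hξ]
    have hpi := Real.pi_pos
    simp only [Matrix.cons_val_zero, Matrix.cons_val_one]
    have hL' : L = -2 * Real.pi * (bank σ Ψ ξ - p / ξ).im := by
      rw [hL, mul_div_assoc 2 p]
      have h3 : -σ * absq k ξ * (Real.pi * ((bank 1 Ψ ξ - bank (-1) Ψ ξ).im / absq k ξ)) =
        -σ * Real.pi * (bank 1 Ψ ξ - bank (-1) Ψ ξ).im := by field_simp
      rw [h3]
      simp only [Complex.sub_im, Complex.add_im, Complex.mul_im,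
        Complex.re_ofNat, Complex.im_ofNat, zero_mul, add_zero, hP]
      rcases hσ with rfl | rfl <;> ring
    rw [hL']
    field_simp
    ring

/-! ### Symmetry of the contours and of the inclusions -/

theorem contour_one_eq (h : ∀ σ : ℝ, (σ = 1 ∨ σ = -1) → ∀ ξ ∈ slit k 1,
    bank σ ω ξ = -bank (-σ) ω (-ξ)) : contour k ω 1 = (fun z => -z) '' contour k ω 0 := by
  ext z
  constructor
  · rintro ⟨ξ, hξ, rfl | rfl⟩
    · exact ⟨_, ⟨-ξ, neg_mem_slit hξ, Or.inr rfl⟩, (h 1 (Or.inl rfl) ξ hξ).symm⟩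
    · refine ⟨_, ⟨-ξ, neg_mem_slit hξ, Or.inl rfl⟩, ?_⟩
      rw [h (-1) (Or.inr rfl) ξ hξ, neg_neg]
  · rintro ⟨_, ⟨ξ, hξ, rfl | rfl⟩, rfl⟩
    · refine ⟨-ξ, neg_mem_slit hξ, Or.inr ?_⟩
      rw [h (-1) (Or.inr rfl) _ (neg_mem_slit hξ), neg_neg, neg_neg]
    · refine ⟨-ξ, neg_mem_slit hξ, Or.inl ?_⟩
      rw [h 1 (Or.inl rfl) _ (neg_mem_slit hξ), neg_neg]

theorem inclusion_one_eq (h : contour k ω 1 = (fun z => -z) '' contour k ω 0) :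
    inclusion k ω 1 = (fun z => -z) '' inclusion k ω 0 := by
  have hmem : ∀ z, -z ∈ contour k ω 1 ↔ z ∈ contour k ω 0 := fun z => by
    rw [h, Set.image_neg_eq_neg, Set.neg_mem_neg]
  have hcompl : (contour k ω 1)ᶜ = Homeomorph.neg ℂ '' (contour k ω 0)ᶜ := by
    rw [Set.image_compl_eq (Homeomorph.neg ℂ).bijective, h]
    rfl
  have hbdd : ∀ z ∉ contour k ω 0,
      Bornology.IsBounded (connectedComponentIn (contour k ω 1)ᶜ (-z)) ↔
        Bornology.IsBounded (connectedComponentIn (contour k ω 0)ᶜ z) := by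
    intro z hz
    rw [hcompl, show -z = Homeomorph.neg ℂ z from rfl,
      ← (Homeomorph.neg ℂ).image_connectedComponentIn hz]
    change Bornology.IsBounded ((fun z => -z) '' _) ↔ _
    simp only [isBounded_iff_forall_norm_le, Set.forall_mem_image, norm_neg]
  ext z
  rw [Set.image_neg_eq_neg, Set.mem_neg]
  unfold inclusion
  rw [Set.mem_ofPred_eq, Set.mem_ofPred_eq]
  have h1 := hmem (-z)
  rw [neg_neg] at h1
  rw [h1]
  refine and_congr_right fun hz => ?_
  have := hbdd (-z) hz
  rwa [neg_neg] at this

end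

end TwoSlit

theorem mainTheorem3 (k : ℝ) (hk0 : 0 < k) (hk1 : k < 1)
    (μ : ℝ) (hμ : 0 < μ) (μi : Fin 2 → ℝ) (hμi : ∀ j, 0 < μi j)
    (hκ : kap μ (μi 0) = kap μ (μi 1)) (hκ1 : kap μ (μi 0) ≠ 1)
    (τ τinf cm : ℂ) (hτ : τ ≠ 0) (hcm : cm ≠ 0) :
    -- the two elliptic integrals converge
    (IntervalIntegrable (fun ξ => 1 / absq k ξ) volume k 1 ∧
      IntervalIntegrable (fun ξ => 1 / (ξ * absq k ξ)) volume k 1) ∧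
    -- solvability of the first Schwarz problem, and its antisymmetric constants
    (∀ a : Fin 2 → ℝ, (∃ F, FirstSchwarz k 0 μ τ τinf cm a F) ↔
      a 1 - a 0 = 2 * ((resF μ τ τinf cm).im * (ellI k)⁻¹ * ellJ k)) ∧
    (∀ a : Fin 2 → ℝ, ((∃ F, FirstSchwarz k 0 μ τ τinf cm a F) ∧ a 1 = -a 0) ↔
      (a 1 = -a 0 ∧ a 1 = (resF μ τ τinf cm).im * (ellI k)⁻¹ * ellJ k)) ∧
    -- solvability of the second Schwarz problem, and its antisymmetric constants
    (∀ (a : Fin 2 → ℝ) (F : ℂ → ℂ), FirstSchwarz k 0 μ τ τinf cm a F → ∀ d : Fin 2 → ℝ,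
      ((∃ ω, SecondSchwarz k 0 μ μi τ cm d F ω) ↔
        rho μ μi d F 1 - rho μ μi d F 0 =
          2 * (-(μi 0 * cStar μ (μi 0) τ τinf cm / (1 - kap μ (μi 0))) *
            (ellI k)⁻¹ * ellJ k)) ∧
      (((∃ ω, SecondSchwarz k 0 μ μi τ cm d F ω) ∧ rho μ μi d F 1 = -rho μ μi d F 0) ↔
        (rho μ μi d F 1 = -rho μ μi d F 0 ∧
          rho μ μi d F 1 = -(μi 0 * cStar μ (μi 0) τ τinf cm / (1 - kap μ (μi 0))) *
            (ellI k)⁻¹ * ellJ k))) ∧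
    -- `g₀` and `g₁` are odd and have an explicit form
    (∀ ξ : ℝ, k ≤ |ξ| → |ξ| ≤ 1 →
      g0 0 μ (μi 0) τ τinf cm (-ξ) = -g0 0 μ (μi 0) τ τinf cm ξ ∧
      g0 0 μ (μi 0) τ τinf cm ξ = cStar μ (μi 0) τ τinf cm / ξ) ∧
    (∀ a : Fin 2 → ℝ, a 1 = -a 0 → ∀ ξ : ℝ, k < |ξ| → |ξ| < 1 →
      (∀ j, PVExists (lo k j) (hi k j) ξ (g1Integrand k 0 μ τ τinf cm a ξ j)) ∧
      PVExists k 1 |ξ| (g1SymIntegrand k (resF μ τ τinf cm).im (a 1) ξ) ∧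
      g1 k 0 μ τ τinf cm a (-ξ) = -g1 k 0 μ τ τinf cm a ξ ∧
      g1 k 0 μ τ τinf cm a ξ = 2 * ξ * absq k ξ / Real.pi *
        pv k 1 |ξ| (g1SymIntegrand k (resF μ τ τinf cm).im (a 1) ξ)) ∧
    -- the map and the inclusions
    (∀ (a d : Fin 2 → ℝ) (F ω : ℂ → ℂ), FirstSchwarz k 0 μ τ τinf cm a F → a 1 = -a 0 →
      SecondSchwarz k 0 μ μi τ cm d F ω → rho μ μi d F 1 = -rho μ μi d F 0 →
      -- the additive constant may be dropped
      (SecondSchwarz k 0 μ μi τ cm d F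
          (fun ζ => ω ζ - (-Complex.I * (gamma0 τ ω : ℂ) / conj τ)) ∧
        gamma0 τ (fun ζ => ω ζ - (-Complex.I * (gamma0 τ ω : ℂ) / conj τ)) = 0) ∧
      (gamma0 τ ω = 0 →
        -- explicit boundary values
        (∀ σ : ℝ, (σ = 1 ∨ σ = -1) → ∀ ξ : ℝ, k < ξ → ξ < 1 →
          (∀ j : Fin 2, PVExists k 1 ((-1 : ℝ) ^ (j : ℕ) * ξ)
            (mapIntegrand k (g0 0 μ (μi 0) τ τinf cm) (g1 k 0 μ τ τinf cm a) (rho' d F 1) σ ξ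
              ((-1 : ℝ) ^ (j : ℕ) * ξ))) ∧
          bank (-σ) ω (-ξ) = -cm / (ξ : ℂ) +
            Complex.I * (μ : ℂ) * (lamTilde μ (μi 0) : ℂ) / conj τ *
              (-(σ : ℂ) * Complex.I * (g1 k 0 μ τ τinf cm a ξ : ℂ)
                + Complex.I * (g0 0 μ (μi 0) τ τinf cm ξ : ℂ)
                + Complex.I * (rho' d F 1 : ℂ)
                + (((1 / Real.pi) * ∑ j : Fin 2, (-1 : ℝ) ^ (j : ℕ) *
                    pv k 1 ((-1 : ℝ) ^ (j : ℕ) * ξ)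
                      (mapIntegrand k (g0 0 μ (μi 0) τ τinf cm) (g1 k 0 μ τ τinf cm a)
                        (rho' d F 1) σ ξ ((-1 : ℝ) ^ (j : ℕ) * ξ)) : ℝ) : ℂ))) ∧
        -- symmetry of the boundary map
        (∀ σ : ℝ, (σ = 1 ∨ σ = -1) → ∀ ξ ∈ slit k 1, bank σ ω ξ = -bank (-σ) ω (-ξ)) ∧
        -- symmetry of the contours and of the inclusions with respect to the origin
        contour k ω 1 = (fun z => -z) '' contour k ω 0 ∧
        inclusion k ω 1 = (fun z => -z) '' inclusion k ω 0)) := by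
  have hμ01 : ∀ j, μi j = μi 0 := by
    have h := (kap_eq_iff hμ).1 hκ
    intro j
    fin_cases j
    · rfl
    · exact h.symm
  have hlm := lam_ne_zero (hμi 0) hκ1
  have hlam : ∀ j, lam μ (μi j) = lam μ (μi 0) := fun j => by rw [hμ01 j]
  have hfirst : ∀ a : Fin 2 → ℝ, (∃ F, FirstSchwarz k 0 μ τ τinf cm a F) ↔
      a 1 - a 0 = 2 * ((resF μ τ τinf cm).im * (ellI k)⁻¹ * ellJ k) := fun a => by
    rw [← exists_isSchwarz_iff hk0 hk1]
    exact ⟨fun ⟨F, h⟩ => ⟨F, h.isSchwarz⟩, fun ⟨F, h⟩ => ⟨F, h.1, h.2⟩⟩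
  have hanti : ∀ x y c : ℝ, y = -x → (y - x = 2 * c ↔ y = c) := by
    rintro x y c rfl
    constructor <;> intro h <;> linarith
  refine ⟨⟨intervalIntegrable_inv_absq hk0 hk1 k 1, intervalIntegrable_inv_mul_absq hk0 hk1⟩,
    hfirst, fun a => ?_, fun a F hF d => ?_, fun ξ _ _ => ?_, fun a ha ξ h1 h2 => ?_,
    fun a d F ω hF ha hω hρ => ?_⟩
  · rw [hfirst, and_comm]
    exact and_congr_right fun ha => hanti _ _ _ ha
  · have h := secondSchwarz_solvable_iff (d := d) hk0 hk1 hμ (hμi 0) hκ1 hμ01 hτ hF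
    refine ⟨h, ?_⟩
    rw [h, and_comm]
    exact and_congr_right fun hρ => hanti _ _ _ hρ
  · rw [g0_eq, g0_eq, div_neg]
    exact ⟨rfl, rfl⟩
  · refine ⟨fun j => ?_, ?_, g1_neg hk0 hk1 ha h1 h2, g1_eq_pv hk0 hk1 ha h1 h2⟩
    · obtain ⟨v, hv⟩ := exists_hasPV_g1Integrand (μ := μ) (τ := τ) (τinf := τinf) (cm := cm)
        (a := a) hk0 hk1 h1 h2 j
      exact hv.pvExists
    · obtain ⟨v, hv⟩ := exists_hasPV_g1SymIntegrand hk0 hk1 h1 h2 (resF μ τ τinf cm).im (a 1)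
      exact hv.pvExists
  · refine ⟨hω.sub_const hτ, fun hγ => ?_⟩
    have hsym : ∀ σ : ℝ, (σ = 1 ∨ σ = -1) → ∀ ξ ∈ slit k 1, bank σ ω ξ = -bank (-σ) ω (-ξ) :=
      fun σ hσ ξ hξ => hω.bank_eq_neg hk0 hk1 hlm hlam hτ hF ha hρ hγ hσ hξ
    have hcont := contour_one_eq hsym
    refine ⟨fun σ hσ ξ h1 h2 => ?_, hsym, hcont, inclusion_one_eq hcont⟩
    obtain ⟨v, hv, him⟩ := hω.map_formula hk0 hk1 hμ (hμi 0) hκ1 hμ01 hτ hF ha hρ hγ hσ h1 h2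
    refine ⟨fun j => (hv j).pvExists, ?_⟩
    have hτ' : conj τ ≠ 0 := (map_ne_zero _).2 hτ
    have hξ0 : (ξ : ℂ) ≠ 0 := by exact_mod_cast (hk0.trans h1).ne'
    have hre := hω.re_bank hk0 hk1 hμ (hμi 0) hκ1 hμ01 hF hσ h1 h2
    have hbank : conj τ * bank σ ω ξ = conj τ * cm / ξ +
        ((lam μ (μi 0) * (-σ * g1 k 0 μ τ τinf cm a ξ + g0 0 μ (μi 0) τ τinf cm ξ +
          rho' d F 1) : ℝ) : ℂ) +
        ((-(lam μ (μi 0)) / Real.pi * (v 0 - v 1) : ℝ) : ℂ) * Complex.I := by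
      rw [Complex.sub_im] at him
      refine Complex.ext ?_ ?_
      · rw [hre, Complex.add_re, Complex.add_re, Complex.ofReal_re, Complex.re_ofReal_mul,
          Complex.I_re, mul_zero, add_zero, Complex.div_ofReal_re]
      · rw [Complex.add_im, Complex.add_im, Complex.ofReal_im, Complex.im_ofReal_mul, Complex.I_im]
        linarith
    have hneg : bank (-σ) ω (-ξ) = -bank σ ω ξ := by
      rw [hsym σ hσ ξ (slit_one_of h1 h2), neg_neg]
    have hμlam : (lam μ (μi 0) : ℂ) = μ * lamTilde μ (μi 0) := by
      rw [← mul_lamTilde hμ]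
      push_cast
      rfl
    have hpi : (Real.pi : ℂ) ≠ 0 := by exact_mod_cast Real.pi_ne_zero
    simp only [Fin.sum_univ_two, (hv _).pv_eq]
    refine mul_left_cancel₀ hτ' ?_
    rw [hneg, mul_neg, hbank]
    push_cast
    rw [hμlam]
    simp only [Fin.val_zero, Fin.val_one, pow_zero, pow_one]
    field_simp
    linear_combination (-(ξ * μ * lamTilde μ (μi 0) * (-(σ * g1 k 0 μ τ τinf cm a ξ) +
      g0 0 μ (μi 0) τ τinf cm ξ + rho' d F 1) * Real.pi : ℂ)) * Complex.I_sq
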